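/- **Theorem 4.1 (Equivariant $b^m$-Moser theorem for surfaces).** Let $m\ge 1$, let $S$ be a compact smooth surface without boundary (not necessarily connected or orientable), and let $Z\subset S$ be a closed embedded smooth $1$-dimensional submanifold, that is, a (finite, possibly empty) union of pairwise disjoint smooth simple closed curves. Fix a function $r$ on $S$ that near $Z$ is a distance function to $Z$: every point of $Z$ has a neighbourhood $U$ with a smooth function $x:U\to\mathbb R$ such that $Z\cap U=\{x=0\}$, $dx\neq 0$ on $U$ and $|x|=r|_U$ (for example, the distance to $Z$ in a Riemannian metric; no global choice of $x$ is required). For $k\ge 1$, a *$b^m$-form of degree $k$* on $(S,Z)$ is a smooth $k$-form $\omega$ on $S\setminus Z$ such that every point of $Z$ has a neighbourhood $U$ with a function $x$ as above on which $\omega=\frac{dx}{x^m}\wedge\alpha+\beta$ on $U\setminus Z$, with $\alpha$ a smooth $(k-1)$-form and $\beta$ a smooth $k$-form on $U$. Equivalently, $\omega$ is a section over $S$ of $\Lambda^k({}^{b^m}T^*S)$, where ${}^{b^m}T^*S$ is dual to the bundle ${}^{b^m}TS$ whose sections are generated near $Z$ by $x^m\partial_x,\partial_y$ (for local coordinates $(x,y)$).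 The differential of a $b^m$-form is its exterior derivative on $S\setminus Z$, and two closed $b^m$-forms of degree $2$ have the same *$b^m$-cohomology class* if their difference is the differential of a $b^m$-form of degree $1$. A *$b^m$-symplectic form* on $(S,Z)$ is a closed $b^m$-form of degree $2$ that is nondegenerate on the fibre of ${}^{b^m}TS$ at every point of $S$. Let $G$ be a compact Lie group acting smoothly on $S$, and let $\omega_0,\omega_1$ be two $b^m$-symplectic forms on $(S,Z)$ that are invariant under the action (every $g\in G$ maps $Z$ onto $Z$ and pulls $\omega_i$ back to $\omega_i$, $i=0,1$) and that define the same $b^m$-cohomology class, $[\omega_0]=[\omega_1]$. Then there is a smooth diffeomorphism $\gamma:S\to S$ such that $\gamma(g\cdot p)=g\cdot\gamma(p)$ for all $g\in G$, $p\in S$, $\gamma(Z)=Z$, and $\gamma^*\omega_1=\omega_0$. -/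

import Mathlib

open scoped Manifold ContDiff Topology

noncomputable section

namespace BmGeometry

variable {E : Type*} [NormedAddCommGroup E] [NormedSpace ℝ E]
variable {M : Type*} [TopologicalSpace M] [ChartedSpace E M]
variable {N : Type*} [TopologicalSpace N] [ChartedSpace E N]

/-- Differential forms of degree `k` on a manifold modelled on `E` (without regularity):
alternating `k`-linear forms `η p` on the tangent spaces `T_p M`. The tangent space
`TangentSpace 𝓘(ℝ, E) p` is by definition the vector space `E` (through the chart around `p`). -/
abbrev DForm (E : Type*) [NormedAddCommGroup E] [NormedSpace ℝ E]
    (M : Type*) [TopologicalSpace M] [ChartedSpace E M] (k : ℕ) : Type _ :=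
  M → E [⋀^Fin k]→L[ℝ] ℝ

/-- The derivative `T_p M → T_{f p} N` of a map `f` between manifolds modelled on `E`. -/
def tangentMapAt (E : Type*) [NormedAddCommGroup E] [NormedSpace ℝ E]
    {M : Type*} [TopologicalSpace M] [ChartedSpace E M]
    {N : Type*} [TopologicalSpace N] [ChartedSpace E N] (f : M → N) (p : M) : E →L[ℝ] E :=
  mfderiv 𝓘(ℝ, E) 𝓘(ℝ, E) f p

/-- The differential `dx : T_p M → ℝ` of a real function at `p`. -/
def differential (E : Type*) [NormedAddCommGroup E] [NormedSpace ℝ E]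
    {M : Type*} [TopologicalSpace M] [ChartedSpace E M] (x : M → ℝ) (p : M) : E →L[ℝ] ℝ :=
  mfderiv 𝓘(ℝ, E) 𝓘(ℝ, ℝ) x p

/-- The pullback `f^* η`. -/
def pullback {k : ℕ} (f : M → N) (η : DForm E N k) : DForm E M k :=
  fun p => (η (f p)).compContinuousLinearMap (tangentMapAt E f p)

/-- The expression of `η` in the chart around `c`: its pullback under the inverse of the chart.
It is meaningful on the target of the chart. -/
def inChart {k : ℕ} (η : DForm E M k) (c : M) : E → E [⋀^Fin k]→L[ℝ] ℝ :=
  pullback (M := E) (N := M) (extChartAt 𝓘(ℝ, E) c).symm η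

/-- `η` is a smooth form on the open set `U`: all its chart expressions are smooth there. -/
def SmoothFormOn {k : ℕ} (η : DForm E M k) (U : Set M) : Prop :=
  ∀ c : M, ContDiffOn ℝ ∞ (inChart η c)
    ((extChartAt 𝓘(ℝ, E) c).target ∩ (extChartAt 𝓘(ℝ, E) c).symm ⁻¹' U)

/-- The exterior derivative `dη` at `p`, computed in the chart around `p` and transported back. -/
def extDer {k : ℕ} (η : DForm E M k) : DForm E M (k + 1) := fun p =>
  (extDeriv (inChart η p) (extChartAt 𝓘(ℝ, E) p p)).compContinuousLinearMap
    (tangentMapAt E (extChartAt 𝓘(ℝ, E) p) p)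

/-- The form `dx ∧ α`:
`(dx ∧ α)(v₀, …, v_k) = ∑ i, (-1)^i dx(v_i) α(v₀, …, v̂_i, …, v_k)`. -/
def dWedge {k : ℕ} (x : M → ℝ) (α : DForm E M k) : DForm E M (k + 1) := fun p =>
  ContinuousAlternatingMap.alternatizeUncurryFin ((differential E x p).smulRight (α p))

/-- `x` is a smooth defining function of `Z` on the open set `U`, without critical points in `U`. -/
structure IsLocalDefining (E : Type*) [NormedAddCommGroup E] [NormedSpace ℝ E]
    {M : Type*} [TopologicalSpace M] [ChartedSpace E M]
    (Z U : Set M) (x : M → ℝ) : Prop where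
  isOpen : IsOpen U
  smooth : ContMDiffOn 𝓘(ℝ, E) 𝓘(ℝ, ℝ) ∞ x U
  regular : ∀ p ∈ U, differential E x p ≠ 0
  zero_iff : ∀ p ∈ U, x p = 0 ↔ p ∈ Z

/-- `Z` is a closed embedded smooth hypersurface. On a compact surface, this says that `Z` is a
(finite, possibly empty) union of pairwise disjoint smooth simple closed curves. -/
structure IsHypersurface (E : Type*) [NormedAddCommGroup E] [NormedSpace ℝ E]
    {M : Type*} [TopologicalSpace M] [ChartedSpace E M] (Z : Set M) : Prop where
  isClosed : IsClosed Z
  exists_defining : ∀ p ∈ Z, ∃ (U : Set M) (x : M → ℝ), p ∈ U ∧ IsLocalDefining E Z U x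

/-- `r` is, near `Z`, a distance function to `Z`: around every point of `Z` it is the absolute
value of a smooth defining function (the signed distance). The distance to `Z` in a Riemannian
metric has this property, and near `Z` every such `r` is the distance in a suitable metric.
No global defining function is required, so that one-sided hypersurfaces are allowed. -/
def IsDistanceTo (E : Type*) [NormedAddCommGroup E] [NormedSpace ℝ E]
    {M : Type*} [TopologicalSpace M] [ChartedSpace E M] (Z : Set M) (r : M → ℝ) : Prop :=
  ∀ p ∈ Z, ∃ (U : Set M) (x : M → ℝ), p ∈ U ∧ IsLocalDefining E Z U x ∧ ∀ q ∈ U, |x q| = r q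

/-- `η = (dx / x^m) ∧ α + β` on `U \ Z`, where `x` is a local defining function of `Z` on `U` with
`|x| = r`, and `α`, `β` are smooth forms on `U` (across `Z`). These are the local expressions of
the sections over `U` of the exterior powers of the `b^m`-cotangent bundle, that is, of the bundle
generated by `dx / x^m, dx_1, …, dx_{n-1}`. -/
structure IsBmDecomposition {k : ℕ} (m : ℕ) (Z : Set M) (r : M → ℝ) (η : DForm E M (k + 1))
    (U : Set M) (x : M → ℝ) (α : DForm E M k) (β : DForm E M (k + 1)) : Prop where
  defining : IsLocalDefining E Z U x
  abs_eq : ∀ q ∈ U, |x q| = r q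
  smooth_left : SmoothFormOn α U
  smooth_right : SmoothFormOn β U
  eq : ∀ q ∈ U \ Z, η q = ((x q) ^ m)⁻¹ • dWedge x α q + β q

/-- `η` is a `b^m`-form of degree `k + 1` on `(M, Z)`, the `b^m`-cotangent bundle being formed with
the distance function `r`. A section of a bundle over `M` is determined by its restriction to the
dense set `M \ Z`, where a `b^m`-form is an ordinary form; so a `b^m`-form is given here
by a form on `M \ Z`, and the values of `η` on `Z` are irrelevant. -/
structure IsBmForm {k : ℕ} (m : ℕ) (Z : Set M) (r : M → ℝ) (η : DForm E M (k + 1)) : Prop where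
  smooth : SmoothFormOn η Zᶜ
  local_form : ∀ p ∈ Z, ∃ (U : Set M) (x : M → ℝ) (α : DForm E M k) (β : DForm E M (k + 1)),
    p ∈ U ∧ IsBmDecomposition m Z r η U x α β

/-- A `b^m`-symplectic form on `(M, Z)`: a closed `b^m`-form `η` of degree two that is
nondegenerate, i.e. `η_p` has maximal rank on the fibre of the `b^m`-tangent bundle for all `p`.
For `p ∉ Z` this fibre is `T_p M`. For `p ∈ Z` it is `ℝ ⊕ ker dx_p = ℝ ⊕ T_p Z`, where `(s, v)`
stands for `s x^m ∂_x + v`, and the value of `η = (dx / x^m) ∧ α + β` on `(s, v)` and `(t, w)` is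
`s α(w) - t α(v) + β(v, w)`. -/
structure IsBmSymplectic (m : ℕ) (Z : Set M) (r : M → ℝ) (η : DForm E M 2) : Prop where
  isBmForm : IsBmForm m Z r η
  closed : ∀ p ∉ Z, extDer η p = 0
  nondegenerate_off : ∀ p ∉ Z, ∀ v : E, (∀ w, η p ![v, w] = 0) → v = 0
  nondegenerate_on : ∀ p ∈ Z, ∀ (U : Set M) (x : M → ℝ) (α : DForm E M 1) (β : DForm E M 2),
    p ∈ U → IsBmDecomposition m Z r η U x α β →
    ∀ (s : ℝ) (v : E), differential E x p v = 0 →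
      (∀ (t : ℝ) (w : E), differential E x p w = 0 →
        s * α p ![w] - t * α p ![v] + β p ![v, w] = 0) →
      s = 0 ∧ v = 0

/-- `[η₀] = [η₁]` in `b^m`-cohomology (in degree `k + 2`): the difference is the exterior
derivative of a `b^m`-form. The differential of the `b^m`-de Rham complex
is the exterior derivative on the dense set `M \ Z`. -/
def SameBmClass {k : ℕ} (m : ℕ) (Z : Set M) (r : M → ℝ) (η₀ η₁ : DForm E M (k + 2)) : Prop :=
  ∃ α : DForm E M (k + 1), IsBmForm m Z r α ∧ ∀ p ∉ Z, η₁ p - η₀ p = extDer α p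

/-- The map `f` of the pair `(M, Z)` pulls the `b^m`-form `η₁` back to the `b^m`-form `η₀`:
`f` preserves `Z` and its complement, and `f^* η₁ = η₀` on the dense set `M \ Z`. -/
def PullsBackTo {k : ℕ} (Z : Set M) (f : M → M) (η₁ η₀ : DForm E M k) : Prop :=
  (∀ p, f p ∈ Z ↔ p ∈ Z) ∧ ∀ p ∉ Z, pullback f η₁ p = η₀ p

/-- `η` is invariant under the action of `G`. -/
def IsInvariant {k : ℕ} (G : Type*) [Group G] [MulAction G M] (Z : Set M) (η : DForm E M k) :
    Prop :=
  ∀ g : G, PullsBackTo Z (fun p => g • p) η η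

end BmGeometry

end

/-!
The proof is Moser's method, carried out for a vector field that extends smoothly across `Z`.

Let `α` be a `b^m`-form with `dα = ω₁ - ω₀`. Near `Z` the products of `ω₀`, `ω₁`, `α` with `x ^ m`
are smooth forms, the first two without zeros. Hence the quotient `h = ω₁ / ω₀` and the solution `X`
of `ι_X ω₀ = -α` extend smoothly over the whole surface (`exists_field_and_ratio`), and `X` is
tangent to `Z`, because `x ^ m α` is a multiple of `dx` there. In terms of `X` the equation
`dα = ω₁ - ω₀` says that the divergence of `X` with respect to `ω₀` is `1 - h`
(`hasDivergence_of_contraction`). From here on only the smooth objects `X` and `h`, and `ω₀` off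
`Z`, play a role.

The two forms have to induce the same orientations, that is, `h > 0`. Since `h` has no zeros,
`{h < 0}` is open and closed.
* If it met `Z`, write `α = f dx / x ^ m + β` and take a point of `{h < 0} ∩ Z` where `|f|`, which
  does not depend on the choice of `x`, is maximal. There `df` is a multiple of `dx`, so that `ω₀`
  and `ω₁` have the same leading coefficient, and `h = 1`, a contradiction
  (`disjoint_of_ratio_neg`).
* If it is nonempty and misses `Z`, it is a compact surface on which all the `(1 + t) ω₀ - t ω₁`,
  `0 ≤ t ≤ 1`, are area forms, and the method itself, applied to `-X`, yields a diffeomorphism that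
  pulls `2 ω₀ - ω₁ = (2 - h) ω₀` back to `ω₀`. As `2 - h ≥ 2`, its iterates shrink areas by
  `2 ^ (-n)`, which is impossible (`isEmpty_of_ratio_neg`, `false_of_area_contraction`).

To obtain an equivariant map, `X` is averaged over the group. Averaging `α` instead would not do: an
element of `G` preserves `Z` but not the function `r`, so it need not map `b^m`-forms to
`b^m`-forms. Tangency to `Z` and the divergence equation are linear in `X` and, since `h` is
invariant, preserved by `G`; so they hold for the average.

Moser's lemma (`exists_isMoserMap`) integrates the field `X / (1 - t (1 - h))`. By the continuity
equation its flow carries `(1 - t (1 - h)) ω₀`, transported back, to `ω₀`; at time `1` this density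
is `h ω₀ = ω₁`. The flow preserves `Z` by Gronwall's inequality, since `|dx(X)| ≤ C |x|`, and
commutes with `G` by uniqueness of trajectories. Only short-time flows on a compact manifold are
used (`exists_short_flow`): the times between which a suitable diffeomorphism exists form an
equivalence relation with open classes on `[0, 1]`. Smooth dependence of flows on the initial value
is derived from the implicit function theorem in a space of continuous curves
(`exists_smooth_localFlow`).
-/

set_option linter.unusedSectionVars false

open Set Filter

noncomputable section

namespace BmGeometry

universe u

/-! ### Composition operators and the implicit function theorem -/

section Nemytskii

variable {K : Type*} [TopologicalSpace K] [CompactSpace K]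
  {V : Type u} [NormedAddCommGroup V] [NormedSpace ℝ V]

/-- The bilinear evaluation map `C(K, V →L F) × C(K, V) → C(K, F)`, `(A, h) ↦ (k ↦ A k (h k))`. -/
def contEval (K : Type*) [TopologicalSpace K] [CompactSpace K] (V F : Type*)
    [NormedAddCommGroup V] [NormedSpace ℝ V] [NormedAddCommGroup F] [NormedSpace ℝ F] :
    C(K, V →L[ℝ] F) →L[ℝ] C(K, V) →L[ℝ] C(K, F) :=
  LinearMap.mkContinuous₂
    (LinearMap.mk₂ ℝ (fun (A : C(K, V →L[ℝ] F)) (h : C(K, V)) =>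
      (⟨fun k => A k (h k), by fun_prop⟩ : C(K, F)))
      (fun _ _ _ => by ext k; simp) (fun _ _ _ => by ext k; simp)
      (fun _ _ _ => by ext k; simp) (fun _ _ _ => by ext k; simp)) 1 (by
    intro A h
    rw [ContinuousMap.norm_le _ (by positivity)]
    intro k
    simp only [one_mul]
    exact ((A k).le_opNorm (h k)).trans
      (mul_le_mul (A.norm_coe_le_norm k) (h.norm_coe_le_norm k) (norm_nonneg _) (norm_nonneg A)))

theorem contEval_apply {F : Type*} [NormedAddCommGroup F] [NormedSpace ℝ F]
    (A : C(K, V →L[ℝ] F)) (h : C(K, V)) (k : K) : contEval K V F A h k = A k (h k) := rfl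

/-- Composition with a `C^1` function `f` is differentiable on `C(K, V)`: by the mean value
inequality, with uniform estimates because `γ ↦ f' ∘ γ` is continuous in the sup norm. -/
theorem hasFDerivAt_comp_continuousMap {F : Type*} [NormedAddCommGroup F] [NormedSpace ℝ F]
    (f : C(V, F)) (f' : C(V, V →L[ℝ] F)) (hf : ∀ v, HasFDerivAt f (f' v) v) (γ : C(K, V)) :
    HasFDerivAt (fun η : C(K, V) => f.comp η) (contEval K V F (f'.comp γ)) γ := by
  rw [hasFDerivAt_iff_isLittleO_nhds_zero, Asymptotics.isLittleO_iff]
  intro ε hε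
  have hc : Continuous (fun η : C(K, V) => f'.comp η) := f'.continuous_postcomp
  obtain ⟨δ, hδ, hball⟩ := (Metric.continuousAt_iff (f := fun η : C(K, V) => f'.comp η) (a := γ)).1
    hc.continuousAt ε hε
  filter_upwards [Metric.ball_mem_nhds (0 : C(K, V)) hδ] with h hh
  rw [ContinuousMap.norm_le _ (by positivity)]
  intro k
  have hh' : ‖h‖ < δ := by simpa using hh
  have key : ∀ z ∈ segment ℝ (γ k) (γ k + h k), ‖f' z - f' (γ k)‖ ≤ ε := by
    intro z hz
    rw [segment_eq_image'] at hz
    obtain ⟨s, hs, rfl⟩ := hz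
    have h1 : dist (f'.comp (γ + s • h)) (f'.comp γ) < ε := by
      apply hball
      rw [dist_eq_norm, add_sub_cancel_left, norm_smul, Real.norm_eq_abs, abs_of_nonneg hs.1]
      nlinarith [hs.2, norm_nonneg h]
    have h2 := (ContinuousMap.dist_apply_le_dist
      (f := f'.comp (γ + s • h)) (g := f'.comp γ) k).trans h1.le
    simpa [dist_eq_norm] using h2
  have := (convex_segment (𝕜 := ℝ) (γ k) (γ k + h k)).norm_image_sub_le_of_norm_hasFDerivWithin_le'
    (f := f) (f' := f') (φ := f' (γ k)) (C := ε)
    (fun z _ => (hf z).hasFDerivWithinAt) key (left_mem_segment ℝ _ _) (right_mem_segment ℝ _ _)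
  refine le_trans ?_ (this.trans ?_)
  · simp [contEval_apply]
  · rw [add_sub_cancel_left]; gcongr; exact h.norm_coe_le_norm k

/-- Composition with a `C^n` function is of class `C^n`. All spaces lie in one universe, since the
induction passes from functions with values in `F` to functions with values in `V →L[ℝ] F`. -/
theorem contDiff_nat_comp_continuousMap (n : ℕ) :
    ∀ {F : Type u} [NormedAddCommGroup F] [NormedSpace ℝ F]
    (f : C(V, F)), ContDiff ℝ n f → ContDiff ℝ n (fun η : C(K, V) => f.comp η) := by
  induction n with
  | zero =>
    intro F _ _ f _
    exact contDiff_zero.2 f.continuous_postcomp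
  | succ n ih =>
    intro F _ _ f hf
    push_cast at hf ⊢
    obtain ⟨f', hf', hd⟩ := (contDiff_succ_iff_hasFDerivAt (n := n)).1 hf
    refine (contDiff_succ_iff_hasFDerivAt (n := n)).2
      ⟨fun γ => contEval K V F ((⟨f', hf'.continuous⟩ : C(V, V →L[ℝ] F)).comp γ), ?_, ?_⟩
    · exact (contEval K V F).contDiff.comp (ih ⟨f', hf'.continuous⟩ hf')
    · exact hasFDerivAt_comp_continuousMap f ⟨f', hf'.continuous⟩ hd

theorem contDiff_comp_continuousMap {F : Type u} [NormedAddCommGroup F] [NormedSpace ℝ F]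
    (f : C(V, F)) (hf : ContDiff ℝ ∞ f) : ContDiff ℝ ∞ (fun η : C(K, V) => f.comp η) :=
  contDiff_infty.2 fun n => contDiff_nat_comp_continuousMap n f (contDiff_infty.1 hf n)

end Nemytskii

/-- The implicit function of a smooth equation is smooth on a whole neighbourhood: near `u` it is
also the implicit function at each nearby solution. -/
theorem exists_smooth_implicit {E₁ E₂ F : Type*} [NormedAddCommGroup E₁] [NormedSpace ℝ E₁]
    [CompleteSpace E₁] [NormedAddCommGroup E₂] [NormedSpace ℝ E₂] [CompleteSpace E₂]
    [NormedAddCommGroup F] [NormedSpace ℝ F] [CompleteSpace F]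
    {f : E₁ × E₂ → F} (hf : ContDiff ℝ ∞ f) {u : E₁ × E₂}
    (hu : (fderiv ℝ f u ∘L .inr ℝ E₁ E₂).IsInvertible) :
    ∃ ψ : E₁ → E₂, ψ u.1 = u.2 ∧ (∀ᶠ x in 𝓝 u.1, ContDiffAt ℝ ∞ ψ x ∧ f (x, ψ x) = f u) ∧
      (∀ᶠ v in 𝓝 u, f v = f u ↔ ψ v.1 = v.2) := by
  have hd : ∀ v, ContDiffAt ℝ ∞ f v := fun v => hf.contDiffAt
  have pn : (∞ : WithTop ℕ∞) ≠ 0 := by simp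
  set ψ := (hd u).implicitFunction pn hu with hψ
  have hself : ψ u.1 = u.2 := (hd u).implicitFunction_apply_self pn hu
  have hcd : ContDiffAt ℝ ∞ ψ u.1 := (hd u).contDiffAt_implicitFunction pn hu
  have hiff := (hd u).eventually_apply_eq_iff_implicitFunction pn hu
  refine ⟨ψ, hself, ?_, hiff⟩
  have hcont : ∀ᶠ x in 𝓝 u.1, ContinuousAt ψ x := by
    have : ContDiffAt ℝ 1 ψ u.1 := hcd.of_le (by exact_mod_cast le_top)
    filter_upwards [this.eventually (by simp)] with x hx using hx.continuousAt
  have hpair : ContinuousAt (fun x => (x, ψ x)) u.1 := continuousAt_id.prodMk hcd.continuousAt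
  have htend : Tendsto (fun x => (x, ψ x)) (𝓝 u.1) (𝓝 u) := by
    have := hpair.tendsto; rwa [hself] at this
  have hinv : ∀ᶠ x in 𝓝 u.1, (fderiv ℝ f (x, ψ x) ∘L .inr ℝ E₁ E₂).IsInvertible := by
    have hc : Continuous (fun v => fderiv ℝ f v ∘L .inr ℝ E₁ E₂) := by
      have := hf.continuous_fderiv (by simp)
      fun_prop
    have ho : IsOpen {A : E₂ →L[ℝ] F | A.IsInvertible} := ContinuousLinearEquiv.isOpen
    exact htend.eventually ((hc.continuousAt (x := u)).eventually (ho.mem_nhds hu))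
  have heq := (hd u).eventually_apply_implicitFunction pn hu
  filter_upwards [hinv, hcont, heq, heq.eventually_nhds, htend.eventually hiff.eventually_nhds]
    with x h1 h2 h3 h4 h5
  refine ⟨?_, h3⟩
  have hcd' := (hd (x, ψ x)).contDiffAt_implicitFunction pn h1
  have hiff' := (hd (x, ψ x)).eventually_apply_eq_iff_implicitFunction pn h1
  refine hcd'.congr_of_eventuallyEq ?_
  have hpair' : ContinuousAt (fun y => (y, ψ y)) x := continuousAt_id.prodMk h2
  filter_upwards [hpair'.tendsto.eventually hiff', h4] with y hy1 hy2
  exact (hy1.1 (hy2.trans h3.symm)).symm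

/-! ### Smooth dependence of flows on initial values -/

section LocalFlow
variable {V : Type u} [NormedAddCommGroup V] [NormedSpace ℝ V]

/-- The time interval `[-1, 1]` on which rescaled trajectories are defined. -/
abbrev UnitTime : Type := Icc (-1 : ℝ) 1

/-- The retraction of `ℝ` onto `[-1, 1]`; it extends a curve on `[-1, 1]` to `ℝ`. -/
def clampTime (τ : ℝ) : UnitTime := projIcc (-1 : ℝ) 1 (by norm_num) τ

theorem continuous_clampTime : Continuous clampTime :=
  continuous_projIcc (h := (by norm_num : (-1 : ℝ) ≤ 1))

theorem clampTime_of_mem {τ : ℝ} (h : τ ∈ Icc (-1 : ℝ) 1) : clampTime τ = ⟨τ, h⟩ :=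
  projIcc_of_mem _ h

/-- The operator that maps a curve `η` on `[-1, 1]` to its primitive `τ ↦ ∫ σ in 0..τ, η σ`. -/
def curvePrimitive : C(UnitTime, V) →L[ℝ] C(UnitTime, V) :=
  LinearMap.mkContinuous
    { toFun := fun η => ⟨fun τ => ∫ σ in (0 : ℝ)..τ, η (clampTime σ), by
        have hc : Continuous fun σ => η (clampTime σ) := η.continuous.comp continuous_clampTime
        have := intervalIntegral.continuous_primitive (μ := MeasureTheory.volume)
          (fun a b => hc.intervalIntegrable a b) 0
        exact this.comp continuous_subtype_val⟩
      map_add' := fun x y => by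
        ext τ
        have hx : Continuous fun σ => x (clampTime σ) := x.continuous.comp continuous_clampTime
        have hy : Continuous fun σ => y (clampTime σ) := y.continuous.comp continuous_clampTime
        simpa using intervalIntegral.integral_add (hx.intervalIntegrable _ _)
          (hy.intervalIntegrable _ _)
      map_smul' := fun c x => by ext τ; simp } 1 (by
    intro η
    rw [one_mul, ContinuousMap.norm_le _ (norm_nonneg η)]
    intro τ
    have := intervalIntegral.norm_integral_le_of_norm_le_const (a := (0 : ℝ)) (b := τ)
      (f := fun σ => η (clampTime σ)) (C := ‖η‖) (fun σ _ => η.norm_coe_le_norm _)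
    refine this.trans ?_
    have h1 : |(τ : ℝ) - 0| ≤ 1 := by rw [sub_zero, abs_le]; exact τ.2
    nlinarith [norm_nonneg η])

theorem curvePrimitive_apply (η : C(UnitTime, V)) (τ : UnitTime) :
    curvePrimitive η τ = ∫ σ in (0 : ℝ)..τ, η (clampTime σ) := rfl

theorem hasDerivAt_primitive_clamp [CompleteSpace V] (η : C(UnitTime, V)) (τ : ℝ) :
    HasDerivAt (fun τ => ∫ σ in (0 : ℝ)..τ, η (clampTime σ)) (η (clampTime τ)) τ := by
  have hc : Continuous fun σ => η (clampTime σ) := η.continuous.comp continuous_clampTime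
  exact hc.integral_hasStrictDerivAt 0 τ |>.hasDerivAt

/-- The expression `γ - x - s ∫ f ∘ γ`, a map `(V × ℝ) × C([-1, 1], V) → C([-1, 1], V)` of
`((x, s), γ)`. It vanishes if and only if `γ τ = c (s τ)` for a trajectory `c` of `f` with
`c 0 = x`: time is rescaled, so that trajectories over intervals of different lengths `s` lie in one
Banach space. -/
def flowDefect (f : C(V, V)) (p : (V × ℝ) × C(UnitTime, V)) : C(UnitTime, V) :=
  p.2 - ContinuousMap.const _ p.1.1 - p.1.2 • curvePrimitive (f.comp p.2)

theorem contDiff_flowDefect (f : C(V, V)) (hf : ContDiff ℝ ∞ f) : ContDiff ℝ ∞ (flowDefect f) := by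
  have h1 : ContDiff ℝ ∞ (fun p : (V × ℝ) × C(UnitTime, V) => f.comp p.2) :=
    (contDiff_comp_continuousMap f hf).comp contDiff_snd
  have h2 : ContDiff ℝ ∞ (fun p : (V × ℝ) × C(UnitTime, V) => ContinuousMap.const UnitTime p.1.1) := by
    have : IsBoundedLinearMap ℝ (fun v : V => ContinuousMap.const UnitTime v) :=
      { map_add := fun _ _ => rfl
        map_smul := fun _ _ => rfl
        bound := ⟨1, one_pos, fun v => by
          rw [one_mul, ContinuousMap.norm_le _ (norm_nonneg v)]; intro _; exact le_rfl⟩ }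
    exact this.contDiff.comp (contDiff_fst.comp contDiff_fst)
  have h3 := (curvePrimitive (V := V)).contDiff.comp h1 (n := ∞)
  exact (contDiff_snd.sub h2).sub ((contDiff_snd.comp contDiff_fst).smul h3)

/-- At `s = 0` the equation reads `γ - x = 0`, so its derivative in `γ` is the identity. -/
theorem isInvertible_fderiv_flowDefect (f : C(V, V)) (hf : ContDiff ℝ ∞ f) (x₀ : V)
    (γ : C(UnitTime, V)) :
    (fderiv ℝ (flowDefect f) ((x₀, 0), γ) ∘L .inr ℝ (V × ℝ) C(UnitTime, V)).IsInvertible := by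
  have h1 : HasFDerivAt (flowDefect f) (fderiv ℝ (flowDefect f) ((x₀, 0), γ)) ((x₀, 0), γ) :=
    ((contDiff_flowDefect f hf).differentiable (by simp) _).hasFDerivAt
  have h2 : HasFDerivAt (fun η : C(UnitTime, V) => (((x₀, (0 : ℝ)), η) : (V × ℝ) × C(UnitTime, V)))
      (.inr ℝ (V × ℝ) C(UnitTime, V)) γ := hasFDerivAt_prodMk_right _ _
  have h3 := h1.comp γ h2
  have h4 : HasFDerivAt (flowDefect f ∘ fun η : C(UnitTime, V) => ((x₀, (0 : ℝ)), η))
      (ContinuousLinearMap.id ℝ C(UnitTime, V)) γ := by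
    have : (flowDefect f ∘ fun η : C(UnitTime, V) => ((x₀, (0 : ℝ)), η)) =
        fun η => η - ContinuousMap.const _ x₀ := by
      funext η; simp [flowDefect]
    rw [this]
    exact (hasFDerivAt_id γ).sub_const _
  rw [h3.unique h4]
  exact ⟨ContinuousLinearEquiv.refl ℝ _, rfl⟩

/-- Slowing a trajectory down by the factor `σ` solves the equation with `s * σ` in place of `s`. -/
theorem flowDefect_rescale (f : C(V, V)) {x : V} {s : ℝ} {γ : C(UnitTime, V)}
    (h : flowDefect f ((x, s), γ) = 0) {σ : ℝ} (hσ : σ ∈ Icc (-1 : ℝ) 1) (η : C(UnitTime, V))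
    (hη : ∀ τ : UnitTime, η τ = γ (clampTime (σ * τ))) :
    flowDefect f ((x, s * σ), η) = 0 := by
  have hmul : ∀ τ ∈ Icc (-1 : ℝ) 1, σ * τ ∈ Icc (-1 : ℝ) 1 := by
    intro τ hτ
    rw [mem_Icc, ← abs_le] at *
    rw [abs_mul]
    nlinarith [abs_nonneg σ, abs_nonneg τ]
  ext τ
  have h1 := congrArg (fun c : C(UnitTime, V) => c (clampTime (σ * τ))) h
  simp only [flowDefect, ContinuousMap.sub_apply, ContinuousMap.const_apply,
    ContinuousMap.smul_apply, ContinuousMap.zero_apply, curvePrimitive_apply] at h1 ⊢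
  rw [hη τ]
  rw [← h1]
  congr 1
  rw [mul_smul]
  congr 1
  have h2 : ((clampTime (σ * τ) : UnitTime) : ℝ) = σ * τ := by
    rw [clampTime_of_mem (hmul _ τ.2)]
  rw [h2]
  have h3 := intervalIntegral.smul_integral_comp_mul_left (a := (0:ℝ)) (b := τ)
    (fun r => (f.comp γ) (clampTime r)) σ
  rw [mul_zero] at h3
  rw [← h3]
  congr 1
  apply intervalIntegral.integral_congr
  intro r hr
  have hr' : r ∈ Icc (-1 : ℝ) 1 := by
    have := τ.2
    rcases le_total (0:ℝ) τ with h0 | h0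
    · rw [uIcc_of_le h0] at hr; exact ⟨by linarith [hr.1], hr.2.trans this.2⟩
    · rw [uIcc_of_ge h0] at hr; exact ⟨this.1.trans hr.1, by linarith [hr.2]⟩
  simp only [ContinuousMap.comp_apply]
  rw [hη, clampTime_of_mem hr']

/-- Every smooth vector field has a local flow that is smooth in the initial value and in time. -/
theorem exists_smooth_localFlow [CompleteSpace V] (f : V → V) (hf : ContDiff ℝ ∞ f) (x₀ : V) :
    ∃ δ > 0, ∃ Φ : V → ℝ → V,
      (∀ x ∈ Metric.ball x₀ δ, ∀ s ∈ Ioo (-δ) δ, ContDiffAt ℝ ∞ (Function.uncurry Φ) (x, s)) ∧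
      ∀ x ∈ Metric.ball x₀ δ, Φ x 0 = x ∧ ∀ s ∈ Ioo (-δ) δ, HasDerivAt (Φ x) (f (Φ x s)) s := by
  set fc : C(V, V) := ⟨f, hf.continuous⟩ with hfc
  set u : (V × ℝ) × C(UnitTime, V) := ((x₀, 0), ContinuousMap.const _ x₀) with hu
  obtain ⟨ψ, hψ0, hψ, hiff⟩ := exists_smooth_implicit (contDiff_flowDefect fc hf) (u := u)
    (isInvertible_fderiv_flowDefect fc hf x₀ _)
  have hzero : flowDefect fc u = 0 := by ext τ; simp [flowDefect, hu]
  rw [hzero] at hψ hiff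
  have hcont : ContinuousAt ψ u.1 := hψ.self_of_nhds.1.continuousAt
  obtain ⟨δ₂, hδ₂, hb₂⟩ := Metric.eventually_nhds_iff_ball.1 hiff
  have hnear : ∀ᶠ p in 𝓝 u.1, ψ p ∈ Metric.ball u.2 δ₂ := by
    apply hcont.eventually
    rw [hψ0]; exact Metric.ball_mem_nhds _ hδ₂
  obtain ⟨δ₁, hδ₁, hb₁⟩ := Metric.eventually_nhds_iff_ball.1 (hψ.and hnear)
  set δ := min δ₁ δ₂ with hδ
  have hδp : 0 < δ := lt_min hδ₁ hδ₂
  have hmem : ∀ x ∈ Metric.ball x₀ δ, ∀ s ∈ Ioo (-δ) δ, (x, s) ∈ Metric.ball u.1 δ := by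
    intro x hx s hs
    rw [hu, ← ball_prod_same]
    refine ⟨hx, ?_⟩
    simpa [Real.dist_eq, abs_lt] using hs
  have hmem₁ : ∀ x ∈ Metric.ball x₀ δ, ∀ s ∈ Ioo (-δ) δ, (x, s) ∈ Metric.ball u.1 δ₁ :=
    fun x hx s hs => Metric.ball_subset_ball (min_le_left _ _) (hmem x hx s hs)
  -- the solution for the parameter `s` contains those for all the smaller parameters `s σ`
  have hres : ∀ x ∈ Metric.ball x₀ δ, ∀ s ∈ Ioo (-δ) δ, ∀ σ ∈ Icc (-1 : ℝ) 1,
      ψ (x, s * σ) (clampTime 1) = ψ (x, s) (clampTime σ) := by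
    intro x hx s hs σ hσ
    set η : C(UnitTime, V) := ⟨fun τ => ψ (x, s) (clampTime (σ * τ)),
      (ψ (x, s)).continuous.comp (continuous_clampTime.comp (by fun_prop))⟩ with hη
    have h1 := flowDefect_rescale fc (hb₁ _ (hmem₁ x hx s hs)).1.2 hσ η (fun τ => rfl)
    have hsσ : s * σ ∈ Ioo (-δ) δ := by
      rw [mem_Ioo, ← abs_lt] at *
      rw [mem_Icc, ← abs_le] at hσ
      rw [abs_mul]
      nlinarith [abs_nonneg s, abs_nonneg σ]
    have h2 : ((x, s * σ), η) ∈ Metric.ball u δ₂ := by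
      rw [hu, ← ball_prod_same]
      refine ⟨Metric.ball_subset_ball (min_le_right _ _) (hmem x hx _ hsσ), ?_⟩
      have h3 := (hb₁ _ (hmem₁ x hx s hs)).2
      rw [Metric.mem_ball, ContinuousMap.dist_lt_iff hδ₂] at h3 ⊢
      intro τ
      exact h3 _
    have h3 := (hb₂ _ h2).1 h1
    simp only at h3
    rw [h3, hη]
    simp [clampTime_of_mem (right_mem_Icc.2 (by norm_num : (-1:ℝ) ≤ 1))]
  refine ⟨δ, hδp, fun x s => ψ (x, s) (clampTime 1), ?_, ?_⟩
  · intro x hx s hs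
    have h1 := (hb₁ _ (hmem₁ x hx s hs)).1.1
    exact (ContinuousMap.evalCLM ℝ (clampTime 1)).contDiff.contDiffAt.comp _ h1
  · intro x hx
    have hform : ∀ s ∈ Ioo (-δ) δ, ∀ τ : UnitTime, ψ (x, s) τ =
        x + s • ∫ σ in (0 : ℝ)..τ, (fc.comp (ψ (x, s))) (clampTime σ) := by
      intro s hs τ
      have h1 := (hb₁ _ (hmem₁ x hx s hs)).1.2
      have h2 := congrArg (fun c : C(UnitTime, V) => c τ) h1
      simp only [flowDefect, ContinuousMap.sub_apply, ContinuousMap.const_apply,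
        ContinuousMap.smul_apply, ContinuousMap.zero_apply, curvePrimitive_apply] at h2
      rw [sub_sub, sub_eq_zero] at h2
      exact h2
    refine ⟨?_, ?_⟩
    · change ψ (x, 0) (clampTime 1) = x
      rw [hform 0 ⟨by linarith, hδp⟩]; simp
    · intro s hs
      obtain ⟨b, hb1, hb2⟩ := exists_between (abs_lt.2 hs)
      have hb0 : 0 < b := (abs_nonneg s).trans_lt hb1
      have hbm : b ∈ Ioo (-δ) δ := ⟨by linarith, hb2⟩
      have hsb : ∀ r : ℝ, |r| < b → r / b ∈ Icc (-1 : ℝ) 1 := by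
        intro r hr
        rw [mem_Icc, ← abs_le, abs_div, abs_of_pos hb0]
        exact (div_le_one hb0).2 hr.le
      have hval : ∀ r : ℝ, |r| < b → ψ (x, r) (clampTime 1) = ψ (x, b) (clampTime (r / b)) := by
        intro r hr
        rw [← hres x hx b hbm _ (hsb r hr), mul_div_cancel₀ _ hb0.ne']
      -- near `s`, the flow is read off from the single curve with parameter `b > |s|`
      have heq : (fun r => ψ (x, r) (clampTime 1)) =ᶠ[𝓝 s] fun r =>
          x + b • ∫ σ in (0 : ℝ)..(r / b), (fc.comp (ψ (x, b))) (clampTime σ) := by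
        filter_upwards [(continuous_abs.isOpen_preimage _ isOpen_Iio).mem_nhds hb1] with r hr
        rw [hval r hr, hform b hbm, clampTime_of_mem (hsb r hr)]
      have hd := hasDerivAt_primitive_clamp (fc.comp (ψ (x, b))) (s / b)
      have hd2 := (hd.scomp s ((hasDerivAt_id s).div_const b)).const_smul b |>.const_add x
      refine (hd2.congr_of_eventuallyEq heq).congr_deriv ?_
      change _ = f (ψ (x, s) (clampTime 1))
      rw [hval s hb1, smul_smul, mul_one_div_cancel hb0.ne', one_smul]
      rfl

/-- A locally defined smooth function has a globally defined one with the same germ. -/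
theorem exists_contDiff_eventuallyEq [FiniteDimensional ℝ V] {F : Type*} [NormedAddCommGroup F]
    [NormedSpace ℝ F] {f : V → F} {W : Set V} (hW : IsOpen W) (hf : ContDiffOn ℝ ∞ f W)
    {v : V} (hv : v ∈ W) : ∃ g : V → F, ContDiff ℝ ∞ g ∧ g =ᶠ[𝓝 v] f := by
  obtain ⟨r, hr, hrW⟩ := Metric.nhds_basis_closedBall.mem_iff.1 (hW.mem_nhds hv)
  let χ : ContDiffBump v := ⟨r / 2, r, by positivity, by linarith⟩
  refine ⟨fun x => χ x • f x, ?_, ?_⟩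
  · rw [contDiff_iff_contDiffAt]
    intro x
    by_cases hx : x ∈ W
    · exact χ.contDiff.contDiffAt.smul (hf.contDiffAt (hW.mem_nhds hx))
    · have hx' : x ∈ (tsupport χ)ᶜ := by
        rw [χ.tsupport_eq]; exact fun h => hx (hrW h)
      have : (fun x => χ x • f x) =ᶠ[𝓝 x] fun _ => 0 := by
        filter_upwards [(isClosed_tsupport χ).isOpen_compl.mem_nhds hx'] with y hy
        rw [image_eq_zero_of_notMem_tsupport hy, zero_smul]
      exact contDiffAt_const.congr_of_eventuallyEq this
  · filter_upwards [χ.eventuallyEq_one] with x hx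
    rw [hx]; simp

/-- The local flow `φ s t u` of a time-dependent field from time `s` to time `t`, with initial
values near `u₀`. It is the flow of the field `(1, f)` on `ℝ × E`. -/
theorem exists_smooth_timeFlow {E : Type u} [NormedAddCommGroup E] [NormedSpace ℝ E]
    [FiniteDimensional ℝ E] {f : ℝ × E → E} {W : Set (ℝ × E)} (hW : IsOpen W)
    (hf : ContDiffOn ℝ ∞ f W) {t₀ : ℝ} {u₀ : E} (h₀ : (t₀, u₀) ∈ W) :
    ∃ ε > 0, ∃ φ : ℝ → ℝ → E → E, ∀ s ∈ Ioo (t₀ - ε) (t₀ + ε), ∀ u ∈ Metric.ball u₀ ε,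
      φ s s u = u ∧ ∀ t ∈ Ioo (t₀ - ε) (t₀ + ε),
        ContDiffAt ℝ ∞ (fun q : ℝ × E => φ s q.1 q.2) (t, u) ∧ (t, φ s t u) ∈ W ∧
        HasDerivAt (fun t => φ s t u) (f (t, φ s t u)) t := by
  have : CompleteSpace E := FiniteDimensional.complete ℝ E
  obtain ⟨g, hg, hgf⟩ := exists_contDiff_eventuallyEq hW hf h₀
  have hF : ContDiff ℝ ∞ (fun p : ℝ × E => ((1 : ℝ), g p)) := contDiff_const.prodMk hg
  obtain ⟨δ, hδ, Φ, hΦ, hΦ'⟩ := exists_smooth_localFlow _ hF (t₀, u₀)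
  have h0 : Φ (t₀, u₀) 0 = (t₀, u₀) := (hΦ' _ (Metric.mem_ball_self hδ)).1
  have hcont : ContinuousAt (Function.uncurry Φ) ((t₀, u₀), 0) :=
    (hΦ _ (Metric.mem_ball_self hδ) 0 ⟨by linarith, hδ⟩).continuousAt
  have hgood : ∀ᶠ q in 𝓝 (((t₀, u₀) : ℝ × E), (0 : ℝ)),
      g (Function.uncurry Φ q) = f (Function.uncurry Φ q) ∧ Function.uncurry Φ q ∈ W := by
    apply hcont.eventually (p := fun z => g z = f z ∧ z ∈ W)
    change ∀ᶠ z in 𝓝 (Φ (t₀, u₀) 0), _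
    rw [h0]
    exact hgf.and (hW.mem_nhds h₀)
  obtain ⟨δ', hδ', hb⟩ := Metric.eventually_nhds_iff_ball.1 hgood
  set ε := min (δ / 2) (δ' / 2) with hε
  have hεp : 0 < ε := lt_min (by positivity) (by positivity)
  have hε1 : 2 * ε ≤ δ := by have := min_le_left (δ / 2) (δ' / 2); linarith
  have hε2 : 2 * ε ≤ δ' := by have := min_le_right (δ / 2) (δ' / 2); linarith
  have hball : ∀ s ∈ Ioo (t₀ - ε) (t₀ + ε), ∀ u ∈ Metric.ball u₀ ε, ∀ d, 2 * ε ≤ d →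
      ((s, u) : ℝ × E) ∈ Metric.ball (t₀, u₀) d := by
    intro s hs u hu d hd
    rw [← ball_prod_same]
    refine ⟨?_, Metric.ball_subset_ball (by linarith) hu⟩
    rw [Metric.mem_ball, Real.dist_eq, abs_lt]
    constructor <;> linarith [hs.1, hs.2]
  -- the first component of the field is `1`, so the first component of the flow is time
  have hfst : ∀ v ∈ Metric.ball (t₀, u₀) δ, ∀ σ ∈ Ioo (-δ) δ, (Φ v σ).1 = v.1 + σ := by
    intro v hv σ hσ
    have hd : ∀ r ∈ Ioo (-δ) δ, HasDerivAt (fun r => (Φ v r).1 - r) 0 r := by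
      intro r hr
      have h1 : HasDerivAt (fun r => (Φ v r).1) 1 r :=
        (ContinuousLinearMap.fst ℝ ℝ E).hasFDerivAt.comp_hasDerivAt r ((hΦ' v hv).2 r hr)
      simpa using h1.fun_sub (hasDerivAt_id r)
    have := (convex_Ioo (-δ) δ).is_const_of_fderivWithin_eq_zero (𝕜 := ℝ)
      (f := fun r => (Φ v r).1 - r)
      (fun r hr => (hd r hr).differentiableAt.differentiableWithinAt) (fun r hr => by
        rw [fderivWithin_of_isOpen isOpen_Ioo hr]
        have h2 := (hd r hr).hasFDerivAt.fderiv
        rw [h2]; ext; simp) hσ (⟨by linarith, hδ⟩ : (0 : ℝ) ∈ Ioo (-δ) δ)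
    simp only [(hΦ' v hv).1, sub_zero] at this
    linarith
  refine ⟨ε, hεp, fun s t u => (Φ (s, u) (t - s)).2, ?_⟩
  intro s hs u hu
  have hv := hball s hs u hu δ hε1
  refine ⟨by simp [(hΦ' _ hv).1], ?_⟩
  intro t ht
  have hts : t - s ∈ Ioo (-(2 * ε)) (2 * ε) :=
    ⟨by linarith [hs.1, hs.2, ht.1, ht.2], by linarith [hs.1, hs.2, ht.1, ht.2]⟩
  have hts1 : t - s ∈ Ioo (-δ) δ := ⟨by linarith [hts.1], by linarith [hts.2]⟩
  have hpair : Φ (s, u) (t - s) = (t, (Φ (s, u) (t - s)).2) := by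
    refine Prod.ext ?_ rfl
    simp [hfst _ hv _ hts1]
  have hmem : (((s, u) : ℝ × E), t - s) ∈ Metric.ball (((t₀, u₀) : ℝ × E), (0 : ℝ)) δ' := by
    rw [← ball_prod_same]
    refine ⟨hball s hs u hu δ' hε2, ?_⟩
    rw [Metric.mem_ball, Real.dist_eq, sub_zero, abs_lt]
    constructor <;> linarith [hts.1, hts.2]
  have hg' := hb _ hmem
  simp only [Function.uncurry] at hg'
  rw [hpair] at hg'
  refine ⟨?_, hg'.2, ?_⟩
  · have h1 := hΦ _ hv _ hts1
    have h2 : ContDiffAt ℝ ∞ (fun q : ℝ × E => (((s, q.2) : ℝ × E), q.1 - s)) (t, u) := by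
      fun_prop
    exact (ContDiffAt.comp (t, u) (g := Function.uncurry Φ) h1 h2).snd
  · have h1 : HasDerivAt (fun r => (Φ (s, u) r).2) (g (Φ (s, u) (t - s))) (t - s) :=
      (ContinuousLinearMap.snd ℝ ℝ E).hasFDerivAt.comp_hasDerivAt _ ((hΦ' _ hv).2 _ hts1)
    rw [hpair, hg'.1] at h1
    have h2 := h1.scomp t ((hasDerivAt_id t).sub_const s)
    simpa [Function.comp_def] using h2

end LocalFlow

/-! ### Forms, fields and maps in charts -/

section ChartCalculus

variable {E : Type*} [NormedAddCommGroup E] [NormedSpace ℝ E]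
  {M : Type*} [TopologicalSpace M] [ChartedSpace E M]
  {N : Type*} [TopologicalSpace N] [ChartedSpace E N]
  {P : Type*} [TopologicalSpace P] [ChartedSpace E P]

theorem tangentMapAt_comp {g : N → P} {f : M → N} {p : M}
    (hg : MDifferentiableAt 𝓘(ℝ, E) 𝓘(ℝ, E) g (f p))
    (hf : MDifferentiableAt 𝓘(ℝ, E) 𝓘(ℝ, E) f p) :
    tangentMapAt E (fun x => g (f x)) p = (tangentMapAt E g (f p)).comp (tangentMapAt E f p) :=
  mfderiv_comp p hg hf

theorem tangentMapAt_congr {f g : M → N} {p : M} (h : f =ᶠ[𝓝 p] g) :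
    tangentMapAt E f p = tangentMapAt E g p := h.mfderiv_eq

theorem tangentMapAt_id (p : M) : tangentMapAt E (fun x : M => x) p = ContinuousLinearMap.id ℝ E :=
  mfderiv_id

theorem tangentMapAt_eq_fderiv (f : E → E) (u : E) : tangentMapAt E f u = fderiv ℝ f u :=
  mfderiv_eq_fderiv

variable [IsManifold 𝓘(ℝ, E) ∞ M] [IsManifold 𝓘(ℝ, E) ∞ N] [IsManifold 𝓘(ℝ, E) ∞ P]

theorem contMDiffAt_chart {c p : M} (h : p ∈ (extChartAt 𝓘(ℝ, E) c).source) :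
    ContMDiffAt 𝓘(ℝ, E) 𝓘(ℝ, E) ∞ (extChartAt 𝓘(ℝ, E) c) p :=
  contMDiffAt_extChartAt' (by rwa [extChartAt_source] at h)

theorem contMDiffAt_chart_symm {c : M} {u : E} (h : u ∈ (extChartAt 𝓘(ℝ, E) c).target) :
    ContMDiffAt 𝓘(ℝ, E) 𝓘(ℝ, E) ∞ (extChartAt 𝓘(ℝ, E) c).symm u :=
  (contMDiffOn_extChartAt_symm c).contMDiffAt ((isOpen_extChartAt_target c).mem_nhds h)

theorem mdifferentiableAt_chart {c p : M} (h : p ∈ (extChartAt 𝓘(ℝ, E) c).source) :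
    MDifferentiableAt 𝓘(ℝ, E) 𝓘(ℝ, E) (extChartAt 𝓘(ℝ, E) c) p :=
  (contMDiffAt_chart h).mdifferentiableAt (by simp)

theorem mdifferentiableAt_chart_symm {c : M} {u : E} (h : u ∈ (extChartAt 𝓘(ℝ, E) c).target) :
    MDifferentiableAt 𝓘(ℝ, E) 𝓘(ℝ, E) (extChartAt 𝓘(ℝ, E) c).symm u :=
  (contMDiffAt_chart_symm h).mdifferentiableAt (by simp)

theorem tangentMapAt_chart_self (p : M) :
    tangentMapAt E (extChartAt 𝓘(ℝ, E) p) p = ContinuousLinearMap.id ℝ E := by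
  have : IsManifold 𝓘(ℝ, E) 1 M := IsManifold.of_le (n := ∞) (by exact_mod_cast le_top)
  exact mfderiv_extChartAt_self

theorem eventually_chart_symm_chart {c p : M} (h : p ∈ (extChartAt 𝓘(ℝ, E) c).source) :
    ∀ᶠ q in 𝓝 p, (extChartAt 𝓘(ℝ, E) c).symm (extChartAt 𝓘(ℝ, E) c q) = q := by
  filter_upwards [(isOpen_extChartAt_source c).mem_nhds h] with q hq
  exact (extChartAt 𝓘(ℝ, E) c).left_inv hq

theorem eventually_chart_chart_symm {c : M} {u : E} (h : u ∈ (extChartAt 𝓘(ℝ, E) c).target) :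
    ∀ᶠ v in 𝓝 u, extChartAt 𝓘(ℝ, E) c ((extChartAt 𝓘(ℝ, E) c).symm v) = v := by
  filter_upwards [(isOpen_extChartAt_target c).mem_nhds h] with q hq
  exact (extChartAt 𝓘(ℝ, E) c).right_inv hq

theorem tangentMapAt_chart_symm_comp {c p : M} (h : p ∈ (extChartAt 𝓘(ℝ, E) c).source) :
    (tangentMapAt E (extChartAt 𝓘(ℝ, E) c).symm (extChartAt 𝓘(ℝ, E) c p)).comp
      (tangentMapAt E (extChartAt 𝓘(ℝ, E) c) p) = ContinuousLinearMap.id ℝ E := by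
  rw [← tangentMapAt_comp
    (mdifferentiableAt_chart_symm ((extChartAt 𝓘(ℝ, E) c).map_source h)) (mdifferentiableAt_chart h),
    tangentMapAt_congr (eventually_chart_symm_chart h), tangentMapAt_id]

theorem tangentMapAt_chart_comp_symm {c : M} {u : E} (h : u ∈ (extChartAt 𝓘(ℝ, E) c).target) :
    (tangentMapAt E (extChartAt 𝓘(ℝ, E) c) ((extChartAt 𝓘(ℝ, E) c).symm u)).comp
      (tangentMapAt E (extChartAt 𝓘(ℝ, E) c).symm u) = ContinuousLinearMap.id ℝ E := by
  rw [← tangentMapAt_comp (mdifferentiableAt_chart ((extChartAt 𝓘(ℝ, E) c).map_target h))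
    (mdifferentiableAt_chart_symm h),
    tangentMapAt_congr (eventually_chart_chart_symm h), tangentMapAt_id]

/-- The expression of a map `f : M → N` in the charts around `c` and `c'`. -/
def mapInCharts (E : Type*) [NormedAddCommGroup E] [NormedSpace ℝ E]
    {M : Type*} [TopologicalSpace M] [ChartedSpace E M]
    {N : Type*} [TopologicalSpace N] [ChartedSpace E N] (f : M → N) (c : M) (c' : N) (u : E) : E :=
  extChartAt 𝓘(ℝ, E) c' (f ((extChartAt 𝓘(ℝ, E) c).symm u))

theorem contDiffAt_mapInCharts {f : M → N} {c : M} {c' : N} {u : E}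
    (hu : u ∈ (extChartAt 𝓘(ℝ, E) c).target)
    (hf : ContMDiffAt 𝓘(ℝ, E) 𝓘(ℝ, E) ∞ f ((extChartAt 𝓘(ℝ, E) c).symm u))
    (hc' : f ((extChartAt 𝓘(ℝ, E) c).symm u) ∈ (extChartAt 𝓘(ℝ, E) c').source) :
    ContDiffAt ℝ ∞ (mapInCharts E f c c') u :=
  ((contMDiffAt_chart hc').comp u (hf.comp u (contMDiffAt_chart_symm hu))).contDiffAt

theorem fderiv_mapInCharts {f : M → N} {c : M} {c' : N} {u : E}
    (hu : u ∈ (extChartAt 𝓘(ℝ, E) c).target)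
    (hf : MDifferentiableAt 𝓘(ℝ, E) 𝓘(ℝ, E) f ((extChartAt 𝓘(ℝ, E) c).symm u))
    (hc' : f ((extChartAt 𝓘(ℝ, E) c).symm u) ∈ (extChartAt 𝓘(ℝ, E) c').source) :
    fderiv ℝ (mapInCharts E f c c') u =
      (tangentMapAt E (extChartAt 𝓘(ℝ, E) c') (f ((extChartAt 𝓘(ℝ, E) c).symm u))).comp
        ((tangentMapAt E f ((extChartAt 𝓘(ℝ, E) c).symm u)).comp
          (tangentMapAt E (extChartAt 𝓘(ℝ, E) c).symm u)) := by
  rw [← tangentMapAt_eq_fderiv, ← tangentMapAt_comp hf (mdifferentiableAt_chart_symm hu)]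
  exact tangentMapAt_comp (f := fun u => f ((extChartAt 𝓘(ℝ, E) c).symm u))
    (mdifferentiableAt_chart hc') (hf.comp u (mdifferentiableAt_chart_symm hu))

/-- The expression in the chart around `c` of a vector field `X`, where `X p` is a tangent vector
at `p`, read off in the preferred chart at `p`. -/
def fieldInChart (X : M → E) (c : M) (u : E) : E :=
  tangentMapAt E (extChartAt 𝓘(ℝ, E) c) ((extChartAt 𝓘(ℝ, E) c).symm u)
    (X ((extChartAt 𝓘(ℝ, E) c).symm u))

theorem tangentMapAt_symm_fieldInChart (X : M → E) {c : M} {u : E}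
    (hu : u ∈ (extChartAt 𝓘(ℝ, E) c).target) :
    tangentMapAt E (extChartAt 𝓘(ℝ, E) c).symm u (fieldInChart X c u) =
      X ((extChartAt 𝓘(ℝ, E) c).symm u) := by
  have := tangentMapAt_chart_symm_comp ((extChartAt 𝓘(ℝ, E) c).map_target hu)
  rw [(extChartAt 𝓘(ℝ, E) c).right_inv hu] at this
  exact congrArg (fun A : E →L[ℝ] E => A (X ((extChartAt 𝓘(ℝ, E) c).symm u))) this

theorem fieldInChart_self (X : M → E) (p : M) :
    fieldInChart X p (extChartAt 𝓘(ℝ, E) p p) = X p := by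
  rw [fieldInChart, extChartAt_to_inv, tangentMapAt_chart_self]; rfl

/-- If `f` maps the field `X` to the field `Y`, then so do the chart expressions. -/
theorem fderiv_mapInCharts_fieldInChart {f : M → N} {X : M → E} {Y : N → E} {c : M} {c' : N} {u : E}
    (hu : u ∈ (extChartAt 𝓘(ℝ, E) c).target)
    (hf : MDifferentiableAt 𝓘(ℝ, E) 𝓘(ℝ, E) f ((extChartAt 𝓘(ℝ, E) c).symm u))
    (hc' : f ((extChartAt 𝓘(ℝ, E) c).symm u) ∈ (extChartAt 𝓘(ℝ, E) c').source)
    (hXY : tangentMapAt E f ((extChartAt 𝓘(ℝ, E) c).symm u) (X ((extChartAt 𝓘(ℝ, E) c).symm u)) =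
      Y (f ((extChartAt 𝓘(ℝ, E) c).symm u))) :
    fderiv ℝ (mapInCharts E f c c') u (fieldInChart X c u) =
      fieldInChart Y c' (mapInCharts E f c c' u) := by
  rw [fderiv_mapInCharts hu hf hc']
  simp only [ContinuousLinearMap.comp_apply]
  rw [tangentMapAt_symm_fieldInChart X hu, hXY, fieldInChart, mapInCharts,
    (extChartAt 𝓘(ℝ, E) c').left_inv hc']

/-- Chart expressions of a pullback are pullbacks under chart expressions. -/
theorem inChart_pullback {k : ℕ} {f : M → N} (η : DForm E N k) {c : M} {c' : N} {u : E}
    (hu : u ∈ (extChartAt 𝓘(ℝ, E) c).target)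
    (hf : MDifferentiableAt 𝓘(ℝ, E) 𝓘(ℝ, E) f ((extChartAt 𝓘(ℝ, E) c).symm u))
    (hc' : f ((extChartAt 𝓘(ℝ, E) c).symm u) ∈ (extChartAt 𝓘(ℝ, E) c').source) :
    inChart (pullback f η) c u =
      (inChart η c' (mapInCharts E f c c' u)).compContinuousLinearMap
        (fderiv ℝ (mapInCharts E f c c') u) := by
  rw [fderiv_mapInCharts hu hf hc']
  have h1 := tangentMapAt_chart_symm_comp hc'
  unfold inChart pullback mapInCharts
  rw [(extChartAt 𝓘(ℝ, E) c').left_inv hc']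
  ext v
  simp only [ContinuousAlternatingMap.compContinuousLinearMap_apply]
  congr 1
  ext i
  have h2 := fun w => congrArg (fun A : E →L[ℝ] E => A w) h1
  simp only [ContinuousLinearMap.comp_apply, ContinuousLinearMap.id_apply] at h2
  exact (h2 _).symm

theorem pullback_id {k : ℕ} (η : DForm E M k) : pullback (fun x : M => x) η = η := by
  funext p; unfold pullback; rw [tangentMapAt_id]; ext v; rfl

theorem inChart_apply_chart {k : ℕ} (η : DForm E M k) {c p : M}
    (h : p ∈ (extChartAt 𝓘(ℝ, E) c).source) :
    (inChart η c (extChartAt 𝓘(ℝ, E) c p)).compContinuousLinearMap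
      (tangentMapAt E (extChartAt 𝓘(ℝ, E) c) p) = η p := by
  have h1 := tangentMapAt_chart_symm_comp h
  unfold inChart pullback
  rw [(extChartAt 𝓘(ℝ, E) c).left_inv h]
  ext v
  simp only [ContinuousAlternatingMap.compContinuousLinearMap_apply]
  congr 1
  ext i
  have h2 := fun w => congrArg (fun A : E →L[ℝ] E => A w) h1
  simp only [ContinuousLinearMap.comp_apply, ContinuousLinearMap.id_apply] at h2
  exact h2 _

theorem inChart_self {k : ℕ} (η : DForm E M k) (p : M) :
    inChart η p (extChartAt 𝓘(ℝ, E) p p) = η p := by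
  have := inChart_apply_chart η (mem_extChartAt_source (I := 𝓘(ℝ, E)) p)
  rw [tangentMapAt_chart_self] at this
  rw [← this]; ext v; rfl

theorem eventually_symm_mem {c : M} {u : E} (hu : u ∈ (extChartAt 𝓘(ℝ, E) c).target) {A : Set M}
    (hA : A ∈ 𝓝 ((extChartAt 𝓘(ℝ, E) c).symm u)) :
    ∀ᶠ v in 𝓝 u, v ∈ (extChartAt 𝓘(ℝ, E) c).target ∧ (extChartAt 𝓘(ℝ, E) c).symm v ∈ A :=
  ((isOpen_extChartAt_target c).eventually_mem hu).and
    ((continuousAt_extChartAt_symm'' hu).eventually hA)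

end ChartCalculus

/-! ### Trajectories and short-time flows of time-dependent vector fields -/

section Trajectories

variable {E : Type*} [NormedAddCommGroup E] [NormedSpace ℝ E]
  {M : Type*} [TopologicalSpace M] [ChartedSpace E M] [IsManifold 𝓘(ℝ, E) ∞ M]

/-- The time-dependent vector field `X` is smooth over the time set `J`. -/
def SmoothTimeField (X : ℝ → M → E) (J : Set ℝ) : Prop :=
  ∀ c : M, ContDiffOn ℝ ∞ (fun q : ℝ × E => fieldInChart (X q.1) c q.2)
    (J ×ˢ (extChartAt 𝓘(ℝ, E) c).target)

/-- The velocity of `γ` at time `t` is `X t (γ t)`. -/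
def HasVelocityAt (X : ℝ → M → E) (γ : ℝ → M) (t : ℝ) : Prop :=
  HasMFDerivAt 𝓘(ℝ, ℝ) 𝓘(ℝ, E) γ t
    (ContinuousLinearMap.toSpanSingleton ℝ (X t (γ t)) : ℝ →L[ℝ] E)

theorem HasVelocityAt.continuousAt {X : ℝ → M → E} {γ : ℝ → M} {t : ℝ}
    (h : HasVelocityAt X γ t) : ContinuousAt γ t := HasMFDerivAt.continuousAt h

theorem HasVelocityAt.chart {X : ℝ → M → E} {γ : ℝ → M} {t : ℝ}
    (h : HasVelocityAt X γ t) {c : M} (hc : γ t ∈ (extChartAt 𝓘(ℝ, E) c).source) :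
    HasDerivAt (fun r => extChartAt 𝓘(ℝ, E) c (γ r))
      (fieldInChart (X t) c (extChartAt 𝓘(ℝ, E) c (γ t))) t := by
  have h1 : HasMFDerivAt 𝓘(ℝ, ℝ) 𝓘(ℝ, E) (fun r => extChartAt 𝓘(ℝ, E) c (γ r)) t
      ((tangentMapAt E (extChartAt 𝓘(ℝ, E) c) (γ t)).comp
        (ContinuousLinearMap.toSpanSingleton ℝ (X t (γ t))) : ℝ →L[ℝ] E) :=
    (mdifferentiableAt_chart hc).hasMFDerivAt.comp t h
  have h2 : HasFDerivAt (fun r => extChartAt 𝓘(ℝ, E) c (γ r))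
      ((tangentMapAt E (extChartAt 𝓘(ℝ, E) c) (γ t)).comp
        (ContinuousLinearMap.toSpanSingleton ℝ (X t (γ t))) : ℝ →L[ℝ] E) t := h1.hasFDerivAt
  refine h2.hasDerivAt.congr_deriv ?_
  rw [fieldInChart, (extChartAt 𝓘(ℝ, E) c).left_inv hc]
  simp

theorem hasVelocityAt_chart_symm {X : ℝ → M → E} {c : M} {u : ℝ → E} {t : ℝ}
    (hu : u t ∈ (extChartAt 𝓘(ℝ, E) c).target)
    (h : HasDerivAt u (fieldInChart (X t) c (u t)) t) :
    HasVelocityAt X (fun r => (extChartAt 𝓘(ℝ, E) c).symm (u r)) t := by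
  have h1 : HasMFDerivAt 𝓘(ℝ, ℝ) 𝓘(ℝ, E) (fun r => (extChartAt 𝓘(ℝ, E) c).symm (u r)) t
      ((tangentMapAt E (extChartAt 𝓘(ℝ, E) c).symm (u t)).comp
        (ContinuousLinearMap.toSpanSingleton ℝ (fieldInChart (X t) c (u t))) : ℝ →L[ℝ] E) :=
    (mdifferentiableAt_chart_symm hu).hasMFDerivAt.comp t h.hasFDerivAt.hasMFDerivAt
  rwa [ContinuousLinearMap.comp_toSpanSingleton, tangentMapAt_symm_fieldInChart (X t) hu] at h1

theorem HasVelocityAt.map {X : ℝ → M → E} {γ : ℝ → M} {t : ℝ} (h : HasVelocityAt X γ t)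
    {g : M → M} (hg : MDifferentiableAt 𝓘(ℝ, E) 𝓘(ℝ, E) g (γ t))
    (hX : tangentMapAt E g (γ t) (X t (γ t)) = X t (g (γ t))) :
    HasVelocityAt X (fun r => g (γ r)) t := by
  have h1 : HasMFDerivAt 𝓘(ℝ, ℝ) 𝓘(ℝ, E) (fun r => g (γ r)) t
      ((tangentMapAt E g (γ t)).comp
        (ContinuousLinearMap.toSpanSingleton ℝ (X t (γ t))) : ℝ →L[ℝ] E) :=
    hg.hasMFDerivAt.comp t h
  rwa [ContinuousLinearMap.comp_toSpanSingleton, hX] at h1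

/-- Trajectories that meet agree for nearby times. -/
theorem trajectory_eventuallyEq {X : ℝ → M → E} {J : Set ℝ} (hJ : IsOpen J)
    (hX : SmoothTimeField X J) {γ₁ γ₂ : ℝ → M} {t : ℝ} (ht : t ∈ J)
    (h₁ : ∀ᶠ r in 𝓝 t, HasVelocityAt X γ₁ r) (h₂ : ∀ᶠ r in 𝓝 t, HasVelocityAt X γ₂ r)
    (h : γ₁ t = γ₂ t) : γ₁ =ᶠ[𝓝 t] γ₂ := by
  set c := γ₁ t with hc
  set e := extChartAt 𝓘(ℝ, E) c with he
  have hopen : IsOpen (J ×ˢ e.target) := hJ.prod (isOpen_extChartAt_target c)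
  have hmem : (t, e c) ∈ J ×ˢ e.target := ⟨ht, mem_extChartAt_target c⟩
  have hcd := (hX c).contDiffAt (hopen.mem_nhds hmem)
  obtain ⟨K, s, hs, hK⟩ := (hcd.of_le (m := 1) (by exact_mod_cast le_top)).exists_lipschitzOnWith
  rw [nhds_prod_eq, mem_prod_iff] at hs
  obtain ⟨A, hA, B, hB, hAB⟩ := hs
  have hlip : ∀ᶠ r in 𝓝 t, LipschitzOnWith K (fun u => fieldInChart (X r) c u) B := by
    filter_upwards [hA] with r hr
    intro x hx y hy
    simpa [Prod.edist_eq] using hK (hAB (mk_mem_prod hr hx)) (hAB (mk_mem_prod hr hy))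
  have haux : ∀ γ : ℝ → M, γ t = c → (∀ᶠ r in 𝓝 t, HasVelocityAt X γ r) → ∀ᶠ r in 𝓝 t,
      (HasDerivAt (fun r => e (γ r)) (fieldInChart (X r) c (e (γ r))) r ∧ e (γ r) ∈ B) ∧
        γ r ∈ e.source := by
    intro γ hγ hv
    have hcont : ContinuousAt γ t := hv.self_of_nhds.continuousAt
    have h3 : ∀ᶠ r in 𝓝 t, γ r ∈ e.source :=
      hcont.eventually (by rw [hγ]; exact extChartAt_source_mem_nhds c)
    have h4 : ContinuousAt (fun r => e (γ r)) t :=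
      (by rw [hγ]; exact continuousAt_extChartAt c : ContinuousAt e (γ t)).comp hcont
    have h5 : ∀ᶠ r in 𝓝 t, e (γ r) ∈ B := h4.eventually (by simpa only [hγ] using! hB)
    filter_upwards [hv, h3, h5] with r h6 h7 h8
    exact ⟨⟨h6.chart h7, h8⟩, h7⟩
  have a1 := haux γ₁ rfl h₁
  have a2 := haux γ₂ h.symm h₂
  have := ODE_solution_unique_of_eventually (v := fun r u => fieldInChart (X r) c u)
    (s := fun _ => B) (K := K) hlip (a1.mono fun _ h => h.1) (a2.mono fun _ h => h.1)
    (by simp only [← h]; rw [← hc])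
  filter_upwards [this, a1, a2] with r h1 h2 h3
  exact e.injOn h2.2 h3.2 h1

/-- Trajectories that meet agree on their common interval of definition. -/
theorem trajectory_eqOn [T2Space M] {X : ℝ → M → E} {J : Set ℝ} (hJ : IsOpen J)
    (hX : SmoothTimeField X J) {a b : ℝ} (hab : Ioo a b ⊆ J) {γ₁ γ₂ : ℝ → M}
    (h₁ : ∀ r ∈ Ioo a b, HasVelocityAt X γ₁ r) (h₂ : ∀ r ∈ Ioo a b, HasVelocityAt X γ₂ r)
    {s : ℝ} (hs : s ∈ Ioo a b) (h : γ₁ s = γ₂ s) : EqOn γ₁ γ₂ (Ioo a b) := by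
  set A := {t | t ∈ Ioo a b ∧ γ₁ t = γ₂ t} with hA
  have hAo : IsOpen A := by
    rw [isOpen_iff_mem_nhds]
    rintro t ⟨ht, he⟩
    have hn : ∀ᶠ r in 𝓝 t, r ∈ Ioo a b := isOpen_Ioo.mem_nhds ht
    filter_upwards [trajectory_eventuallyEq hJ hX (hab ht) (hn.mono h₁) (hn.mono h₂) he, hn]
      with r h3 h4 using ⟨h4, h3⟩
  have hsub : Ioo a b ⊆ A := by
    refine isPreconnected_Ioo.subset_of_closure_inter_subset hAo ⟨s, hs, hs, h⟩ ?_
    rintro t ⟨htc, ht⟩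
    refine ⟨ht, ?_⟩
    have hne : (𝓝[A] t).NeBot := mem_closure_iff_nhdsWithin_neBot.1 htc
    have h1 := ((h₁ t ht).continuousAt.tendsto).mono_left (nhdsWithin_le_nhds (s := A))
    have h2 := ((h₂ t ht).continuousAt.tendsto).mono_left (nhdsWithin_le_nhds (s := A))
    refine tendsto_nhds_unique (h1.congr' ?_) h2
    filter_upwards [self_mem_nhdsWithin] with r hr using hr.2
  exact fun t ht => (hsub ht).2

/-- A local flow box: in the chart around `c`, for the initial time `s` and initial points near
`p`, the motion over the times `I` is given by the smooth map `φ`. -/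
structure IsFlowBox (X : ℝ → M → E) (I : Set ℝ) (s : ℝ) (Φ : ℝ → M → M) (c : M)
    (φ : ℝ → E → E) (q : M) : Prop where
  mem_source : q ∈ (extChartAt 𝓘(ℝ, E) c).source
  initial : φ s (extChartAt 𝓘(ℝ, E) c q) = extChartAt 𝓘(ℝ, E) c q
  eq : ∀ t ∈ I, Φ t q = (extChartAt 𝓘(ℝ, E) c).symm (φ t (extChartAt 𝓘(ℝ, E) c q))
  mem_target : ∀ t ∈ I, φ t (extChartAt 𝓘(ℝ, E) c q) ∈ (extChartAt 𝓘(ℝ, E) c).target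
  smooth : ∀ t ∈ I, ContDiffAt ℝ ∞ (fun z : ℝ × E => φ z.1 z.2) (t, extChartAt 𝓘(ℝ, E) c q)
  hasDeriv : ∀ t ∈ I, HasDerivAt (fun t => φ t (extChartAt 𝓘(ℝ, E) c q))
    (fieldInChart (X t) c (φ t (extChartAt 𝓘(ℝ, E) c q))) t

end Trajectories

section Flow

variable {E : Type*} [NormedAddCommGroup E] [NormedSpace ℝ E] [FiniteDimensional ℝ E]
  {M : Type*} [TopologicalSpace M] [ChartedSpace E M] [IsManifold 𝓘(ℝ, E) ∞ M]

/-- On a compact manifold the flow exists for all initial points over one time interval, and is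
locally given by smooth maps in charts. -/
theorem exists_short_flow [T2Space M] [CompactSpace M] {X : ℝ → M → E} {J : Set ℝ} (hJ : IsOpen J)
    (hX : SmoothTimeField X J) {t₀ : ℝ} (ht₀ : t₀ ∈ J) :
    ∃ ε > 0, Ioo (t₀ - ε) (t₀ + ε) ⊆ J ∧ ∃ Φ : ℝ → ℝ → M → M, ∀ s ∈ Ioo (t₀ - ε) (t₀ + ε),
      ∀ p, Φ s s p = p ∧ (∀ t ∈ Ioo (t₀ - ε) (t₀ + ε), HasVelocityAt X (fun r => Φ s r p) t) ∧
        ∃ c φ, ∀ᶠ q in 𝓝 p, IsFlowBox X (Ioo (t₀ - ε) (t₀ + ε)) s (Φ s) c φ q := by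
  have hloc : ∀ p : M, ∃ ε > 0, ∃ φ : ℝ → ℝ → E → E, ∀ s ∈ Ioo (t₀ - ε) (t₀ + ε),
      ∀ u ∈ Metric.ball (extChartAt 𝓘(ℝ, E) p p) ε, φ s s u = u ∧ ∀ t ∈ Ioo (t₀ - ε) (t₀ + ε),
        ContDiffAt ℝ ∞ (fun q : ℝ × E => φ s q.1 q.2) (t, u) ∧
        (t, φ s t u) ∈ J ×ˢ (extChartAt 𝓘(ℝ, E) p).target ∧
        HasDerivAt (fun t => φ s t u) (fieldInChart (X t) p (φ s t u)) t := fun p =>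
    exists_smooth_timeFlow (hJ.prod (isOpen_extChartAt_target p)) (hX p)
      (mk_mem_prod ht₀ (mem_extChartAt_target p))
  choose ε hε φ hφ using hloc
  set U : M → Set M := fun p => (extChartAt 𝓘(ℝ, E) p).source ∩
    extChartAt 𝓘(ℝ, E) p ⁻¹' Metric.ball (extChartAt 𝓘(ℝ, E) p p) (ε p) with hU
  have hUo : ∀ p, IsOpen (U p) := fun p =>
    (continuousOn_extChartAt p).isOpen_inter_preimage (isOpen_extChartAt_source p) Metric.isOpen_ball
  have hUm : ∀ p, p ∈ U p := fun p => ⟨mem_extChartAt_source p, Metric.mem_ball_self (hε p)⟩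
  obtain ⟨F, hF⟩ := CompactSpace.elim_nhds_subcover U fun p => (hUo p).mem_nhds (hUm p)
  obtain ⟨ε₀, hε₀, hJε⟩ := Metric.isOpen_iff.1 hJ t₀ ht₀
  rw [Real.ball_eq_Ioo] at hJε
  obtain ⟨ε', hε', hlt⟩ : ∃ ε' > 0, ε' ≤ ε₀ ∧ ∀ p ∈ F, ε' ≤ ε p := by
    rcases F.eq_empty_or_nonempty with h | h
    · exact ⟨ε₀, hε₀, le_rfl, by simp [h]⟩
    · refine ⟨min ε₀ (F.inf' h ε), lt_min hε₀ ((Finset.lt_inf'_iff h).2 fun p _ => hε p),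
        min_le_left _ _, fun p hp => (min_le_right _ _).trans (Finset.inf'_le _ hp)⟩
  have hcov : ∀ p : M, ∃ i ∈ F, p ∈ U i := by
    intro p
    have : p ∈ ⋃ x ∈ F, U x := by rw [hF]; trivial
    simpa using this
  choose i hiF hi using hcov
  set I := Ioo (t₀ - ε') (t₀ + ε') with hI
  have hIJ : I ⊆ J := fun t ht => hJε ⟨by linarith [ht.1, hlt.1], by linarith [ht.2, hlt.1]⟩
  have hIi : ∀ j ∈ F, I ⊆ Ioo (t₀ - ε j) (t₀ + ε j) := fun j hj t ht =>
    ⟨by linarith [ht.1, hlt.2 j hj], by linarith [ht.2, hlt.2 j hj]⟩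
  -- the motion computed in the chart around `j`
  set Ψ : M → ℝ → ℝ → M → M := fun j s t p =>
    (extChartAt 𝓘(ℝ, E) j).symm (φ j s t (extChartAt 𝓘(ℝ, E) j p)) with hΨ
  have hΨs : ∀ j ∈ F, ∀ p ∈ U j, ∀ s ∈ I, Ψ j s s p = p := by
    intro j hj p hp s hs
    have := (hφ j s (hIi j hj hs) _ hp.2).1
    simp only [hΨ]
    rw [this, (extChartAt 𝓘(ℝ, E) j).left_inv hp.1]
  have hΨv : ∀ j ∈ F, ∀ p ∈ U j, ∀ s ∈ I, ∀ t ∈ I, HasVelocityAt X (fun r => Ψ j s r p) t := by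
    intro j hj p hp s hs t ht
    obtain ⟨-, h1, h2⟩ := (hφ j s (hIi j hj hs) _ hp.2).2 t (hIi j hj ht)
    exact hasVelocityAt_chart_symm h1.2 h2
  have hΨeq : ∀ j ∈ F, ∀ p ∈ U j, ∀ s ∈ I, ∀ t ∈ I, Ψ (i p) s t p = Ψ j s t p := by
    intro j hj p hp s hs
    refine trajectory_eqOn hJ hX hIJ (hΨv _ (hiF p) p (hi p) s hs) (hΨv j hj p hp s hs) hs ?_
    rw [hΨs _ (hiF p) p (hi p) s hs, hΨs j hj p hp s hs]
  refine ⟨ε', hε', hIJ, fun s t p => Ψ (i p) s t p, fun s hs p =>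
    ⟨hΨs _ (hiF p) p (hi p) s hs, hΨv _ (hiF p) p (hi p) s hs, i p, φ (i p) s, ?_⟩⟩
  filter_upwards [(hUo (i p)).mem_nhds (hi p)] with q hq
  have h1 := hφ (i p) s (hIi _ (hiF p) hs) _ hq.2
  exact
    { mem_source := hq.1
      initial := h1.1
      eq := fun t ht => hΨeq (i p) (hiF p) q hq s hs t ht
      mem_target := fun t ht => (h1.2 t (hIi _ (hiF p) ht)).2.1.2
      smooth := fun t ht => (h1.2 t (hIi _ (hiF p) ht)).1
      hasDeriv := fun t ht => (h1.2 t (hIi _ (hiF p) ht)).2.2 }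

end Flow

/-! ### Linear algebra of the plane and the variational equation -/

section PlaneAlgebra

/-- The model plane `ℝ²`. -/
abbrev Plane : Type := EuclideanSpace ℝ (Fin 2)

/-- The standard basis of `ℝ²`. -/
def planeBasis (i : Fin 2) : Plane := EuclideanSpace.single i 1

@[simp] theorem planeBasis_apply (i j : Fin 2) : planeBasis i j = if j = i then 1 else 0 := by
  simp [planeBasis]

theorem plane_eq (v : Plane) : v = v 0 • planeBasis 0 + v 1 • planeBasis 1 := by
  ext i; fin_cases i <;> simp

theorem plane_map {F : Type*} [NormedAddCommGroup F] [NormedSpace ℝ F] (A : Plane →L[ℝ] F)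
    (v : Plane) : A v = v 0 • A (planeBasis 0) + v 1 • A (planeBasis 1) := by
  conv_lhs => rw [plane_eq v]
  simp only [map_add, map_smul]

/-- The determinant of an endomorphism of `ℝ²`, written out in coordinates. -/
def planeDet (A : Plane →L[ℝ] Plane) : ℝ :=
  A (planeBasis 0) 0 * A (planeBasis 1) 1 - A (planeBasis 0) 1 * A (planeBasis 1) 0

/-- The trace of an endomorphism of `ℝ²`. -/
def planeTrace (A : Plane →L[ℝ] Plane) : ℝ := A (planeBasis 0) 0 + A (planeBasis 1) 1

/-- The coefficient of a two-form on the plane with respect to `dx₀ ∧ dx₁`. -/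
def planeCoeff (η : Plane [⋀^Fin 2]→L[ℝ] ℝ) : ℝ := η ![planeBasis 0, planeBasis 1]

theorem twoForm_apply (η : Plane [⋀^Fin 2]→L[ℝ] ℝ) (a b : Plane) :
    η ![a, b] = (a 0 * b 1 - a 1 * b 0) * planeCoeff η := by
  have e0 : ∀ z w : Plane, Function.update ![0, z] 0 w = ![w, z] := fun z w => by
    ext i j; fin_cases i <;> rfl
  have e1 : ∀ z w : Plane, Function.update ![z, 0] 1 w = ![z, w] := fun z w => by
    ext i j; fin_cases i <;> rfl
  have hadd : ∀ (x y z : Plane), η ![x + y, z] = η ![x, z] + η ![y, z] := fun x y z => by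
    have := η.map_update_add ![0, z] 0 x y
    rwa [e0, e0, e0] at this
  have hsm : ∀ (r : ℝ) (x z : Plane), η ![r • x, z] = r * η ![x, z] := fun r x z => by
    have := η.map_update_smul ![0, z] 0 r x
    rwa [e0, e0] at this
  have hadd' : ∀ (x y z : Plane), η ![z, x + y] = η ![z, x] + η ![z, y] := fun x y z => by
    have := η.map_update_add ![z, 0] 1 x y
    rwa [e1, e1, e1] at this
  have hsm' : ∀ (r : ℝ) (x z : Plane), η ![z, r • x] = r * η ![z, x] := fun r x z => by
    have := η.map_update_smul ![z, 0] 1 r x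
    rwa [e1, e1] at this
  have hself : ∀ x : Plane, η ![x, x] = 0 := fun x =>
    η.map_eq_zero_of_eq ![x, x] (i := 0) (j := 1) rfl (by decide)
  have hswap : η ![planeBasis 1, planeBasis 0] = - η ![planeBasis 0, planeBasis 1] := by
    have := hself (planeBasis 0 + planeBasis 1)
    rw [hadd, hadd', hadd', hself, hself] at this
    linarith
  conv_lhs => rw [plane_eq a, plane_eq b]
  rw [hadd, hadd', hadd', hsm, hsm, hsm, hsm, hsm', hsm', hsm', hsm', hself, hself, hswap]
  unfold planeCoeff
  ring

theorem twoForm_ext {η η' : Plane [⋀^Fin 2]→L[ℝ] ℝ} (h : planeCoeff η = planeCoeff η') :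
    η = η' := by
  ext v
  have hv : v = ![v 0, v 1] := by ext i j; fin_cases i <;> rfl
  rw [hv, twoForm_apply, twoForm_apply, h]

theorem planeCoeff_comp (η : Plane [⋀^Fin 2]→L[ℝ] ℝ) (A : Plane →L[ℝ] Plane) :
    planeCoeff (η.compContinuousLinearMap A) = planeDet A * planeCoeff η := by
  have : planeCoeff (η.compContinuousLinearMap A) = η ![A (planeBasis 0), A (planeBasis 1)] := by
    unfold planeCoeff
    rw [ContinuousAlternatingMap.compContinuousLinearMap_apply]
    congr 1
    ext i j; fin_cases i <;> rfl
  rw [this, twoForm_apply]; rfl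

theorem planeCoeff_smul (r : ℝ) (η : Plane [⋀^Fin 2]→L[ℝ] ℝ) :
    planeCoeff (r • η) = r * planeCoeff η := rfl

theorem planeDet_id : planeDet (ContinuousLinearMap.id ℝ Plane) = 1 := by
  simp [planeDet]

theorem planeDet_comp (A B : Plane →L[ℝ] Plane) :
    planeDet (A.comp B) = planeDet A * planeDet B := by
  simp only [planeDet, ContinuousLinearMap.comp_apply]
  rw [plane_map A (B (planeBasis 0)), plane_map A (B (planeBasis 1))]
  simp only [PiLp.add_apply, PiLp.smul_apply, smul_eq_mul]
  ring

/-- Jacobi's formula in the plane. -/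
theorem hasDerivAt_planeDet {A : ℝ → Plane →L[ℝ] Plane} {B : Plane →L[ℝ] Plane} {t : ℝ}
    (h : ∀ v, HasDerivAt (fun r => A r v) (B (A t v)) t) :
    HasDerivAt (fun r => planeDet (A r)) (planeTrace B * planeDet (A t)) t := by
  have hc : ∀ v (i : Fin 2), HasDerivAt (fun r => A r v i) (B (A t v) i) t := fun v i =>
    (EuclideanSpace.proj (𝕜 := ℝ) i).hasFDerivAt.comp_hasDerivAt t (h v)
  have := ((hc (planeBasis 0) 0).mul (hc (planeBasis 1) 1)).sub
    ((hc (planeBasis 0) 1).mul (hc (planeBasis 1) 0))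
  refine this.congr_deriv ?_
  rw [plane_map B (A t (planeBasis 0)), plane_map B (A t (planeBasis 1))]
  simp only [PiLp.add_apply, PiLp.smul_apply, smul_eq_mul, planeTrace, planeDet]
  ring

theorem contDiff_planeCoeff {n : WithTop ℕ∞} : ContDiff ℝ n planeCoeff :=
  (ContinuousAlternatingMap.apply ℝ Plane ℝ ![planeBasis 0, planeBasis 1]).contDiff

end PlaneAlgebra

section Variation

variable {E : Type*} [NormedAddCommGroup E] [NormedSpace ℝ E]

/-- The variational equation: the derivative of a flow with respect to the initial value solves
the linearised equation. -/
theorem hasDerivAt_fderiv_flow {φ : ℝ → E → E} {f : E → E} {t : ℝ} {u₀ : E}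
    (hφ : ContDiffAt ℝ ∞ (fun z : ℝ × E => φ z.1 z.2) (t, u₀))
    (hd : ∀ᶠ u in 𝓝 u₀, HasDerivAt (fun r => φ r u) (f (φ t u)) t)
    (hf : DifferentiableAt ℝ f (φ t u₀)) (v : E) :
    HasDerivAt (fun r => fderiv ℝ (φ r) u₀ v)
      (fderiv ℝ f (φ t u₀) (fderiv ℝ (φ t) u₀ v)) t := by
  set g : ℝ × E → E := fun z => φ z.1 z.2 with hg
  have h2 : ContDiffAt ℝ 2 g (t, u₀) :=
    hφ.of_le (WithTop.coe_le_coe.2 (le_top : (2 : ℕ∞) ≤ ⊤))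
  have hev : ∀ᶠ z in 𝓝 (t, u₀), DifferentiableAt ℝ g z := by
    have h1 : ContDiffAt ℝ 1 g (t, u₀) := hφ.of_le (by exact_mod_cast le_top)
    filter_upwards [h1.eventually (by simp)] with z hz using hz.differentiableAt (by simp)
  have hslice : ∀ r u, DifferentiableAt ℝ g (r, u) →
      HasFDerivAt (φ r) ((fderiv ℝ g (r, u)).comp (.inr ℝ ℝ E)) u := fun r u h =>
    h.hasFDerivAt.comp u (hasFDerivAt_prodMk_right r u)
  have hdd : DifferentiableAt ℝ (fderiv ℝ g) (t, u₀) :=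
    (h2.fderiv_right (m := 1) (by norm_num)).differentiableAt (by simp)
  have hsymm : IsSymmSndFDerivAt ℝ g (t, u₀) := h2.isSymmSndFDerivAt (by simp)
  -- the time derivative of the spatial derivative
  have hleft : HasDerivAt (fun r => fderiv ℝ g (r, u₀) (0, v))
      (fderiv ℝ (fderiv ℝ g) (t, u₀) (1, 0) (0, v)) t := by
    have h3 : HasDerivAt (fun r : ℝ => (r, u₀)) ((1, 0) : ℝ × E) t :=
      (hasDerivAt_id t).prodMk (hasDerivAt_const t u₀)
    have h4 := hdd.hasFDerivAt.comp_hasDerivAt t h3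
    exact h4.clm_apply (hasDerivAt_const t ((0, v) : ℝ × E)) |>.congr_deriv (by simp)
  have hright : HasFDerivAt (fun u => fderiv ℝ g (t, u) (1, 0))
      (((fderiv ℝ (fderiv ℝ g) (t, u₀)).comp (.inr ℝ ℝ E)).flip (1, 0)) u₀ := by
    have h4 := hdd.hasFDerivAt.comp u₀ (hasFDerivAt_prodMk_right t u₀)
    exact (h4.clm_apply (hasFDerivAt_const ((1, 0) : ℝ × E) u₀)).congr_fderiv (by ext; simp)
  have hprod : Tendsto (fun u : E => (t, u)) (𝓝 u₀) (𝓝 (t, u₀)) :=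
    (Continuous.prodMk_right t).tendsto u₀
  have hprod' : Tendsto (fun r : ℝ => (r, u₀)) (𝓝 t) (𝓝 (t, u₀)) :=
    (Continuous.prodMk_left u₀).tendsto t
  have heq : (fun u => fderiv ℝ g (t, u) (1, 0)) =ᶠ[𝓝 u₀] fun u => f (φ t u) := by
    filter_upwards [hd, hprod.eventually hev] with u h5 h6
    have h7 := h6.hasFDerivAt.comp_hasDerivAt t ((hasDerivAt_id t).prodMk (hasDerivAt_const t u))
    exact h7.unique h5
  have hφt := hslice t u₀ hev.self_of_nhds
  have hcomp := (hf.hasFDerivAt.comp u₀ hφt).congr_of_eventuallyEq heq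
  have key := congrArg (fun A : E →L[ℝ] E => A v) (hright.unique hcomp)
  have key' : fderiv ℝ (fderiv ℝ g) (t, u₀) (0, v) (1, 0) =
      fderiv ℝ f (φ t u₀) (fderiv ℝ (φ t) u₀ v) := by
    rw [hφt.fderiv]; simpa using key
  have hfin : (fun r => fderiv ℝ (φ r) u₀ v) =ᶠ[𝓝 t] fun r => fderiv ℝ g (r, u₀) (0, v) := by
    filter_upwards [hprod'.eventually hev] with r hr
    rw [(hslice r u₀ hr).fderiv]; simp
  refine (hleft.congr_of_eventuallyEq hfin).congr_deriv ?_
  rw [← key', hsymm.eq]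

end Variation

/-! ### Invariance of a closed set and the continuity equation -/

section Invariance

variable {E : Type*} [NormedAddCommGroup E] [NormedSpace ℝ E]
  {M : Type*} [TopologicalSpace M] [ChartedSpace E M] [IsManifold 𝓘(ℝ, E) ∞ M]

/-- The vector field `X` is smooth: all its chart expressions are. -/
def SmoothField (X : M → E) : Prop :=
  ∀ c : M, ContDiffOn ℝ ∞ (fieldInChart X c) (extChartAt 𝓘(ℝ, E) c).target

/-- Quantitative tangency of `X` to `Z`: near each of its points, `Z` is the zero set of a function
`x` such that `|dx(X)| ≤ C |x|`. The function `x` may have critical points, so `Z` may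
be open. -/
def IsTangentTo (Z : Set M) (X : M → E) : Prop :=
  ∀ p ∈ Z, ∃ U ∈ 𝓝 p, ∃ (x : M → ℝ) (C : ℝ), ∀ q ∈ U,
    MDifferentiableAt 𝓘(ℝ, E) 𝓘(ℝ, ℝ) x q ∧ (x q = 0 ↔ q ∈ Z) ∧
      |differential E x q (X q)| ≤ C * |x q|

/-- Gronwall's inequality, as uniqueness for the linear equation `y' = (f' / f) y`, whose
coefficient is bounded by `K` (and is `0` where `f` vanishes). -/
theorem eventuallyEq_zero_of_abs_deriv_le {f f' : ℝ → ℝ} {t K : ℝ} (h0 : f t = 0)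
    (hd : ∀ᶠ r in 𝓝 t, HasDerivAt f (f' r) r) (hb : ∀ᶠ r in 𝓝 t, |f' r| ≤ K * |f r|) :
    f =ᶠ[𝓝 t] fun _ => 0 := by
  have hlip : ∀ᶠ r in 𝓝 t, LipschitzOnWith K.toNNReal (fun y : ℝ => f' r / f r * y) univ := by
    filter_upwards [hb] with r hr
    apply LipschitzWith.lipschitzOnWith
    apply LipschitzWith.of_dist_le_mul
    intro x y
    rw [Real.dist_eq, Real.dist_eq, ← mul_sub, abs_mul]
    refine mul_le_mul_of_nonneg_right ?_ (abs_nonneg _)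
    by_cases hf : f r = 0
    · rw [hf, div_zero, abs_zero]; exact K.toNNReal.2
    · refine le_trans ?_ (Real.le_coe_toNNReal K)
      rw [abs_div, div_le_iff₀ (abs_pos.2 hf)]; exact hr
  refine ODE_solution_unique_of_eventually (v := fun r y => f' r / f r * y) (s := fun _ => univ)
    hlip ?_ ?_ h0
  · filter_upwards [hd, hb] with r h1 h2
    refine ⟨?_, trivial⟩
    by_cases hf : f r = 0
    · have : f' r = 0 := by simpa [hf] using h2
      rw [this] at h1; simpa [this] using h1
    · rwa [div_mul_cancel₀ _ hf]
  · exact Eventually.of_forall fun r => ⟨by simpa using hasDerivAt_const r (0 : ℝ), trivial⟩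

/-- A trajectory of a multiple `κ X` of a field tangent to `Z` that meets `Z` stays in `Z`. -/
theorem trajectory_mem {Z : Set M} (hZ : IsClosed Z) {X : M → E} (hX : IsTangentTo Z X)
    {κ : ℝ → M → ℝ} {a b : ℝ} {γ : ℝ → M}
    (hκ : ∀ t ∈ Ioo a b, ContinuousAt (fun r => κ r (γ r)) t)
    (hγ : ∀ t ∈ Ioo a b, HasVelocityAt (fun t p => κ t p • X p) γ t) {s t : ℝ} (hs : s ∈ Ioo a b)
    (ht : t ∈ Ioo a b) : γ s ∈ Z → γ t ∈ Z := by
  intro hsZ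
  set A := {t | t ∈ Ioo a b ∧ γ t ∈ Z} with hA
  have hAo : IsOpen A := by
    rw [isOpen_iff_mem_nhds]
    rintro r ⟨hr, hrZ⟩
    obtain ⟨U, hU, x, C, h⟩ := hX _ hrZ
    have hn : ∀ᶠ r in 𝓝 r, r ∈ Ioo a b := isOpen_Ioo.mem_nhds hr
    have hUr : ∀ᶠ r in 𝓝 r, γ r ∈ U := (hγ r hr).continuousAt.eventually hU
    have hK : ∀ᶠ r' in 𝓝 r, |κ r' (γ r')| < |κ r (γ r)| + 1 :=
      (hκ r hr).abs.eventually_lt continuousAt_const (by linarith)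
    have hd : ∀ᶠ r in 𝓝 r, HasDerivAt (fun r => x (γ r))
        (differential E x (γ r) (κ r (γ r) • X (γ r))) r := by
      filter_upwards [hn, hUr] with r' h1 h2
      have h3 : HasMFDerivAt 𝓘(ℝ, ℝ) 𝓘(ℝ, ℝ) (fun r => x (γ r)) r'
        ((differential E x (γ r')).comp
          (ContinuousLinearMap.toSpanSingleton ℝ (κ r' (γ r') • X (γ r'))) : ℝ →L[ℝ] ℝ) :=
        (h _ h2).1.hasMFDerivAt.comp r' (hγ r' h1)
      have h4 : HasFDerivAt (fun r => x (γ r)) ((differential E x (γ r')).comp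
          (ContinuousLinearMap.toSpanSingleton ℝ (κ r' (γ r') • X (γ r'))) : ℝ →L[ℝ] ℝ) r' :=
        h3.hasFDerivAt
      exact h4.hasDerivAt.congr_deriv (by simp)
    have hz := eventuallyEq_zero_of_abs_deriv_le (K := (|κ r (γ r)| + 1) * C)
      ((h _ hUr.self_of_nhds).2.1.2 hrZ) hd (by
        filter_upwards [hUr, hK] with r' h1 h2
        rw [map_smul, smul_eq_mul, abs_mul, mul_assoc]
        exact mul_le_mul h2.le (h _ h1).2.2 (abs_nonneg _) (by positivity))
    filter_upwards [hz, hn, hUr] with r' h1 h2 h3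
    exact ⟨h2, (h _ h3).2.1.1 h1⟩
  have hsub : Ioo a b ⊆ A := by
    refine isPreconnected_Ioo.subset_of_closure_inter_subset hAo ⟨s, hs, hs, hsZ⟩ ?_
    rintro t ⟨htc, ht⟩
    refine ⟨ht, ?_⟩
    have hne : (𝓝[A] t).NeBot := mem_closure_iff_nhdsWithin_neBot.1 htc
    have h1 := ((hγ t ht).continuousAt.tendsto).mono_left (nhdsWithin_le_nhds (s := A))
    refine hZ.mem_of_tendsto h1 ?_
    filter_upwards [self_mem_nhdsWithin] with r hr using hr.2
  exact (hsub ht).2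

end Invariance

section Moser

variable {M : Type*} [TopologicalSpace M] [ChartedSpace Plane M] [IsManifold 𝓘(ℝ, Plane) ∞ M]

/-- The coefficient of a two-form on a surface in the chart around `c`. -/
def coeffInChart (η : DForm Plane M 2) (c : M) (u : Plane) : ℝ := planeCoeff (inChart η c u)

/-- Off `Z`, the divergence of `X` with respect to the area form `η` is `θ`: in every chart
`div (w X) = θ w`, where `w` is the coefficient of `η`. -/
def HasDivergence (Z : Set M) (η : DForm Plane M 2) (X : M → Plane) (θ : M → ℝ) : Prop :=
  ∀ c : M, ∀ u ∈ (extChartAt 𝓘(ℝ, Plane) c).target, (extChartAt 𝓘(ℝ, Plane) c).symm u ∉ Z →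
    fderiv ℝ (coeffInChart η c) u (fieldInChart X c u) +
      coeffInChart η c u * planeTrace (fderiv ℝ (fieldInChart X c) u) =
    θ ((extChartAt 𝓘(ℝ, Plane) c).symm u) * coeffInChart η c u

/-- The scalar function `θ` is smooth: all its chart expressions are. -/
def SmoothScalar (θ : M → ℝ) : Prop :=
  ∀ c : M, ContDiffOn ℝ ∞ (fun u => θ ((extChartAt 𝓘(ℝ, Plane) c).symm u))
    (extChartAt 𝓘(ℝ, Plane) c).target

theorem SmoothScalar.continuous {θ : M → ℝ} (h : SmoothScalar θ) : Continuous θ := by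
  rw [continuous_iff_continuousAt]
  intro p
  have h1 := (h p).continuousOn.continuousAt
    ((isOpen_extChartAt_target p).mem_nhds (mem_extChartAt_target (I := 𝓘(ℝ, Plane)) p))
  have h2 := h1.comp (continuousAt_extChartAt (I := 𝓘(ℝ, Plane)) p)
  refine h2.congr ?_
  filter_upwards [eventually_chart_symm_chart (mem_extChartAt_source (I := 𝓘(ℝ, Plane)) p)]
    with q hq
  exact congrArg θ hq

/-- The field `X / (1 - t θ)`. If `div X = θ` with respect to `η`, its flow transports the densities
`(1 - t θ) η` into each other. It is used only for `t` with `1 - t θ > 0`. -/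
def moserField (X : M → Plane) (θ : M → ℝ) (t : ℝ) (p : M) : Plane := (1 - t * θ p)⁻¹ • X p

theorem fieldInChart_moserField (X : M → Plane) (θ : M → ℝ) (t : ℝ) (c : M) (u : Plane) :
    fieldInChart (moserField X θ t) c u =
      (1 - t * θ ((extChartAt 𝓘(ℝ, Plane) c).symm u))⁻¹ • fieldInChart X c u := by
  simp only [fieldInChart, moserField, map_smul]

theorem smoothTimeField_moserField {X : M → Plane} {θ : M → ℝ} (hX : SmoothField X)
    (hθ : SmoothScalar θ) {J : Set ℝ} (hJ : ∀ t ∈ J, ∀ p, 0 < 1 - t * θ p) :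
    SmoothTimeField (moserField X θ) J := by
  intro c
  have h1 : ContDiffOn ℝ ∞ (fun q : ℝ × Plane => fieldInChart X c q.2)
      (J ×ˢ (extChartAt 𝓘(ℝ, Plane) c).target) :=
    (hX c).comp contDiffOn_snd fun q hq => hq.2
  have h2 : ContDiffOn ℝ ∞ (fun q : ℝ × Plane => θ ((extChartAt 𝓘(ℝ, Plane) c).symm q.2))
      (J ×ˢ (extChartAt 𝓘(ℝ, Plane) c).target) :=
    (hθ c).comp contDiffOn_snd fun q hq => hq.2
  have h3 := ((contDiffOn_const (c := (1 : ℝ))).sub (contDiffOn_fst.mul h2)).inv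
    (fun q hq => (hJ q.1 hq.1 _).ne')
  refine (h3.smul h1).congr fun q _ => ?_
  exact fieldInChart_moserField X θ q.1 c q.2

theorem contDiffOn_coeffInChart {Z : Set M} {η : DForm Plane M 2} (hη : SmoothFormOn η Zᶜ) (c : M) :
    ContDiffOn ℝ ∞ (coeffInChart η c)
      ((extChartAt 𝓘(ℝ, Plane) c).target ∩ (extChartAt 𝓘(ℝ, Plane) c).symm ⁻¹' Zᶜ) :=
  contDiff_planeCoeff.comp_contDiffOn (hη c)

theorem contDiffAt_coeffInChart {Z : Set M} (hZ : IsClosed Z) {η : DForm Plane M 2}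
    (hη : SmoothFormOn η Zᶜ) {c : M} {u : Plane} (hu : u ∈ (extChartAt 𝓘(ℝ, Plane) c).target)
    (huZ : (extChartAt 𝓘(ℝ, Plane) c).symm u ∉ Z) : ContDiffAt ℝ ∞ (coeffInChart η c) u :=
  (contDiffOn_coeffInChart hη c).contDiffAt
    (eventually_symm_mem hu (hZ.isOpen_compl.mem_nhds huZ))

/-- The continuity equation along the flow of `X / (1 - t θ)`: the density `(1 - t θ) η`,
transported by the flow, does not change. -/
theorem hasDerivAt_moser_density {Z : Set M} (hZ : IsClosed Z) {η : DForm Plane M 2}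
    (hη : SmoothFormOn η Zᶜ) {X : M → Plane} (hX : SmoothField X) {θ : M → ℝ}
    (hθ : SmoothScalar θ) (hdiv : HasDivergence Z η X θ) {c : M} {φ : ℝ → Plane → Plane} {t : ℝ}
    {u₀ : Plane} (hpos : 0 < 1 - t * θ ((extChartAt 𝓘(ℝ, Plane) c).symm (φ t u₀)))
    (htar : φ t u₀ ∈ (extChartAt 𝓘(ℝ, Plane) c).target)
    (hoff : (extChartAt 𝓘(ℝ, Plane) c).symm (φ t u₀) ∉ Z)
    (hφ : ContDiffAt ℝ ∞ (fun z : ℝ × Plane => φ z.1 z.2) (t, u₀))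
    (hd : ∀ᶠ u in 𝓝 u₀, HasDerivAt (fun r => φ r u)
      (fieldInChart (moserField X θ t) c (φ t u)) t) :
    HasDerivAt (fun r => (1 - r * θ ((extChartAt 𝓘(ℝ, Plane) c).symm (φ r u₀))) *
      coeffInChart η c (φ r u₀) * planeDet (fderiv ℝ (φ r) u₀)) 0 t := by
  set y := φ t u₀ with hy
  set Xc := fieldInChart X c with hXc
  set w := coeffInChart η c with hw
  set τ : Plane → ℝ := fun u => θ ((extChartAt 𝓘(ℝ, Plane) c).symm u) with hτ
  have hnhds := (isOpen_extChartAt_target (I := 𝓘(ℝ, Plane)) c).mem_nhds htar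
  have dX : DifferentiableAt ℝ Xc y := ((hX c).contDiffAt hnhds).differentiableAt (by simp)
  have dτ : DifferentiableAt ℝ τ y := ((hθ c).contDiffAt hnhds).differentiableAt (by simp)
  have dw : DifferentiableAt ℝ w y :=
    (contDiffAt_coeffInChart hZ hη htar hoff).differentiableAt (by simp)
  have hfield : fieldInChart (moserField X θ t) c = fun u => (1 - t * τ u)⁻¹ • Xc u := by
    funext u; exact fieldInChart_moserField X θ t c u
  have hpos' : 1 - t * τ y ≠ 0 := hpos.ne'
  have hinv : HasFDerivAt (fun u => (1 - t * τ u)⁻¹)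
      (((1 - t * τ y) ^ 2)⁻¹ • (t • fderiv ℝ τ y)) y := by
    have h1 : HasFDerivAt (fun u => 1 - t * τ u) (-(t • fderiv ℝ τ y)) y := by
      simpa using (dτ.hasFDerivAt.const_mul t).const_sub 1
    have h2 := (hasDerivAt_inv hpos').comp_hasFDerivAt y h1
    refine h2.congr_fderiv ?_
    ext v; simp
  have hfd := hinv.fun_smul dX.hasFDerivAt
  rw [hfield] at hd
  have hy' := hd.self_of_nhds
  have hdet := hasDerivAt_planeDet (A := fun r => fderiv ℝ (φ r) u₀) fun v =>
    hasDerivAt_fderiv_flow hφ hd hfd.differentiableAt v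
  have hw' := dw.hasFDerivAt.comp_hasDerivAt t hy'
  have hτ' := dτ.hasFDerivAt.comp_hasDerivAt t hy'
  have hρ := ((hasDerivAt_id t).mul hτ').const_sub 1
  have hall := (hρ.mul hw').mul hdet
  refine hall.congr_deriv ?_
  have htr : planeTrace (fderiv ℝ (fun u => (1 - t * τ u)⁻¹ • Xc u) y) =
      (1 - t * τ y)⁻¹ * planeTrace (fderiv ℝ Xc y) +
        ((1 - t * τ y) ^ 2)⁻¹ * (t * fderiv ℝ τ y (Xc y)) := by
    rw [hfd.fderiv, plane_map (fderiv ℝ τ y) (Xc y)]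
    simp [planeTrace]
    ring
  rw [htr]
  have hD := hdiv c y htar hoff
  simp only [← hXc, ← hw] at hD
  change _ = τ y * w y at hD
  simp only [Function.comp_def, id, ← hy, map_smul, smul_eq_mul, Pi.mul_apply]
  set D := planeDet (fderiv ℝ (φ t) u₀)
  have hi : (1 - t * τ y) * (1 - t * τ y)⁻¹ = 1 := mul_inv_cancel₀ hpos'
  rw [← inv_pow]
  linear_combination D * hD + (fderiv ℝ w y (Xc y) * D + w y * planeTrace (fderiv ℝ Xc y) * D +
    (1 - t * τ y)⁻¹ * t * fderiv ℝ τ y (Xc y) * w y * D) * hi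

end Moser

/-! ### Moser's lemma -/

section MoserLemma

variable {M : Type*} [TopologicalSpace M] [ChartedSpace Plane M] [IsManifold 𝓘(ℝ, Plane) ∞ M]

/-- `γ` carries the density `(1 - t θ) η` back to `(1 - s θ) η`, preserves `Z`, and commutes with
all the symmetries of `X` and `θ`. -/
structure IsMoserMap (Z : Set M) (η : DForm Plane M 2) (X : M → Plane) (θ : M → ℝ) (s t : ℝ)
    (γ : M → M) : Prop where
  mem_iff : ∀ p, γ p ∈ Z ↔ p ∈ Z
  pullback_eq : ∀ p ∉ Z, pullback γ (fun q => (1 - t * θ q) • η q) p = (1 - s * θ p) • η p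
  comm : ∀ g : M → M, MDifferentiable 𝓘(ℝ, Plane) 𝓘(ℝ, Plane) g →
    (∀ p, tangentMapAt Plane g p (X p) = X (g p)) → (∀ p, θ (g p) = θ p) → ∀ p, γ (g p) = g (γ p)

theorem pullback_comp {k : ℕ} {f g : M → M} (η : DForm Plane M k) {p : M}
    (hg : MDifferentiableAt 𝓘(ℝ, Plane) 𝓘(ℝ, Plane) g (f p))
    (hf : MDifferentiableAt 𝓘(ℝ, Plane) 𝓘(ℝ, Plane) f p) :
    pullback (fun x => g (f x)) η p = (pullback g η (f p)).compContinuousLinearMap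
      (tangentMapAt Plane f p) := by
  unfold pullback
  rw [tangentMapAt_comp hg hf]
  rfl

theorem IsMoserMap.trans {Z : Set M} {η : DForm Plane M 2} {X : M → Plane} {θ : M → ℝ}
    {r s t : ℝ} {γ₁ γ₂ : M → M} (h₁ : IsMoserMap Z η X θ r s γ₁) (h₂ : IsMoserMap Z η X θ s t γ₂)
    (hd₁ : MDifferentiable 𝓘(ℝ, Plane) 𝓘(ℝ, Plane) γ₁)
    (hd₂ : MDifferentiable 𝓘(ℝ, Plane) 𝓘(ℝ, Plane) γ₂) :
    IsMoserMap Z η X θ r t (fun p => γ₂ (γ₁ p)) where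
  mem_iff p := (h₂.mem_iff _).trans (h₁.mem_iff p)
  pullback_eq p hp := by
    rw [pullback_comp _ (hd₂ _) (hd₁ _), h₂.pullback_eq _ (fun h => hp ((h₁.mem_iff p).1 h)),
      ← h₁.pullback_eq p hp]
    rfl
  comm g hg hX hθ p := by rw [h₁.comm g hg hX hθ, h₂.comm g hg hX hθ]

theorem IsMoserMap.symm {Z : Set M} {η : DForm Plane M 2} {X : M → Plane} {θ : M → ℝ}
    {s t : ℝ} {γ : Diffeomorph 𝓘(ℝ, Plane) 𝓘(ℝ, Plane) M M ∞} (h : IsMoserMap Z η X θ s t γ) :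
    IsMoserMap Z η X θ t s γ.symm where
  mem_iff p := by rw [← h.mem_iff, γ.apply_symm_apply]
  pullback_eq p hp := by
    have hp' : γ.symm p ∉ Z := fun h' => hp (by simpa using (h.mem_iff _).2 h')
    have h1 := h.pullback_eq _ hp'
    have h2 := pullback_comp (f := γ.symm) (g := γ) (fun q => (1 - t * θ q) • η q) (p := p)
      ((γ.contMDiff _).mdifferentiableAt (by simp))
      ((γ.symm.contMDiff _).mdifferentiableAt (by simp))
    rw [h1] at h2
    simp only [Diffeomorph.apply_symm_apply] at h2
    rw [pullback_id] at h2
    exact h2.symm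
  comm g hg hX hθ p := by
    apply γ.injective
    change γ (γ.symm (g p)) = γ (g (γ.symm p))
    rw [γ.apply_symm_apply, h.comm g hg hX hθ, γ.apply_symm_apply]

variable [T2Space M] [CompactSpace M]

/-- Along trajectories off `Z`, the flow from `s` to `t` pulls `(1 - t θ) η` back to
`(1 - s θ) η`. -/
theorem pullback_flowBox {Z : Set M} (hZ : IsClosed Z) {η : DForm Plane M 2}
    (hη : SmoothFormOn η Zᶜ) {X : M → Plane} (hX : SmoothField X) {θ : M → ℝ}
    (hθ : SmoothScalar θ) (hdiv : HasDivergence Z η X θ) {a b s : ℝ} (hs : s ∈ Ioo a b)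
    (hpos : ∀ t ∈ Ioo a b, ∀ p, 0 < 1 - t * θ p) {Φ : ℝ → M → M} {c p : M}
    {φ : ℝ → Plane → Plane}
    (hbox : ∀ᶠ q in 𝓝 p, IsFlowBox (moserField X θ) (Ioo a b) s Φ c φ q)
    (hoff : ∀ t ∈ Ioo a b, Φ t p ∉ Z) {t : ℝ} (ht : t ∈ Ioo a b) :
    pullback (Φ t) (fun q => (1 - t * θ q) • η q) p = (1 - s * θ p) • η p := by
  set e := extChartAt 𝓘(ℝ, Plane) c with he
  have hp := hbox.self_of_nhds
  have hsrc : p ∈ e.source := hp.mem_source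
  set u₀ := e p with hu₀
  have hu₀t : u₀ ∈ e.target := e.map_source hsrc
  have hsymm : e.symm u₀ = p := e.left_inv hsrc
  have hbox' : ∀ᶠ u in 𝓝 u₀, u ∈ e.target ∧
      IsFlowBox (moserField X θ) (Ioo a b) s Φ c φ (e.symm u) :=
    eventually_symm_mem hu₀t (by rw [← he, hsymm]; exact hbox)
  have hsy : ∀ r ∈ Ioo a b, e.symm (φ r u₀) = Φ r p := fun r hr => (hp.eq r hr).symm
  set F : ℝ → ℝ := fun r => (1 - r * θ (e.symm (φ r u₀))) *
      coeffInChart η c (φ r u₀) * planeDet (fderiv ℝ (φ r) u₀) with hF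
  have hder : ∀ r ∈ Ioo a b, HasDerivAt F 0 r := by
    intro r hr
    refine hasDerivAt_moser_density hZ hη hX hθ hdiv (hpos r hr _) (hp.mem_target r hr) ?_
      (hp.smooth r hr) ?_
    · rw [← he, hsy r hr]; exact hoff r hr
    · filter_upwards [hbox'] with u hu
      have := hu.2.hasDeriv r hr
      rwa [← he, e.right_inv hu.1] at this
  have hconst : F t = F s := by
    refine (convex_Ioo a b).is_const_of_fderivWithin_eq_zero (𝕜 := ℝ)
      (fun r hr => (hder r hr).differentiableAt.differentiableWithinAt) (fun r hr => ?_) ht hs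
    rw [fderivWithin_of_isOpen isOpen_Ioo hr, (hder r hr).hasFDerivAt.fderiv]
    ext; simp
  have hφs : φ s =ᶠ[𝓝 u₀] fun u => u := by
    filter_upwards [hbox'] with u hu
    have := hu.2.initial
    rwa [← he, e.right_inv hu.1] at this
  have hFs : F s = (1 - s * θ p) * coeffInChart η c u₀ := by
    have h1 : fderiv ℝ (φ s) u₀ = ContinuousLinearMap.id ℝ Plane := by
      rw [hφs.fderiv_eq]; exact fderiv_fun_id
    simp only [hF, h1, planeDet_id, hφs.self_of_nhds, hsymm, mul_one]
  -- the motion near `p`, read in the chart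
  have hΦ : Φ t =ᶠ[𝓝 p] fun q => e.symm (φ t (e q)) := by
    filter_upwards [hbox] with q hq using hq.eq t ht
  have hφd : DifferentiableAt ℝ (φ t) u₀ := by
    have h1 : DifferentiableAt ℝ (fun z : ℝ × Plane => φ z.1 z.2) (t, u₀) :=
      (hp.smooth t ht).differentiableAt (by simp)
    exact (h1.hasFDerivAt.comp u₀ (hasFDerivAt_prodMk_right t u₀)).differentiableAt
  have hT : tangentMapAt Plane (Φ t) p = (tangentMapAt Plane e.symm (φ t u₀)).comp
      ((fderiv ℝ (φ t) u₀).comp (tangentMapAt Plane e p)) := by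
    rw [tangentMapAt_congr hΦ, ← tangentMapAt_eq_fderiv]
    have h1 : MDifferentiableAt 𝓘(ℝ, Plane) 𝓘(ℝ, Plane) (φ t) (e p) := hφd.mdifferentiableAt
    have h2 : MDifferentiableAt 𝓘(ℝ, Plane) 𝓘(ℝ, Plane) (fun q => φ t (e q)) p :=
      h1.comp p (mdifferentiableAt_chart hsrc)
    rw [← tangentMapAt_comp h1 (mdifferentiableAt_chart hsrc)]
    exact tangentMapAt_comp (f := fun q => φ t (e q))
      (mdifferentiableAt_chart_symm (hp.mem_target t ht)) h2
  have hform : (inChart (fun q => (1 - t * θ q) • η q) c (φ t u₀)).compContinuousLinearMap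
      (fderiv ℝ (φ t) u₀) = (1 - s * θ p) • inChart η c u₀ := by
    apply twoForm_ext
    rw [planeCoeff_comp, planeCoeff_smul]
    have h1 : inChart (fun q => (1 - t * θ q) • η q) c (φ t u₀) =
        (1 - t * θ (e.symm (φ t u₀))) • inChart η c (φ t u₀) := rfl
    rw [h1, planeCoeff_smul]
    have h2 := hconst.trans hFs
    simp only [hF, coeffInChart] at h2
    rw [← h2]; ring
  have h3 : pullback (Φ t) (fun q => (1 - t * θ q) • η q) p =
      ((inChart (fun q => (1 - t * θ q) • η q) c (φ t u₀)).compContinuousLinearMap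
        (fderiv ℝ (φ t) u₀)).compContinuousLinearMap (tangentMapAt Plane e p) := by
    unfold inChart
    unfold pullback
    rw [hT, hΦ.self_of_nhds]
    rfl
  rw [h3, hform]
  have h4 := inChart_apply_chart η hsrc
  rw [← h4]
  rfl

/-- As long as the density `1 - t₀ θ` is positive, the flow connects `t₀` with all nearby times. -/
theorem exists_isMoserMap_near {Z : Set M} (hZ : IsClosed Z) {η : DForm Plane M 2}
    (hη : SmoothFormOn η Zᶜ) {X : M → Plane} (hX : SmoothField X) {θ : M → ℝ}
    (hθ : SmoothScalar θ) (hdiv : HasDivergence Z η X θ) (htan : IsTangentTo Z X) {t₀ : ℝ}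
    (ht₀ : ∀ p, 0 < 1 - t₀ * θ p) :
    ∀ᶠ t in 𝓝 t₀, ∃ γ : Diffeomorph 𝓘(ℝ, Plane) 𝓘(ℝ, Plane) M M ∞,
      IsMoserMap Z η X θ t₀ t γ := by
  set J : Set ℝ := {t | ∀ p, 0 < 1 - t * θ p} with hJ
  have hθc := hθ.continuous
  have hJo : IsOpen J := by
    rw [isOpen_iff_mem_nhds]
    intro t ht
    have h2 := isCompact_univ.eventually_forall_of_forall_eventually (x₀ := t)
      (P := fun t p => 0 < 1 - t * θ p) (fun p _ => by
        have h1 : Continuous fun z : ℝ × M => 1 - z.1 * θ z.2 := by fun_prop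
        exact h1.continuousAt.eventually (lt_mem_nhds (ht p)))
    filter_upwards [h2] with t' h' p using h' p trivial
  have hXt := smoothTimeField_moserField hX hθ (J := J) fun t ht => ht
  obtain ⟨ε, hε, hIJ, Φ, hΦ⟩ := exists_short_flow hJo hXt (t₀ := t₀) ht₀
  set I := Ioo (t₀ - ε) (t₀ + ε) with hI
  have ht₀I : t₀ ∈ I := ⟨by linarith, by linarith⟩
  have hinv : ∀ s ∈ I, ∀ t ∈ I, ∀ p, Φ t s (Φ s t p) = p := by
    intro s hs t ht p
    have := trajectory_eqOn hJo hXt hIJ (hΦ t ht (Φ s t p)).2.1 (hΦ s hs p).2.1 ht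
      (hΦ t ht (Φ s t p)).1
    exact (this hs).trans (hΦ s hs p).1
  have hsmooth : ∀ s ∈ I, ∀ t ∈ I, ContMDiff 𝓘(ℝ, Plane) 𝓘(ℝ, Plane) ∞ (Φ s t) := by
    intro s hs t ht p
    obtain ⟨c, φ, hbox⟩ := (hΦ s hs p).2.2
    have hp := hbox.self_of_nhds
    have h1 : ContDiffAt ℝ ∞ (φ t) (extChartAt 𝓘(ℝ, Plane) c p) :=
      ContDiffAt.comp (f := fun u : Plane => (t, u)) _ (hp.smooth t ht)
        (contDiffAt_const.prodMk contDiffAt_id)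
    have h2 := (contMDiffAt_chart_symm (hp.mem_target t ht)).comp p
      (h1.contMDiffAt.comp p (contMDiffAt_chart hp.mem_source))
    refine h2.congr_of_eventuallyEq ?_
    filter_upwards [hbox] with q hq using hq.eq t ht
  filter_upwards [isOpen_Ioo.mem_nhds ht₀I] with t ht
  refine ⟨⟨⟨Φ t₀ t, Φ t t₀, hinv t₀ ht₀I t ht, hinv t ht t₀ ht₀I⟩, hsmooth _ ht₀I _ ht,
    hsmooth _ ht _ ht₀I⟩, ?_⟩
  have hmem : ∀ p, ∀ r ∈ I, ∀ r' ∈ I, Φ t₀ r p ∈ Z → Φ t₀ r' p ∈ Z := by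
    intro p r hr r' hr'
    refine trajectory_mem hZ htan (κ := fun t p => (1 - t * θ p)⁻¹) (γ := fun r => Φ t₀ r p)
      ?_ (hΦ t₀ ht₀I p).2.1 hr hr'
    intro q hq
    have h1 := ((hΦ t₀ ht₀I p).2.1 q hq).continuousAt
    have h2 : ContinuousAt (fun r => 1 - r * θ (Φ t₀ r p)) q :=
      continuousAt_const.sub (continuousAt_id.mul (hθc.continuousAt.comp h1))
    exact h2.inv₀ (hIJ hq _).ne'
  have hiff : ∀ p, ∀ r ∈ I, (Φ t₀ r p ∈ Z ↔ p ∈ Z) := by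
    intro p r hr
    have h0 := (hΦ t₀ ht₀I p).1
    exact ⟨fun h => by simpa [h0] using hmem p r hr t₀ ht₀I h,
      fun h => hmem p t₀ ht₀I r hr (by rwa [h0])⟩
  exact
    { mem_iff := fun p => hiff p t ht
      pullback_eq := fun p hp => by
        obtain ⟨c, φ, hbox⟩ := (hΦ t₀ ht₀I p).2.2
        exact pullback_flowBox hZ hη hX hθ hdiv ht₀I (fun t ht => hIJ ht) hbox
          (fun r hr h => hp ((hiff p r hr).1 h)) ht
      comm := fun g hg hgX hgθ p => by
        have h1 : ∀ r ∈ I, HasVelocityAt (moserField X θ) (fun r => g (Φ t₀ r p)) r := by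
          intro r hr
          refine ((hΦ t₀ ht₀I p).2.1 r hr).map (hg _) ?_
          simp only [moserField, map_smul, hgX, hgθ]
        exact trajectory_eqOn hJo hXt hIJ (hΦ t₀ ht₀I (g p)).2.1 h1 ht₀I
          (by rw [(hΦ t₀ ht₀I (g p)).1, (hΦ t₀ ht₀I p).1]) ht }

/-- **Moser's lemma** on a compact surface: if `div X = θ` with respect to the area form `η`
and all the densities `1 - t θ`, `0 ≤ t ≤ 1`, are positive, then a diffeomorphism pulls `(1 - θ) η`
back to `η`. It preserves `Z` and commutes with all the symmetries of `X` and `θ`. -/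
theorem exists_isMoserMap {Z : Set M} (hZ : IsClosed Z) {η : DForm Plane M 2}
    (hη : SmoothFormOn η Zᶜ) {X : M → Plane} (hX : SmoothField X) {θ : M → ℝ}
    (hθ : SmoothScalar θ) (hdiv : HasDivergence Z η X θ) (htan : IsTangentTo Z X)
    (hθ1 : ∀ p, θ p < 1) :
    ∃ γ : Diffeomorph 𝓘(ℝ, Plane) 𝓘(ℝ, Plane) M M ∞, IsMoserMap Z η X θ 0 1 γ := by
  have hpos : ∀ t ∈ Icc (0 : ℝ) 1, ∀ p, 0 < 1 - t * θ p := by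
    intro t ht p
    have := hθ1 p
    rcases ht.1.eq_or_lt with h0 | h0
    · rw [← h0]; norm_num
    · nlinarith [ht.2]
  -- the relation between `s` and `t` is an equivalence relation with open classes
  refine isPreconnected_Icc.induction₂ (s := Icc (0 : ℝ) 1)
    (fun s t => ∃ γ : Diffeomorph 𝓘(ℝ, Plane) 𝓘(ℝ, Plane) M M ∞, IsMoserMap Z η X θ s t γ)
    ?_ ?_ ?_ (left_mem_Icc.2 zero_le_one) (right_mem_Icc.2 zero_le_one)
  · intro t ht
    exact (exists_isMoserMap_near hZ hη hX hθ hdiv htan (hpos t ht)).filter_mono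
      nhdsWithin_le_nhds
  · rintro r s t - - - ⟨γ₁, h₁⟩ ⟨γ₂, h₂⟩
    exact ⟨γ₁.trans γ₂, h₁.trans h₂ (γ₁.mdifferentiable (by simp)) (γ₂.mdifferentiable (by simp))⟩
  · rintro s t - - ⟨γ, h⟩
    exact ⟨γ.symm, h.symm⟩

end MoserLemma

/-! ### Area-contracting maps -/

section Area

theorem planeDet_eq_det (A : Plane →L[ℝ] Plane) : planeDet A = A.det := by
  rw [ContinuousLinearMap.det, ← LinearMap.det_toMatrix (EuclideanSpace.basisFun (Fin 2) ℝ).toBasis,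
    Matrix.det_fin_two]
  simp [LinearMap.toMatrix_apply, planeDet, planeBasis]
  ring

variable {M : Type*} [TopologicalSpace M] [ChartedSpace Plane M] [IsManifold 𝓘(ℝ, Plane) ∞ M]

theorem coeffInChart_ne_zero {η : DForm Plane M 2} {c : M} {u : Plane}
    (hu : u ∈ (extChartAt 𝓘(ℝ, Plane) c).target)
    (h : η ((extChartAt 𝓘(ℝ, Plane) c).symm u) ≠ 0) : coeffInChart η c u ≠ 0 := by
  intro h0
  apply h
  have h1 := inChart_apply_chart η ((extChartAt 𝓘(ℝ, Plane) c).map_target hu)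
  rw [(extChartAt 𝓘(ℝ, Plane) c).right_inv hu] at h1
  have h2 : inChart η c u = 0 := twoForm_ext (by simpa [planeCoeff, coeffInChart] using h0)
  rw [← h1, h2]
  ext; simp

/-- If `f` multiplies the area form `η` by factors of size at most `a` on the set `B` of a
coordinate patch, then the part of the image of `B` in a second coordinate patch has Lebesgue
measure at most `a K / k` times that of `B`, where `K` and `k` bound the coefficients of `η` from
above and below. -/
theorem volume_image_chart_le {η : DForm Plane M 2} {f : M → M}
    (hf : ContMDiff 𝓘(ℝ, Plane) 𝓘(ℝ, Plane) ∞ f) {c c₀ : M} {B : Set Plane}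
    (hB : MeasurableSet B) (hBt : B ⊆ (extChartAt 𝓘(ℝ, Plane) c).target)
    {W : Set Plane} (hW : IsOpen W) (hWt : W ⊆ (extChartAt 𝓘(ℝ, Plane) c₀).target)
    {a K k : ℝ} (ha : 0 ≤ a) (hk : 0 < k) (hK : ∀ v ∈ B, |coeffInChart η c v| ≤ K)
    (hk' : ∀ u ∈ W, k ≤ |coeffInChart η c₀ u|)
    (hpull : ∀ v ∈ B, ∃ r : ℝ, |r| ≤ a ∧ pullback f η ((extChartAt 𝓘(ℝ, Plane) c).symm v) =
      r • η ((extChartAt 𝓘(ℝ, Plane) c).symm v)) :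
    MeasureTheory.volume {u ∈ W | ∃ v ∈ B,
      f ((extChartAt 𝓘(ℝ, Plane) c).symm v) = (extChartAt 𝓘(ℝ, Plane) c₀).symm u} ≤
      ENNReal.ofReal (a * (K / k)) * MeasureTheory.volume B := by
  set e := extChartAt 𝓘(ℝ, Plane) c with he
  set e₀ := extChartAt 𝓘(ℝ, Plane) c₀ with he₀
  set T := mapInCharts Plane f c c₀ with hT
  set O : Set M := e₀.source ∩ e₀ ⁻¹' W with hO
  have hOo : IsOpen O :=
    (continuousOn_extChartAt c₀).isOpen_inter_preimage (isOpen_extChartAt_source c₀) hW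
  set A : Set Plane := B ∩ (e.target ∩ (fun v => f (e.symm v)) ⁻¹' O) with hA
  have hAm : MeasurableSet A := by
    refine hB.inter (IsOpen.measurableSet ?_)
    exact (hf.continuous.comp_continuousOn (continuousOn_extChartAt_symm c)).isOpen_inter_preimage
      (isOpen_extChartAt_target c) hOo
  have hTd : ∀ v ∈ A, HasFDerivWithinAt T (fderiv ℝ T v) A v := fun v hv =>
    ((contDiffAt_mapInCharts hv.2.1 (hf _) hv.2.2.1).differentiableAt
      (by simp)).hasFDerivAt.hasFDerivWithinAt
  have hdet : ∀ v ∈ A, |(fderiv ℝ T v).det| ≤ a * (K / k) := by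
    intro v hv
    obtain ⟨r, hr, hpb⟩ := hpull v hv.1
    have h1 := inChart_pullback η hv.2.1 ((hf _).mdifferentiableAt (by simp)) hv.2.2.1
    have h2 : inChart (pullback f η) c v = r • inChart η c v := by
      unfold inChart
      conv_lhs => rw [pullback]
      rw [hpb]
      rfl
    rw [h2] at h1
    have h3 := congrArg planeCoeff h1
    rw [planeCoeff_smul, planeCoeff_comp, ← hT, planeDet_eq_det] at h3
    have h4 : T v ∈ W := hv.2.2.2
    have h5 : |r| * |coeffInChart η c v| = |(fderiv ℝ T v).det| * |coeffInChart η c₀ (T v)| := by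
      rw [← abs_mul, ← abs_mul]; exact congrArg abs h3
    have h6 := hk' _ h4
    have h7 := hK v hv.1
    rw [mul_div_assoc', le_div_iff₀ hk]
    calc |(fderiv ℝ T v).det| * k ≤ |(fderiv ℝ T v).det| * |coeffInChart η c₀ (T v)| := by gcongr
      _ = |r| * |coeffInChart η c v| := h5.symm
      _ ≤ a * K := mul_le_mul hr h7 (abs_nonneg _) ha
  calc _ ≤ MeasureTheory.volume (T '' A) := by
        apply MeasureTheory.measure_mono
        rintro u ⟨huW, v, hvB, hfv⟩
        refine ⟨v, ⟨hvB, hBt hvB, ?_⟩, ?_⟩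
        · change f (e.symm v) ∈ O
          rw [hfv]
          exact ⟨e₀.map_target (hWt huW), by simpa [e₀.right_inv (hWt huW)] using huW⟩
        · change e₀ (f (e.symm v)) = u
          rw [hfv, e₀.right_inv (hWt huW)]
    _ ≤ ∫⁻ v in A, ENNReal.ofReal |(fderiv ℝ T v).det| :=
        MeasureTheory.addHaar_image_le_lintegral_abs_det_fderiv _ hAm hTd
    _ ≤ ∫⁻ _ in A, ENNReal.ofReal (a * (K / k)) :=
        MeasureTheory.setLIntegral_mono measurable_const fun v hv =>
          ENNReal.ofReal_le_ofReal (hdet v hv)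
    _ = ENNReal.ofReal (a * (K / k)) * MeasureTheory.volume A := by
        rw [MeasureTheory.setLIntegral_const]
    _ ≤ _ := by gcongr; exact inter_subset_left

/-- A compact surface of positive area has no area-contracting self-map onto itself: no map `γ`
of a clopen set `N` onto itself can satisfy `γ^*(l η) = η` with `l ≥ 2`. -/
theorem false_of_area_contraction [CompactSpace M] {N : Set M} (hN : IsClopen N)
    (hne : N.Nonempty) {η : DForm Plane M 2} (hη : SmoothFormOn η N) (hη0 : ∀ p ∈ N, η p ≠ 0)
    (γ : Diffeomorph 𝓘(ℝ, Plane) 𝓘(ℝ, Plane) M M ∞) (hγN : ∀ p, γ p ∈ N ↔ p ∈ N) {l : M → ℝ}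
    (hl : ∀ p ∈ N, 2 ≤ l p)
    (hγ : ∀ p ∈ N, pullback γ (fun q => l q • η q) p = η p) : False := by
  -- the iterates of `γ` map `N` onto itself and shrink areas by `2 ^ (-n)`
  have hiter : ∀ n : ℕ, ∃ f : M → M, ContMDiff 𝓘(ℝ, Plane) 𝓘(ℝ, Plane) ∞ f ∧
      (∀ p ∈ N, f p ∈ N) ∧ (∀ q ∈ N, ∃ p ∈ N, f p = q) ∧
      ∀ p ∈ N, ∃ r : ℝ, |r| ≤ (1 / 2) ^ n ∧ pullback f η p = r • η p := by
    intro n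
    induction n with
    | zero =>
      exact ⟨fun p => p, contMDiff_id, fun p hp => hp, fun q hq => ⟨q, hq, rfl⟩,
        fun p _ => ⟨1, by simp, by rw [pullback_id, one_smul]⟩⟩
    | succ n ih =>
      obtain ⟨f, hf, h1, h2, h3⟩ := ih
      refine ⟨fun p => γ (f p), γ.contMDiff.comp hf, fun p hp => (hγN _).2 (h1 p hp), ?_, ?_⟩
      · intro q hq
        have hq' : γ.symm q ∈ N := by rw [← hγN]; simpa using hq
        obtain ⟨p, hp, hfp⟩ := h2 _ hq'
        exact ⟨p, hp, by change γ (f p) = q; rw [hfp]; simp⟩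
      · intro p hp
        obtain ⟨r, hr, hrp⟩ := h3 p hp
        have hlp := hl _ ((hγN _).2 (h1 p hp))
        have hl0 : l (γ (f p)) ≠ 0 := by positivity
        have h4 : pullback γ η (f p) = (l (γ (f p)))⁻¹ • η (f p) := by
          rw [← hγ _ (h1 p hp)]
          unfold pullback
          ext v
          simp [hl0]
        refine ⟨(l (γ (f p)))⁻¹ * r, ?_, ?_⟩
        · rw [abs_mul, abs_inv, pow_succ', abs_of_pos (by linarith : (0:ℝ) < l (γ (f p)))]
          refine mul_le_mul ?_ hr (abs_nonneg _) (by norm_num)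
          rw [inv_le_comm₀ (by linarith) (by norm_num)]
          norm_num; exact hlp
        · rw [pullback_comp η ((γ.contMDiff _).mdifferentiableAt (by simp))
            ((hf _).mdifferentiableAt (by simp)), h4, mul_smul, ← hrp]
          rfl
  -- closed coordinate discs inside `N`
  have hdisc : ∀ p : N, ∃ ρ > 0, Metric.closedBall (extChartAt 𝓘(ℝ, Plane) (p : M) p) ρ ⊆
      (extChartAt 𝓘(ℝ, Plane) (p : M)).target ∩ (extChartAt 𝓘(ℝ, Plane) (p : M)).symm ⁻¹' N := by
    intro p
    have h1 := eventually_symm_mem (mem_extChartAt_target (I := 𝓘(ℝ, Plane)) (p : M)) (A := N)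
      (by rw [extChartAt_to_inv]; exact hN.isOpen.mem_nhds p.2)
    exact Metric.nhds_basis_closedBall.mem_iff.1 h1
  choose ρ hρ hρs using hdisc
  have hcont : ∀ p : N, ContinuousOn (fun u => |coeffInChart η (p : M) u|)
      (Metric.closedBall (extChartAt 𝓘(ℝ, Plane) (p : M) p) (ρ p)) := fun p =>
    (((contDiffOn_coeffInChart (Z := Nᶜ) (by rwa [compl_compl]) (p : M)).continuousOn).mono
      (by rw [compl_compl]; exact hρs p)).abs
  have hupper : ∀ p : N, ∃ K, ∀ u ∈ Metric.closedBall (extChartAt 𝓘(ℝ, Plane) (p : M) p) (ρ p),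
      |coeffInChart η (p : M) u| ≤ K := fun p => by
    obtain ⟨K, hK⟩ := (isCompact_closedBall _ _).bddAbove_image (hcont p)
    exact ⟨K, fun u hu => hK (mem_image_of_mem _ hu)⟩
  choose K hK using hupper
  set U : N → Set M := fun p => (extChartAt 𝓘(ℝ, Plane) (p : M)).source ∩
    extChartAt 𝓘(ℝ, Plane) (p : M) ⁻¹' Metric.ball (extChartAt 𝓘(ℝ, Plane) (p : M) p) (ρ p) with hU
  have hUo : ∀ p, IsOpen (U p) := fun p => (continuousOn_extChartAt (p : M)).isOpen_inter_preimage
    (isOpen_extChartAt_source (p : M)) Metric.isOpen_ball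
  obtain ⟨F, hF⟩ := hN.isClosed.isCompact.elim_finite_subcover U hUo fun p hp =>
    mem_iUnion.2 ⟨⟨p, hp⟩, mem_extChartAt_source p, Metric.mem_ball_self (hρ _)⟩
  obtain ⟨p₀, hp₀⟩ := hne
  set q₀ : N := ⟨p₀, hp₀⟩
  set e₀ := extChartAt 𝓘(ℝ, Plane) p₀ with he₀
  set W := Metric.ball (e₀ p₀) (ρ q₀) with hWdef
  obtain ⟨k, hk, hkW⟩ : ∃ k > 0, ∀ u ∈ Metric.closedBall (e₀ p₀) (ρ q₀),
      k ≤ |coeffInChart η p₀ u| := by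
    obtain ⟨u, hu, hmin⟩ := (isCompact_closedBall (e₀ p₀) (ρ q₀)).exists_isMinOn
      ⟨_, Metric.mem_closedBall_self (hρ q₀).le⟩ (hcont q₀)
    exact ⟨_, abs_pos.2 (coeffInChart_ne_zero (hρs q₀ hu).1 (hη0 _ (hρs q₀ hu).2)),
      fun v hv => hmin hv⟩
  have hWvol : 0 < MeasureTheory.volume W := Metric.measure_ball_pos _ _ (hρ q₀)
  set V : N → ENNReal := fun j =>
    MeasureTheory.volume (Metric.closedBall (extChartAt 𝓘(ℝ, Plane) (j : M) j) (ρ j)) with hV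
  -- the images of the finitely many discs cover `N`, hence the fixed disc `W`
  have hbound : ∀ n : ℕ, MeasureTheory.volume W ≤
      ∑ j ∈ F, ENNReal.ofReal ((1 / 2) ^ n * (K j / k)) * V j := by
    intro n
    obtain ⟨f, hf, h1, h2, h3⟩ := hiter n
    have hcover : W ⊆ ⋃ j ∈ F, {u ∈ W | ∃ v ∈ Metric.closedBall
        (extChartAt 𝓘(ℝ, Plane) (j : M) j) (ρ j),
        f ((extChartAt 𝓘(ℝ, Plane) (j : M)).symm v) = e₀.symm u} := by
      intro u hu
      obtain ⟨p, hp, hfp⟩ := h2 _ (hρs q₀ (Metric.ball_subset_closedBall hu)).2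
      obtain ⟨j, hj, hpj⟩ := mem_iUnion₂.1 (hF hp)
      refine mem_iUnion₂.2 ⟨j, hj, hu, _, Metric.ball_subset_closedBall hpj.2, ?_⟩
      rw [(extChartAt 𝓘(ℝ, Plane) (j : M)).left_inv hpj.1, hfp]
    refine (MeasureTheory.measure_mono hcover).trans
      ((MeasureTheory.measure_biUnion_finset_le F _).trans (Finset.sum_le_sum fun j _ => ?_))
    refine volume_image_chart_le (η := η) hf Metric.isClosed_closedBall.measurableSet
      (fun v hv => (hρs j hv).1) Metric.isOpen_ball
      (fun u hu => (hρs q₀ (Metric.ball_subset_closedBall hu)).1) (by positivity) hk (hK j)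
      (fun u hu => hkW u (Metric.ball_subset_closedBall hu)) fun v hv => h3 _ (hρs j hv).2
  have hlim : Tendsto (fun n : ℕ => ∑ j ∈ F, ENNReal.ofReal ((1 / 2) ^ n * (K j / k)) * V j)
      atTop (𝓝 0) := by
    have h0 : (0 : ENNReal) = ∑ _j ∈ F, 0 := by simp
    rw [h0]
    refine tendsto_finsetSum F fun j _ => ?_
    have hVj : V j ≠ ⊤ := (isCompact_closedBall _ _).measure_lt_top.ne
    have h1 : Tendsto (fun n : ℕ => ((1 : ℝ) / 2) ^ n * (K j / k)) atTop (𝓝 (0 * (K j / k))) :=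
      (tendsto_pow_atTop_nhds_zero_of_lt_one (by norm_num) (by norm_num)).mul_const _
    have h2 := ENNReal.Tendsto.mul_const (ENNReal.tendsto_ofReal h1) (Or.inr hVj)
    simpa using h2
  exact hWvol.not_ge (ge_of_tendsto' hlim hbound)

end Area

/-! ### Naturality of the exterior derivative -/

section Naturality

variable {E : Type*} [NormedAddCommGroup E] [NormedSpace ℝ E]
  {M : Type*} [TopologicalSpace M] [ChartedSpace E M] [IsManifold 𝓘(ℝ, E) ∞ M]
  {N : Type*} [TopologicalSpace N] [ChartedSpace E N] [IsManifold 𝓘(ℝ, E) ∞ N]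

theorem SmoothFormOn.contDiffAt {k : ℕ} {η : DForm E M k} {U : Set M} (h : SmoothFormOn η U)
    {c : M} {u : E} (hu : u ∈ (extChartAt 𝓘(ℝ, E) c).target)
    (hU : U ∈ 𝓝 ((extChartAt 𝓘(ℝ, E) c).symm u)) : ContDiffAt ℝ ∞ (inChart η c) u :=
  (h c).contDiffAt (eventually_symm_mem hu hU)

theorem SmoothFormOn.mono {k : ℕ} {η : DForm E M k} {U V : Set M} (h : SmoothFormOn η U)
    (hVU : V ⊆ U) : SmoothFormOn η V :=
  fun c => (h c).mono fun _ hu => ⟨hu.1, hVU hu.2⟩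

/-- The form `η` is differentiable at `p`: its chart expressions are. -/
def FormDifferentiableAt {k : ℕ} (η : DForm E M k) (p : M) : Prop :=
  ∀ c : M, p ∈ (extChartAt 𝓘(ℝ, E) c).source →
    DifferentiableAt ℝ (inChart η c) (extChartAt 𝓘(ℝ, E) c p)

theorem SmoothFormOn.formDifferentiableAt {k : ℕ} {η : DForm E M k} {U : Set M}
    (h : SmoothFormOn η U) {p : M} (hU : U ∈ 𝓝 p) : FormDifferentiableAt η p := fun c hc =>
  (h.contDiffAt ((extChartAt 𝓘(ℝ, E) c).map_source hc)
    (by rwa [(extChartAt 𝓘(ℝ, E) c).left_inv hc])).differentiableAt (by simp)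

theorem inChart_pullback_eventuallyEq {k : ℕ} {f : M → N} (η : DForm E N k) {c : M} {c' : N} {u : E}
    (hu : u ∈ (extChartAt 𝓘(ℝ, E) c).target)
    (hf : ∀ᶠ q in 𝓝 ((extChartAt 𝓘(ℝ, E) c).symm u), ContMDiffAt 𝓘(ℝ, E) 𝓘(ℝ, E) ∞ f q)
    (hc' : f ((extChartAt 𝓘(ℝ, E) c).symm u) ∈ (extChartAt 𝓘(ℝ, E) c').source) :
    inChart (pullback f η) c =ᶠ[𝓝 u] fun v =>
      (inChart η c' (mapInCharts E f c c' v)).compContinuousLinearMap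
        (fderiv ℝ (mapInCharts E f c c') v) := by
  have h1 := hf.self_of_nhds.continuousAt ((isOpen_extChartAt_source c').mem_nhds hc')
  filter_upwards [eventually_symm_mem hu (hf.and h1)] with v hv
  exact inChart_pullback η hv.1 (hv.2.1.mdifferentiableAt (by simp)) hv.2.2

theorem FormDifferentiableAt.pullback {k : ℕ} {f : M → N} {η : DForm E N k} {p : M}
    (hf : ∀ᶠ q in 𝓝 p, ContMDiffAt 𝓘(ℝ, E) 𝓘(ℝ, E) ∞ f q) (hη : FormDifferentiableAt η (f p)) :
    FormDifferentiableAt (pullback f η) p := by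
  intro c hc
  have hu := (extChartAt 𝓘(ℝ, E) c).map_source hc
  have hp := (extChartAt 𝓘(ℝ, E) c).left_inv hc
  have hsrc := mem_extChartAt_source (I := 𝓘(ℝ, E)) (f p)
  have hsrc' : f ((extChartAt 𝓘(ℝ, E) c).symm (extChartAt 𝓘(ℝ, E) c p)) ∈
    (extChartAt 𝓘(ℝ, E) (f p)).source := by rwa [hp]
  refine DifferentiableAt.congr_of_eventuallyEq ?_
    (inChart_pullback_eventuallyEq η hu (by rwa [hp]) hsrc')
  have hF := contDiffAt_mapInCharts hu (by rw [hp]; exact hf.self_of_nhds) hsrc'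
  have h1 : DifferentiableAt ℝ (inChart η (f p))
      (mapInCharts E f c (f p) (extChartAt 𝓘(ℝ, E) c p)) := by
    rw [mapInCharts, hp]; exact hη _ hsrc
  have h2 : ContDiffAt ℝ ∞ (fderiv ℝ (mapInCharts E f c (f p))) (extChartAt 𝓘(ℝ, E) c p) :=
    hF.fderiv_right (by simp)
  exact (h1.comp _ (hF.differentiableAt (by simp))).continuousAlternatingMapCompContinuousLinearMap
    (h2.differentiableAt (by simp))

/-- The exterior derivative commutes with pullbacks. -/
theorem extDer_pullback {k : ℕ} {f : M → N} {η : DForm E N k} {p : M}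
    (hf : ∀ᶠ q in 𝓝 p, ContMDiffAt 𝓘(ℝ, E) 𝓘(ℝ, E) ∞ f q) (hη : FormDifferentiableAt η (f p)) :
    extDer (pullback f η) p = pullback f (extDer η) p := by
  set c := extChartAt 𝓘(ℝ, E) p with hc
  set c' := extChartAt 𝓘(ℝ, E) (f p) with hc'
  set F := mapInCharts E f p (f p) with hF
  have hp : c p ∈ c.target := mem_extChartAt_target p
  have hinv : c.symm (c p) = p := extChartAt_to_inv p
  have hFp : F (c p) = c' (f p) := by rw [hF, mapInCharts, hinv]
  have hsrc : f (c.symm (c p)) ∈ c'.source := by rw [hinv]; exact mem_extChartAt_source _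
  have hfp := hf.self_of_nhds
  have hcont : ContDiffAt ℝ ∞ F (c p) := contDiffAt_mapInCharts hp (by rwa [hinv]) hsrc
  have hev : inChart (pullback f η) p =ᶠ[𝓝 (c p)] fun u =>
      (inChart η (f p) (F u)).compContinuousLinearMap (fderiv ℝ F u) :=
    inChart_pullback_eventuallyEq η hp (by rwa [hinv]) hsrc
  have hd : DifferentiableAt ℝ (inChart η (f p)) (F (c p)) := by
    rw [hFp]
    exact hη _ (mem_extChartAt_source _)
  have hder : fderiv ℝ F (c p) = tangentMapAt E f p := by
    rw [hF, fderiv_mapInCharts hp (by rw [hinv]; exact hfp.mdifferentiableAt (by simp)) hsrc, hinv,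
      tangentMapAt_chart_self]
    have := tangentMapAt_chart_symm_comp (mem_extChartAt_source (I := 𝓘(ℝ, E)) p)
    rw [tangentMapAt_chart_self, ContinuousLinearMap.comp_id] at this
    rw [this]; rfl
  have hmain : extDeriv (inChart (pullback f η) p) (c p) =
      (extDeriv (inChart η (f p)) (F (c p))).compContinuousLinearMap (fderiv ℝ F (c p)) := by
    rw [hev.extDeriv_eq]
    exact extDeriv_pullback hd hcont (by
      rw [minSmoothness_of_isRCLikeNormedField]; exact ENat.LEInfty.out)
  change (extDeriv (inChart (pullback f η) p) (c p)).compContinuousLinearMap (tangentMapAt E c p) =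
    ((extDeriv (inChart η (f p)) (c' (f p))).compContinuousLinearMap
      (tangentMapAt E c' (f p))).compContinuousLinearMap (tangentMapAt E f p)
  rw [hmain, hFp, hder, tangentMapAt_chart_self, tangentMapAt_chart_self]
  rfl

theorem inChart_model {k : ℕ} (η : DForm E E k) (c : E) : inChart η c = η :=
  pullback_id η

/-- The exterior derivative can be computed in every chart. -/
theorem inChart_extDer {k : ℕ} {η : DForm E M k} {c : M} {u : E}
    (hu : u ∈ (extChartAt 𝓘(ℝ, E) c).target)
    (hη : FormDifferentiableAt η ((extChartAt 𝓘(ℝ, E) c).symm u)) :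
    inChart (extDer η) c u = extDeriv (inChart η c) u := by
  have h := extDer_pullback (f := (extChartAt 𝓘(ℝ, E) c).symm) (p := u) (by
    filter_upwards [(isOpen_extChartAt_target c).mem_nhds hu] with v hv
    exact contMDiffAt_chart_symm hv) hη
  change extDer (inChart η c) u = inChart (extDer η) c u at h
  rw [← h]
  unfold extDer
  rw [inChart_model, tangentMapAt_chart_self]
  rfl

end Naturality

/-! ### Local defining functions -/

section DefiningFunctions

variable {E : Type*} [NormedAddCommGroup E] [NormedSpace ℝ E]

/-- Division by a defining function: if `ψ` vanishes on the regular level set `{ξ = 0}`, then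
`ψ = O(ξ)`. From `u` the level set is reached by moving a distance `O(|ξ u|)` along a direction
transverse to it. -/
theorem exists_abs_le_of_zero_imp {ξ ψ : E → ℝ} {u₀ : E} (hξ : ContDiffAt ℝ ∞ ξ u₀)
    (hψ : ContDiffAt ℝ ∞ ψ u₀) (h0 : ξ u₀ = 0) (hd : fderiv ℝ ξ u₀ ≠ 0)
    (hz : ∀ᶠ u in 𝓝 u₀, ξ u = 0 → ψ u = 0) : ∃ C, ∀ᶠ u in 𝓝 u₀, |ψ u| ≤ C * |ξ u| := by
  obtain ⟨n, hn⟩ : ∃ n, fderiv ℝ ξ u₀ n = 1 := by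
    obtain ⟨v, hv⟩ : ∃ v, fderiv ℝ ξ u₀ v ≠ 0 := by
      by_contra! h
      exact hd (ContinuousLinearMap.ext h)
    exact ⟨(fderiv ℝ ξ u₀ v)⁻¹ • v, by simp [hv]⟩
  obtain ⟨K, s, hs, hK⟩ := (hψ.hasStrictFDerivAt (by simp)).exists_lipschitzOnWith
  have hc : 0 < (2 * (‖n‖ + 1))⁻¹ := by positivity
  have h1 := (hξ.hasStrictFDerivAt (by simp)).isLittleO.def hc
  rw [nhds_prod_eq, eventually_prod_self_iff'] at h1
  obtain ⟨t, ht, h1⟩ := h1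
  have hcont : ∀ᶠ u in 𝓝 u₀, ContinuousAt ξ u :=
    ((hξ.of_le (m := 1) (by simp)).eventually (by simp)).mono fun u hu => hu.continuousAt
  obtain ⟨δ, hδ, hball⟩ := Metric.eventually_nhds_iff_ball.1 ((hcont.and hz).and
    ((eventually_mem_set.2 hs).and (eventually_mem_set.2 ht)))
  refine ⟨K * (2 * ‖n‖), ?_⟩
  have hsmall : ∀ᶠ u in 𝓝 u₀, 2 * |ξ u| * ‖n‖ < δ / 2 := by
    have : ContinuousAt (fun u => 2 * |ξ u| * ‖n‖) u₀ := by
      have := hξ.continuousAt; fun_prop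
    exact this.eventually_lt continuousAt_const (by simp [h0, hδ])
  filter_upwards [hsmall, Metric.ball_mem_nhds u₀ (half_pos hδ)] with u hu hub
  set a := 2 * |ξ u| with ha
  have ha0 : 0 ≤ a := by positivity
  have hmem : ∀ s ∈ Icc (-a) a, u + s • n ∈ Metric.ball u₀ δ := by
    intro s hs
    have h2 : ‖s • n‖ ≤ a * ‖n‖ := by
      rw [norm_smul]; exact mul_le_mul_of_nonneg_right (abs_le.2 hs) (norm_nonneg _)
    rw [mem_ball_iff_norm] at hub ⊢
    calc ‖u + s • n - u₀‖ = ‖(u - u₀) + s • n‖ := by congr 1; abel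
      _ ≤ ‖u - u₀‖ + ‖s • n‖ := norm_add_le _ _
      _ < δ := by linarith
  have humem : u ∈ Metric.ball u₀ δ := by
    simpa using hmem 0 ⟨by linarith, ha0⟩
  -- along the direction `n`, on which `dξ = 1`, the function `ξ` has slope at least `1 / 2`
  have hslope : ∀ s ∈ Icc (-a) a, |ξ (u + s • n) - ξ u - s| ≤ |s| / 2 := by
    intro s hs
    have h3 := h1 _ (hball _ (hmem s hs)).2.2 _ (hball _ humem).2.2
    simp only [add_sub_cancel_left, map_smul, hn, smul_eq_mul, mul_one, Real.norm_eq_abs,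
      norm_smul] at h3
    refine h3.trans ?_
    have h4 : (2 * (‖n‖ + 1))⁻¹ * ‖n‖ ≤ 1 / 2 := by
      rw [inv_mul_le_iff₀ (by positivity)]; linarith
    calc _ = |s| * ((2 * (‖n‖ + 1))⁻¹ * ‖n‖) := by ring
      _ ≤ |s| * (1 / 2) := mul_le_mul_of_nonneg_left h4 (abs_nonneg _)
      _ = _ := by ring
  obtain ⟨s, hs, hs0⟩ : ∃ s ∈ Icc (-a) a, ξ (u + s • n) = 0 := by
    have hco : ContinuousOn (fun s : ℝ => ξ (u + s • n)) (Icc (-a) a) := fun s hs =>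
      ((hball _ (hmem s hs)).1.1.comp (f := fun s : ℝ => u + s • n)
        (by fun_prop)).continuousWithinAt
    have h5 := hslope a ⟨by linarith, le_rfl⟩
    have h6 := hslope (-a) ⟨le_rfl, by linarith⟩
    rw [abs_neg] at h6
    rw [abs_of_nonneg ha0, abs_le] at h5 h6
    refine intermediate_value_Icc (by linarith) hco ⟨?_, ?_⟩
    · linarith [le_abs_self (ξ u)]
    · linarith [neg_abs_le (ξ u)]
  have h7 := hK.dist_le_mul _ (hball _ humem).2.1 _ (hball _ (hmem s hs)).2.1
  rw [Real.dist_eq, (hball _ (hmem s hs)).1.2 hs0, sub_zero, dist_eq_norm, sub_add_cancel_left,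
    norm_neg, norm_smul, Real.norm_eq_abs] at h7
  refine h7.trans ?_
  calc (K : ℝ) * (|s| * ‖n‖) ≤ K * (a * ‖n‖) := by
        gcongr; exact abs_le.2 hs
    _ = _ := by rw [ha]; ring

/-- A function that vanishes on the regular level set `{ξ = 0}` has derivative zero along it. -/
theorem fderiv_apply_eq_zero_of_zero_imp {ξ ψ : E → ℝ} {u₀ v : E} (hξ : ContDiffAt ℝ ∞ ξ u₀)
    (hψ : ContDiffAt ℝ ∞ ψ u₀) (h0 : ξ u₀ = 0) (hd : fderiv ℝ ξ u₀ ≠ 0)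
    (hz : ∀ᶠ u in 𝓝 u₀, ξ u = 0 → ψ u = 0) (hv : fderiv ℝ ξ u₀ v = 0) : fderiv ℝ ψ u₀ v = 0 := by
  obtain ⟨C, hC⟩ := exists_abs_le_of_zero_imp hξ hψ h0 hd hz
  have hline : HasDerivAt (fun s : ℝ => u₀ + s • v) v 0 := by
    simpa using ((hasDerivAt_id (0 : ℝ)).smul_const v).const_add u₀
  have hξ' : HasDerivAt (fun s : ℝ => ξ (u₀ + s • v)) 0 0 := by
    refine HasDerivAt.congr_deriv (f := fun s : ℝ => ξ (u₀ + s • v)) ?_ hv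
    exact HasFDerivAt.comp_hasDerivAt (0 : ℝ) (by
      simpa using (hξ.differentiableAt (by simp)).hasFDerivAt) hline
  have hψ' : HasDerivAt (fun s : ℝ => ψ (u₀ + s • v)) (fderiv ℝ ψ u₀ v) 0 :=
    HasFDerivAt.comp_hasDerivAt (0 : ℝ) (by
      simpa using (hψ.differentiableAt (by simp)).hasFDerivAt) hline
  have h1 : (fun s : ℝ => ξ (u₀ + s • v)) =o[𝓝 0] fun s => s := by
    have := hξ'.isLittleO; simpa [h0] using this
  have hψ0 : ψ u₀ = 0 := hz.self_of_nhds h0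
  have h2 : (fun s : ℝ => ψ (u₀ + s • v)) =o[𝓝 0] fun s => s := by
    refine Asymptotics.IsBigO.trans_isLittleO (Asymptotics.IsBigO.of_bound C ?_) h1
    have : Tendsto (fun s : ℝ => u₀ + s • v) (𝓝 0) (𝓝 u₀) := by
      simpa using hline.continuousAt.tendsto
    simpa using this.eventually hC
  have h3 : HasDerivAt (fun s : ℝ => ψ (u₀ + s • v)) 0 0 := by
    rw [hasDerivAt_iff_isLittleO]; simpa [hψ0] using h2
  exact hψ'.unique h3

variable {M : Type*} [TopologicalSpace M] [ChartedSpace E M] [IsManifold 𝓘(ℝ, E) ∞ M]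

theorem differential_comp_symm {x : M → ℝ} {c : M} {u : E}
    (hu : u ∈ (extChartAt 𝓘(ℝ, E) c).target)
    (hx : MDifferentiableAt 𝓘(ℝ, E) 𝓘(ℝ, ℝ) x ((extChartAt 𝓘(ℝ, E) c).symm u)) :
    fderiv ℝ (fun v => x ((extChartAt 𝓘(ℝ, E) c).symm v)) u =
      (differential E x ((extChartAt 𝓘(ℝ, E) c).symm u)).comp
        (tangentMapAt E (extChartAt 𝓘(ℝ, E) c).symm u) := by
  rw [← mfderiv_eq_fderiv]
  exact mfderiv_comp u hx (mdifferentiableAt_chart_symm hu)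

theorem differential_apply_field {x : M → ℝ} (X : M → E) {c : M} {u : E}
    (hu : u ∈ (extChartAt 𝓘(ℝ, E) c).target)
    (hx : MDifferentiableAt 𝓘(ℝ, E) 𝓘(ℝ, ℝ) x ((extChartAt 𝓘(ℝ, E) c).symm u)) :
    fderiv ℝ (fun v => x ((extChartAt 𝓘(ℝ, E) c).symm v)) u (fieldInChart X c u) =
      differential E x ((extChartAt 𝓘(ℝ, E) c).symm u) (X ((extChartAt 𝓘(ℝ, E) c).symm u)) := by
  rw [differential_comp_symm hu hx, ContinuousLinearMap.comp_apply, tangentMapAt_symm_fieldInChart X hu]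

theorem differential_self {x : M → ℝ} {p : M} (hx : MDifferentiableAt 𝓘(ℝ, E) 𝓘(ℝ, ℝ) x p) :
    fderiv ℝ (fun v => x ((extChartAt 𝓘(ℝ, E) p).symm v)) (extChartAt 𝓘(ℝ, E) p p) =
      differential E x p := by
  have hp := mem_extChartAt_target (I := 𝓘(ℝ, E)) p
  rw [differential_comp_symm hp (by rwa [extChartAt_to_inv]), extChartAt_to_inv]
  have := tangentMapAt_chart_symm_comp (mem_extChartAt_source (I := 𝓘(ℝ, E)) p)
  rw [tangentMapAt_chart_self, ContinuousLinearMap.comp_id] at this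
  rw [this]; rfl

namespace IsLocalDefining

variable {Z U : Set M} {x : M → ℝ}

theorem mono (h : IsLocalDefining E Z U x) {V : Set M} (hV : IsOpen V) (hVU : V ⊆ U) :
    IsLocalDefining E Z V x :=
  ⟨hV, h.smooth.mono hVU, fun p hp => h.regular p (hVU hp), fun p hp => h.zero_iff p (hVU hp)⟩

theorem contMDiffAt (h : IsLocalDefining E Z U x) {p : M} (hp : p ∈ U) :
    ContMDiffAt 𝓘(ℝ, E) 𝓘(ℝ, ℝ) ∞ x p :=
  h.smooth.contMDiffAt (h.isOpen.mem_nhds hp)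

theorem mdifferentiableAt (h : IsLocalDefining E Z U x) {p : M} (hp : p ∈ U) :
    MDifferentiableAt 𝓘(ℝ, E) 𝓘(ℝ, ℝ) x p :=
  (h.contMDiffAt hp).mdifferentiableAt (by simp)

theorem contDiffAt (h : IsLocalDefining E Z U x) {c : M} {u : E}
    (hu : u ∈ (extChartAt 𝓘(ℝ, E) c).target) (hU : (extChartAt 𝓘(ℝ, E) c).symm u ∈ U) :
    ContDiffAt ℝ ∞ (fun v => x ((extChartAt 𝓘(ℝ, E) c).symm v)) u :=
  ((h.contMDiffAt hU).comp u (contMDiffAt_chart_symm hu)).contDiffAt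

/-- A regular level set has empty interior. -/
theorem frequently_notMem (h : IsLocalDefining E Z U x) {p : M} (hp : p ∈ U) :
    ∃ᶠ q in 𝓝 p, q ∉ Z := by
  intro hc
  have h1 : x =ᶠ[𝓝 p] fun _ => (0 : ℝ) := by
    filter_upwards [hc, h.isOpen.mem_nhds hp] with q hq hqU
    exact (h.zero_iff q hqU).2 (not_not.1 hq)
  apply h.regular p hp
  unfold differential
  rw [h1.mfderiv_eq]
  exact mfderiv_const

end IsLocalDefining

theorem IsHypersurface.frequently_notMem {Z : Set M} (hZ : IsHypersurface E Z) (p : M) :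
    ∃ᶠ q in 𝓝 p, q ∉ Z := by
  by_cases hp : p ∈ Z
  · obtain ⟨U, x, hpU, h⟩ := hZ.exists_defining p hp
    exact h.frequently_notMem hpU
  · exact (hZ.isClosed.isOpen_compl.eventually_mem hp).frequently

theorem IsHypersurface.frequently_symm_notMem {Z : Set M} (hZ : IsHypersurface E Z) {c : M} {u : E}
    (hu : u ∈ (extChartAt 𝓘(ℝ, E) c).target) :
    ∃ᶠ v in 𝓝 u, (extChartAt 𝓘(ℝ, E) c).symm v ∉ Z := by
  intro hc
  refine hZ.frequently_notMem ((extChartAt 𝓘(ℝ, E) c).symm u) ?_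
  have hs := (extChartAt 𝓘(ℝ, E) c).map_target hu
  have h1 := (mdifferentiableAt_chart (E := E) hs).continuousAt
  have h2 := h1.eventually (by rw [(extChartAt 𝓘(ℝ, E) c).right_inv hu]; exact hc)
  filter_upwards [h2, eventually_chart_symm_chart hs] with q hq hq'
  rwa [hq'] at hq

/-- Two continuous functions that agree at points arbitrarily close to `p` agree at `p`. It is used
for points off `Z`, to extend identities across `Z`. -/
theorem eq_of_frequently {Y : Type*} [TopologicalSpace Y] {V : Type*} [TopologicalSpace V]
    [T2Space V] {p : Y} {P : Y → Prop} (hP : ∃ᶠ q in 𝓝 p, P q) {f g : Y → V} (hf : ContinuousAt f p)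
    (hg : ContinuousAt g p) (h : ∀ᶠ q in 𝓝 p, P q → f q = g q) : f p = g p := by
  by_contra hne
  refine hP ?_
  filter_upwards [h, (hf.tendsto.prodMk_nhds hg.tendsto).eventually
    (isClosed_diagonal.isOpen_compl.mem_nhds (show (f p, g p) ∈ (diagonal V)ᶜ from hne))] with q h1 h2 h3
  exact h2 (h1 h3)

/-- Two defining functions with the same absolute value agree up to a constant sign. -/
theorem IsLocalDefining.exists_sign {Z U U' : Set M} {x x' : M → ℝ} (h : IsLocalDefining E Z U x)
    (h' : IsLocalDefining E Z U' x') (habs : ∀ q ∈ U, q ∈ U' → |x q| = |x' q|) {p : M} (hp : p ∈ U)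
    (hp' : p ∈ U') : ∃ ε : ℝ, ε * ε = 1 ∧ ∀ᶠ q in 𝓝 p, x' q = ε * x q := by
  have key : ∀ ε : ℝ, ε * ε = 1 → differential E x' p ≠ ε • differential E x p →
      ∀ᶠ q in 𝓝 p, x' q = -ε * x q := by
    intro ε hε hne
    -- near `p`, the function `x' - ε x` has no critical points, so its zero set is nowhere dense
    set y : M → ℝ := fun q => x' q - ε * x q with hy
    have hyd : ContMDiffAt 𝓘(ℝ, E) 𝓘(ℝ, ℝ) ∞ y p :=
      (h'.contMDiffAt hp').sub (contMDiffAt_const.mul (h.contMDiffAt hp))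
    have hu := mem_extChartAt_target (I := 𝓘(ℝ, E)) p
    have hsymm := contMDiffAt_chart_symm hu
    have hyc : ContDiffAt ℝ ∞ (fun v => y ((extChartAt 𝓘(ℝ, E) p).symm v))
        (extChartAt 𝓘(ℝ, E) p p) :=
      (ContMDiffAt.comp (g := y) _ (by rwa [extChartAt_to_inv]) hsymm).contDiffAt
    have hder : fderiv ℝ (fun v => y ((extChartAt 𝓘(ℝ, E) p).symm v)) (extChartAt 𝓘(ℝ, E) p p) ≠ 0 := by
      have hpU : (extChartAt 𝓘(ℝ, E) p).symm (extChartAt 𝓘(ℝ, E) p p) ∈ U := by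
        rwa [extChartAt_to_inv]
      have hpU' : (extChartAt 𝓘(ℝ, E) p).symm (extChartAt 𝓘(ℝ, E) p p) ∈ U' := by
        rwa [extChartAt_to_inv]
      have e1 := (h.contDiffAt hu hpU).differentiableAt (by simp)
      have e2 := (h'.contDiffAt hu hpU').differentiableAt (by simp)
      have e3 := (e2.hasFDerivAt.sub (e1.hasFDerivAt.const_mul ε)).fderiv
      rw [differential_self (h.mdifferentiableAt hp), differential_self (h'.mdifferentiableAt hp')]
        at e3
      intro h0
      exact hne (sub_eq_zero.1 (e3.symm.trans h0))
    have hev : ∀ᶠ u in 𝓝 (extChartAt 𝓘(ℝ, E) p p),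
        fderiv ℝ (fun v => y ((extChartAt 𝓘(ℝ, E) p).symm v)) u ≠ 0 :=
      (hyc.fderiv_right (m := 0) (by simp)).continuousAt.eventually_ne hder
    have hprod : ∀ᶠ u in 𝓝 (extChartAt 𝓘(ℝ, E) p p),
        (x' ((extChartAt 𝓘(ℝ, E) p).symm u) + ε * x ((extChartAt 𝓘(ℝ, E) p).symm u)) = 0 := by
      have hin := eventually_symm_mem hu (A := U ∩ U') (by
        rw [extChartAt_to_inv]
        exact inter_mem (h.isOpen.mem_nhds hp) (h'.isOpen.mem_nhds hp'))
      filter_upwards [hin.eventually_nhds, hev] with u hu1 hu2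
      have hsq : ∀ᶠ v in 𝓝 u, y ((extChartAt 𝓘(ℝ, E) p).symm v) ≠ 0 →
          x' ((extChartAt 𝓘(ℝ, E) p).symm v) + ε * x ((extChartAt 𝓘(ℝ, E) p).symm v) = 0 := by
        filter_upwards [hu1] with v hv hyv
        have h1 := sq_eq_sq_iff_abs_eq_abs _ _ |>.2 (habs _ hv.2.1 hv.2.2)
        refine (mul_eq_zero.1 ?_).resolve_left hyv
        simp only [hy]
        linear_combination -h1 - x ((extChartAt 𝓘(ℝ, E) p).symm v) ^ 2 * hε
      have huu := hu1.self_of_nhds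
      have c1 := (h.contDiffAt huu.1 huu.2.1).continuousAt
      have c2 := (h'.contDiffAt huu.1 huu.2.2).continuousAt
      refine eq_of_frequently (P := fun v => y ((extChartAt 𝓘(ℝ, E) p).symm v) ≠ 0) (fun hc => ?_)
        (c2.add (c1.const_mul ε)) (continuousAt_const (y := (0 : ℝ))) hsq
      apply hu2
      have h0 : (fun v => y ((extChartAt 𝓘(ℝ, E) p).symm v)) =ᶠ[𝓝 u] fun _ => (0 : ℝ) := by
        filter_upwards [hc] with v hv using not_not.1 hv
      rw [h0.fderiv_eq]
      exact (hasFDerivAt_const (0 : ℝ) u).fderiv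
    have hs := mem_extChartAt_source (I := 𝓘(ℝ, E)) p
    filter_upwards [(mdifferentiableAt_chart hs).continuousAt.eventually hprod,
      eventually_chart_symm_chart hs] with q h1 h2
    rw [h2] at h1
    linarith
  by_cases h1 : differential E x' p = (1 : ℝ) • differential E x p
  · refine ⟨1, by norm_num, ?_⟩
    have := key (-1) (by norm_num) (by
      rw [h1]
      intro h2
      refine h.regular p hp (ContinuousLinearMap.ext fun v => ?_)
      have h3 := congrArg (fun L : E →L[ℝ] ℝ => L v) h2
      simp only [_root_.smul_apply, smul_eq_mul] at h3
      rw [_root_.zero_apply]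
      linarith)
    simpa using this
  · exact ⟨-1, by norm_num, key 1 (by norm_num) h1⟩

end DefiningFunctions

/-! ### Clearing denominators -/

section Cleared

variable {E : Type*} [NormedAddCommGroup E] [NormedSpace ℝ E]
  {M : Type*} [TopologicalSpace M] [ChartedSpace E M]

/-- The form `dx ∧ α + x^m β`, that is, `x^m η` for the `b^m`-form `η = (dx / x^m) ∧ α + β`. -/
def clearedForm {k : ℕ} (m : ℕ) (x : M → ℝ) (α : DForm E M k) (β : DForm E M (k + 1)) :
    DForm E M (k + 1) := fun q => dWedge x α q + x q ^ m • β q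

theorem inChart_apply_one (η : DForm E M 1) (c : M) (u v : E) :
    inChart η c u ![v] = η ((extChartAt 𝓘(ℝ, E) c).symm u)
      ![tangentMapAt E (extChartAt 𝓘(ℝ, E) c).symm u v] := by
  unfold inChart pullback
  rw [ContinuousAlternatingMap.compContinuousLinearMap_apply]
  congr 1; ext i; fin_cases i; rfl

theorem inChart_apply_two (η : DForm E M 2) (c : M) (u v w : E) :
    inChart η c u ![v, w] = η ((extChartAt 𝓘(ℝ, E) c).symm u)
      ![tangentMapAt E (extChartAt 𝓘(ℝ, E) c).symm u v,
        tangentMapAt E (extChartAt 𝓘(ℝ, E) c).symm u w] := by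
  unfold inChart pullback
  rw [ContinuousAlternatingMap.compContinuousLinearMap_apply]
  congr 1; ext i; fin_cases i <;> rfl

theorem inChart_eq_smul {k : ℕ} {η η' : DForm E M k} {c : M} {u : E} {r : ℝ}
    (h : η ((extChartAt 𝓘(ℝ, E) c).symm u) = r • η' ((extChartAt 𝓘(ℝ, E) c).symm u)) :
    inChart η c u = r • inChart η' c u := by
  unfold inChart pullback; rw [h]; rfl

theorem dWedge_apply_one (x : M → ℝ) (α : DForm E M 0) (p : M) (v : E) :
    dWedge x α p ![v] = α p ![] * differential E x p v := by
  unfold dWedge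
  rw [ContinuousAlternatingMap.alternatizeUncurryFin_apply]
  simp [Subsingleton.elim (Fin.removeNth 0 ![v]) ![], mul_comm]

theorem dWedge_apply_two (x : M → ℝ) (α : DForm E M 1) (p : M) (v w : E) :
    dWedge x α p ![v, w] = differential E x p v * α p ![w] - differential E x p w * α p ![v] := by
  unfold dWedge
  have h0 : Fin.removeNth 0 ![v, w] = ![w] := by ext i; fin_cases i; rfl
  have h1 : Fin.removeNth 1 ![v, w] = ![v] := by ext i; fin_cases i; rfl
  rw [ContinuousAlternatingMap.alternatizeUncurryFin_apply, Fin.sum_univ_two, h0, h1]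
  simp [sub_eq_add_neg]

variable [IsManifold 𝓘(ℝ, E) ∞ M]

theorem inChart_dWedge {k : ℕ} {x : M → ℝ} (α : DForm E M k) {c : M} {u : E}
    (hu : u ∈ (extChartAt 𝓘(ℝ, E) c).target)
    (hx : MDifferentiableAt 𝓘(ℝ, E) 𝓘(ℝ, ℝ) x ((extChartAt 𝓘(ℝ, E) c).symm u)) :
    inChart (dWedge x α) c u = ContinuousAlternatingMap.alternatizeUncurryFin
      ((fderiv ℝ (fun v => x ((extChartAt 𝓘(ℝ, E) c).symm v)) u).smulRight (inChart α c u)) := by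
  rw [differential_comp_symm hu hx]
  unfold inChart pullback dWedge
  ext v
  rw [ContinuousAlternatingMap.compContinuousLinearMap_apply,
    ContinuousAlternatingMap.alternatizeUncurryFin_apply,
    ContinuousAlternatingMap.alternatizeUncurryFin_apply]
  rfl

theorem inChart_clearedForm {k m : ℕ} {x : M → ℝ} (α : DForm E M k) (β : DForm E M (k + 1)) {c : M}
    {u : E} (hu : u ∈ (extChartAt 𝓘(ℝ, E) c).target)
    (hx : MDifferentiableAt 𝓘(ℝ, E) 𝓘(ℝ, ℝ) x ((extChartAt 𝓘(ℝ, E) c).symm u)) :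
    inChart (clearedForm m x α β) c u = ContinuousAlternatingMap.alternatizeUncurryFin
      ((fderiv ℝ (fun v => x ((extChartAt 𝓘(ℝ, E) c).symm v)) u).smulRight (inChart α c u)) +
      x ((extChartAt 𝓘(ℝ, E) c).symm u) ^ m • inChart β c u := by
  rw [← inChart_dWedge α hu hx]; rfl

theorem smoothFormOn_clearedForm {k m : ℕ} {Z U : Set M} {x : M → ℝ} (hx : IsLocalDefining E Z U x)
    {α : DForm E M k} {β : DForm E M (k + 1)} (hα : SmoothFormOn α U) (hβ : SmoothFormOn β U) :
    SmoothFormOn (clearedForm m x α β) U := by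
  intro c u hu
  refine ContDiffAt.contDiffWithinAt ?_
  have hU := hx.isOpen.mem_nhds hu.2
  have hξ := hx.contDiffAt hu.1 hu.2
  have h0 : ContDiffAt ℝ ∞ (fun v =>
      (fderiv ℝ (fun v => x ((extChartAt 𝓘(ℝ, E) c).symm v)) v).smulRight (inChart α c v)) u :=
    ContDiffAt.smulRight (hξ.fderiv_right (by simp)) (hα.contDiffAt hu.1 hU)
  have h1 : ContDiffAt ℝ ∞ (fun v => ContinuousAlternatingMap.alternatizeUncurryFinCLM ℝ E ℝ
      ((fderiv ℝ (fun v => x ((extChartAt 𝓘(ℝ, E) c).symm v)) v).smulRight (inChart α c v))) u :=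
    h0.continuousLinearMap_comp _
  refine (h1.add ((hξ.pow m).smul (hβ.contDiffAt hu.1 hU))).congr_of_eventuallyEq ?_
  filter_upwards [eventually_symm_mem hu.1 hU] with v hv
  exact inChart_clearedForm α β hv.1 (hx.mdifferentiableAt hv.2)

namespace IsBmDecomposition

variable {k m : ℕ} {Z U : Set M} {r x : M → ℝ} {η : DForm E M (k + 1)} {α : DForm E M k}
  {β : DForm E M (k + 1)}

theorem clearedForm_eq (h : IsBmDecomposition m Z r η U x α β) {q : M} (hq : q ∈ U) (hqZ : q ∉ Z) :
    clearedForm m x α β q = x q ^ m • η q := by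
  have hx : x q ^ m ≠ 0 := pow_ne_zero _ fun h0 => hqZ ((h.defining.zero_iff q hq).1 h0)
  rw [h.eq q ⟨hq, hqZ⟩, smul_add, smul_smul, mul_inv_cancel₀ hx, one_smul]; rfl

theorem mono (h : IsBmDecomposition m Z r η U x α β) {V : Set M} (hV : IsOpen V) (hVU : V ⊆ U) :
    IsBmDecomposition m Z r η V x α β :=
  ⟨h.defining.mono hV hVU, fun q hq => h.abs_eq q (hVU hq), h.smooth_left.mono hVU,
    h.smooth_right.mono hVU, fun q hq => h.eq q ⟨hVU hq.1, hq.2⟩⟩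

/-- A decomposition can be rewritten in terms of any other defining function with absolute
value `r`, because this function is locally `± x`. -/
theorem exists_of_defining (h : IsBmDecomposition m Z r η U x α β) {U' : Set M} {x' : M → ℝ}
    (hx' : IsLocalDefining E Z U' x') (habs : ∀ q ∈ U', |x' q| = r q) {p : M} (hp : p ∈ U)
    (hp' : p ∈ U') : ∃ V : Set M, V ⊆ U' ∧ p ∈ V ∧ ∃ (α' : DForm E M k),
      IsBmDecomposition m Z r η V x' α' β ∧ ∃ ε : ℝ, ε * ε = 1 ∧
        ∀ q ∈ V, x' q = ε * x q ∧ α' q = ε ^ (m + 1) • α q := by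
  obtain ⟨ε, hε, hev⟩ := h.defining.exists_sign hx' (fun q hq hq' => by
    rw [h.abs_eq q hq, habs q hq'])
    hp hp'
  obtain ⟨W, hW, hWo, hpW⟩ := eventually_nhds_iff.1 hev
  set V := W ∩ (U ∩ U') with hV
  have hVo : IsOpen V := hWo.inter (h.defining.isOpen.inter hx'.isOpen)
  refine ⟨V, fun q hq => hq.2.2, ⟨hpW, hp, hp'⟩, fun q => ε ^ (m + 1) • α q,
    ⟨hx'.mono hVo fun q hq => hq.2.2, fun q hq => habs q hq.2.2, fun c => ?_,
      h.smooth_right.mono fun q hq => hq.2.1, fun q hq => ?_⟩, ε, hε,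
      fun q hq => ⟨hW q hq.1, rfl⟩⟩
  · have hαV : SmoothFormOn α V := h.smooth_left.mono fun q hq => hq.2.1
    exact ((hαV c).const_smul (ε ^ (m + 1))).congr fun u _ => inChart_eq_smul rfl
  · have hd : differential E x' q = ε • differential E x q := by
      have he : x' =ᶠ[𝓝 q] fun q => ε * x q := by
        filter_upwards [hWo.mem_nhds hq.1.1] with y hy using hW y hy
      unfold differential
      rw [he.mfderiv_eq]
      have := ((h.defining.mdifferentiableAt hq.1.2.1).hasMFDerivAt.const_smul ε).mfderiv
      exact this
    have hw : dWedge x' (fun q => ε ^ (m + 1) • α q) q = (ε ^ m * (ε * ε)) • dWedge x α q := by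
      unfold dWedge
      rw [hd, ← ContinuousAlternatingMap.alternatizeUncurryFin_smul]
      congr 1
      ext v w
      simp [pow_succ]
      ring
    rw [h.eq q ⟨hq.1.2.1, hq.2⟩, hw, hε, mul_one, hW q hq.1.1, mul_pow, mul_inv, smul_smul]
    have hεm : (ε ^ m) ≠ 0 := pow_ne_zero _ (by rintro rfl; simp at hε)
    congr 2
    field_simp

end IsBmDecomposition

end Cleared

section Glueing

theorem oneForm_apply (a : Plane [⋀^Fin 1]→L[ℝ] ℝ) (v : Plane) :
    a ![v] = v 0 * a ![planeBasis 0] + v 1 * a ![planeBasis 1] := by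
  have h : ∀ z w : Plane, Function.update ![z] 0 w = ![w] := fun z w => by
    ext i j; fin_cases i; rfl
  have hadd : ∀ y z : Plane, a ![y + z] = a ![y] + a ![z] := fun y z => by
    have := a.map_update_add ![0] 0 y z
    simpa [h] using this
  have hsmul : ∀ (s : ℝ) (z : Plane), a ![s • z] = s * a ![z] := fun s z => by
    have := a.map_update_smul ![0] 0 s z
    simpa [h] using this
  conv_lhs => rw [plane_eq v]
  rw [hadd, hsmul, hsmul]

/-- The solution `X` of `ι_X (ρ dx₀ ∧ dx₁) = -a`. -/
def planeSolve (ρ : ℝ) (a : Plane [⋀^Fin 1]→L[ℝ] ℝ) : Plane :=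
  ρ⁻¹ • (a ![planeBasis 0] • planeBasis 1 - a ![planeBasis 1] • planeBasis 0)

theorem planeSolve_spec {η : Plane [⋀^Fin 2]→L[ℝ] ℝ} (hη : planeCoeff η ≠ 0)
    (a : Plane [⋀^Fin 1]→L[ℝ] ℝ) (v : Plane) : η ![planeSolve (planeCoeff η) a, v] = -a ![v] := by
  rw [twoForm_apply, oneForm_apply]
  simp [planeSolve]
  field_simp
  ring

theorem eq_planeSolve {η : Plane [⋀^Fin 2]→L[ℝ] ℝ} (hη : planeCoeff η ≠ 0)
    {a : Plane [⋀^Fin 1]→L[ℝ] ℝ} {X : Plane} (h : ∀ v, η ![X, v] = -a ![v]) :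
    X = planeSolve (planeCoeff η) a := by
  have h0 := h (planeBasis 0)
  have h1 := h (planeBasis 1)
  rw [twoForm_apply] at h0 h1
  simp at h0 h1
  ext i
  fin_cases i
  · simp [planeSolve]
    field_simp
    linarith
  · simp [planeSolve]
    field_simp
    linarith

variable {M : Type*} [TopologicalSpace M] [ChartedSpace Plane M]

/-- On the open set `U` the forms `ω₀`, `ω₁`, `α` become, after multiplication by the function `g`,
smooth forms `R₀`, `R₁`, `A`, the first two without zeros. -/
structure IsCleared (Z : Set M) (ω₀ ω₁ : DForm Plane M 2) (α : DForm Plane M 1) (U : Set M)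
    (R₀ R₁ : DForm Plane M 2) (A : DForm Plane M 1) (g : M → ℝ) : Prop where
  isOpen : IsOpen U
  smooth₀ : SmoothFormOn R₀ U
  smooth₁ : SmoothFormOn R₁ U
  smooth : SmoothFormOn A U
  ne₀ : ∀ q ∈ U, planeCoeff (R₀ q) ≠ 0
  ne₁ : ∀ q ∈ U, planeCoeff (R₁ q) ≠ 0
  eq₀ : ∀ q ∈ U, q ∉ Z → R₀ q = g q • ω₀ q
  eq₁ : ∀ q ∈ U, q ∉ Z → R₁ q = g q • ω₁ q
  eq : ∀ q ∈ U, q ∉ Z → A q = g q • α q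

variable [IsManifold 𝓘(ℝ, Plane) ∞ M] {Z : Set M} {ω₀ ω₁ : DForm Plane M 2} {α : DForm Plane M 1}

theorem planeCoeff_inChart (η : DForm Plane M 2) (c : M) (u : Plane) :
    planeCoeff (inChart η c u) = planeDet (tangentMapAt Plane (extChartAt 𝓘(ℝ, Plane) c).symm u) *
      planeCoeff (η ((extChartAt 𝓘(ℝ, Plane) c).symm u)) :=
  planeCoeff_comp _ _

theorem planeDet_chart_symm_ne {c : M} {u : Plane} (hu : u ∈ (extChartAt 𝓘(ℝ, Plane) c).target) :
    planeDet (tangentMapAt Plane (extChartAt 𝓘(ℝ, Plane) c).symm u) ≠ 0 := by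
  have h := congrArg planeDet (tangentMapAt_chart_comp_symm hu)
  rw [planeDet_comp, planeDet_id] at h
  exact right_ne_zero_of_mul_eq_one h

theorem SmoothFormOn.contDiffAt_coeff {η : DForm Plane M 2} {U : Set M} (h : SmoothFormOn η U)
    {c : M} {u : Plane} (hu : u ∈ (extChartAt 𝓘(ℝ, Plane) c).target)
    (hU : U ∈ 𝓝 ((extChartAt 𝓘(ℝ, Plane) c).symm u)) : ContDiffAt ℝ ∞ (coeffInChart η c) u :=
  contDiff_planeCoeff.contDiffAt.comp u (h.contDiffAt hu hU)

theorem SmoothFormOn.contDiffAt_apply {η : DForm Plane M 1} {U : Set M} (h : SmoothFormOn η U)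
    {c : M} {u : Plane} (hu : u ∈ (extChartAt 𝓘(ℝ, Plane) c).target)
    (hU : U ∈ 𝓝 ((extChartAt 𝓘(ℝ, Plane) c).symm u)) (v : Plane) :
    ContDiffAt ℝ ∞ (fun w => inChart η c w ![v]) u :=
  (ContinuousAlternatingMap.apply ℝ Plane ℝ ![v]).contDiff.contDiffAt.comp u (h.contDiffAt hu hU)

/-- Two ways of clearing denominators differ by a factor, also on `Z`, by continuity. -/
theorem IsCleared.cross (hZ : IsHypersurface Plane Z) {U U' : Set M}
    {R₀ R₁ R₀' R₁' : DForm Plane M 2}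
    {A A' : DForm Plane M 1} {g g' : M → ℝ} (h : IsCleared Z ω₀ ω₁ α U R₀ R₁ A g)
    (h' : IsCleared Z ω₀ ω₁ α U' R₀' R₁' A' g') {p : M} (hp : p ∈ U) (hp' : p ∈ U') :
    planeCoeff (R₀ p) * planeCoeff (R₁' p) = planeCoeff (R₀' p) * planeCoeff (R₁ p) ∧
      ∀ v, planeCoeff (R₀ p) * A' p ![v] = planeCoeff (R₀' p) * A p ![v] := by
  have hu := mem_extChartAt_target (I := 𝓘(ℝ, Plane)) p
  have hU : U ∈ 𝓝 ((extChartAt 𝓘(ℝ, Plane) p).symm (extChartAt 𝓘(ℝ, Plane) p p)) := by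
    rw [extChartAt_to_inv]; exact h.isOpen.mem_nhds hp
  have hU' : U' ∈ 𝓝 ((extChartAt 𝓘(ℝ, Plane) p).symm (extChartAt 𝓘(ℝ, Plane) p p)) := by
    rw [extChartAt_to_inv]; exact h'.isOpen.mem_nhds hp'
  have hfr := hZ.frequently_symm_notMem hu
  have hev := eventually_symm_mem hu (inter_mem hU hU')
  have c0 := (h.smooth₀.contDiffAt_coeff hu hU).continuousAt
  have c0' := (h'.smooth₀.contDiffAt_coeff hu hU').continuousAt
  have c1 := (h.smooth₁.contDiffAt_coeff hu hU).continuousAt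
  have c1' := (h'.smooth₁.contDiffAt_coeff hu hU').continuousAt
  constructor
  · have := eq_of_frequently hfr (c0.mul c1') (c0'.mul c1) (by
      filter_upwards [hev] with v hv hvZ
      simp only [Pi.mul_apply, coeffInChart]
      rw [inChart_eq_smul (h.eq₀ _ hv.2.1 hvZ), inChart_eq_smul (h.eq₁ _ hv.2.1 hvZ),
        inChart_eq_smul (h'.eq₀ _ hv.2.2 hvZ), inChart_eq_smul (h'.eq₁ _ hv.2.2 hvZ)]
      simp only [planeCoeff_smul]
      ring)
    simpa only [Pi.mul_apply, coeffInChart, inChart_self] using this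
  · intro w
    have a1 := (h.smooth.contDiffAt_apply hu hU w).continuousAt
    have a1' := (h'.smooth.contDiffAt_apply hu hU' w).continuousAt
    have := eq_of_frequently hfr (c0.mul a1') (c0'.mul a1) (by
      filter_upwards [hev] with v hv hvZ
      simp only [Pi.mul_apply, coeffInChart]
      rw [inChart_eq_smul (h.eq₀ _ hv.2.1 hvZ), inChart_eq_smul (h.eq _ hv.2.1 hvZ),
        inChart_eq_smul (h'.eq₀ _ hv.2.2 hvZ), inChart_eq_smul (h'.eq _ hv.2.2 hvZ)]
      simp only [planeCoeff_smul, ContinuousAlternatingMap.smul_apply, smul_eq_mul]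
      ring)
    simpa only [Pi.mul_apply, coeffInChart, inChart_self] using this

/-- The solution `X` of `ι_X ω₀ = -α` and the quotient `h = ω₁ / ω₀` extend smoothly across `Z`. -/
theorem exists_field_and_ratio (hZ : IsHypersurface Plane Z)
    (hcl : ∀ p, ∃ U R₀ R₁ A g, p ∈ U ∧ IsCleared Z ω₀ ω₁ α U R₀ R₁ A g) :
    ∃ (X : M → Plane) (h : M → ℝ), SmoothField X ∧ SmoothScalar h ∧
      ∀ p U R₀ R₁ A g, IsCleared Z ω₀ ω₁ α U R₀ R₁ A g → p ∈ U →
        h p ≠ 0 ∧ R₁ p = h p • R₀ p ∧ ∀ v, R₀ p ![X p, v] = -A p ![v] := by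
  choose U R₀ R₁ A g hp hc using hcl
  set X : M → Plane := fun p => planeSolve (planeCoeff (R₀ p p)) (A p p) with hX
  set h : M → ℝ := fun p => planeCoeff (R₁ p p) / planeCoeff (R₀ p p) with hh
  have key : ∀ p U R₀ R₁ A g, IsCleared Z ω₀ ω₁ α U R₀ R₁ A g → p ∈ U →
        h p ≠ 0 ∧ R₁ p = h p • R₀ p ∧ ∀ v, R₀ p ![X p, v] = -A p ![v] := by
    intro p U' R₀' R₁' A' g' hc' hpU'
    obtain ⟨e1, e2⟩ := (hc p).cross hZ hc' (hp p) hpU'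
    have n0 := (hc p).ne₀ p (hp p)
    have n1 := (hc p).ne₁ p (hp p)
    refine ⟨div_ne_zero n1 n0, twoForm_ext ?_, fun v => ?_⟩
    · rw [planeCoeff_smul, hh]
      field_simp
      linarith
    · have e3 := planeSolve_spec n0 (A p p) v
      change R₀ p p ![X p, v] = _ at e3
      have e4 := e2 v
      rw [twoForm_apply] at e3 ⊢
      apply mul_left_cancel₀ n0
      linear_combination planeCoeff (R₀' p) * e3 + e4
  refine ⟨X, h, fun c u hu => ?_, fun c u hu => ?_, key⟩
  · refine ContDiffAt.contDiffWithinAt ?_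
    set p := (extChartAt 𝓘(ℝ, Plane) c).symm u
    have hU := (hc p).isOpen.mem_nhds (hp p)
    have hev : fieldInChart X c =ᶠ[𝓝 u] fun v =>
        planeSolve (coeffInChart (R₀ p) c v) (inChart (A p) c v) := by
      filter_upwards [eventually_symm_mem hu hU] with v hv
      refine eq_planeSolve ?_ fun w => ?_
      · rw [planeCoeff_inChart]
        exact mul_ne_zero (planeDet_chart_symm_ne hv.1) ((hc p).ne₀ _ hv.2)
      · rw [inChart_apply_one, inChart_apply_two, tangentMapAt_symm_fieldInChart X hv.1]
        exact (key _ _ _ _ _ _ (hc p) hv.2).2.2 _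
    refine ContDiffAt.congr_of_eventuallyEq ?_ hev
    have hne : coeffInChart (R₀ p) c u ≠ 0 := by
      rw [coeffInChart, planeCoeff_inChart]
      exact mul_ne_zero (planeDet_chart_symm_ne hu) ((hc p).ne₀ _ (hp p))
    have a := fun v => (hc p).smooth.contDiffAt_apply hu hU v
    exact (((hc p).smooth₀.contDiffAt_coeff hu hU).inv hne).smul
      (((a _).smul contDiffAt_const).sub ((a _).smul contDiffAt_const))
  · refine ContDiffAt.contDiffWithinAt ?_
    set p := (extChartAt 𝓘(ℝ, Plane) c).symm u
    have hU := (hc p).isOpen.mem_nhds (hp p)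
    have hev : (fun v => h ((extChartAt 𝓘(ℝ, Plane) c).symm v)) =ᶠ[𝓝 u] fun v =>
        coeffInChart (R₁ p) c v / coeffInChart (R₀ p) c v := by
      filter_upwards [eventually_symm_mem hu hU] with v hv
      have h1 := (key _ _ _ _ _ _ (hc p) hv.2).2.1
      rw [coeffInChart, coeffInChart, inChart_eq_smul h1, planeCoeff_smul, mul_div_cancel_right₀]
      rw [planeCoeff_inChart]
      exact mul_ne_zero (planeDet_chart_symm_ne hv.1) ((hc p).ne₀ _ hv.2)
    refine ContDiffAt.congr_of_eventuallyEq ?_ hev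
    have hne : coeffInChart (R₀ p) c u ≠ 0 := by
      rw [coeffInChart, planeCoeff_inChart]
      exact mul_ne_zero (planeDet_chart_symm_ne hu) ((hc p).ne₀ _ (hp p))
    exact ((hc p).smooth₁.contDiffAt_coeff hu hU).div ((hc p).smooth₀.contDiffAt_coeff hu hU) hne

end Glueing

/-! ### Forms with poles along the hypersurface and tangent fields -/

section BmForms

variable {M : Type*} [TopologicalSpace M] [ChartedSpace Plane M] [IsManifold 𝓘(ℝ, Plane) ∞ M]
  {m : ℕ} {Z : Set M} {r : M → ℝ}

theorem pow_eq_zero_of_mem {U : Set M} {x : M → ℝ} (hx : IsLocalDefining Plane Z U x) (hm : 1 ≤ m)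
    {p : M} (hp : p ∈ U) (hpZ : p ∈ Z) : x p ^ m = 0 := by
  rw [(hx.zero_iff p hp).2 hpZ, zero_pow (by omega)]

/-- The denominators-free form of a `b^m`-symplectic form has no zeros. -/
theorem IsBmSymplectic.planeCoeff_clearedForm_ne_zero {η : DForm Plane M 2}
    (h : IsBmSymplectic m Z r η) (hm : 1 ≤ m) {U : Set M} {x : M → ℝ} {α : DForm Plane M 1}
    {β : DForm Plane M 2} (hd : IsBmDecomposition m Z r η U x α β) {p : M} (hp : p ∈ U) :
    planeCoeff (clearedForm m x α β p) ≠ 0 := by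
  intro h0
  by_cases hpZ : p ∈ Z
  · have hw : ∀ v w : Plane, differential Plane x p v * α p ![w] =
        differential Plane x p w * α p ![v] := by
      intro v w
      have h1 : clearedForm m x α β p ![v, w] = 0 := by rw [twoForm_apply, h0, mul_zero]
      unfold clearedForm at h1
      rw [pow_eq_zero_of_mem hd.defining hm hp hpZ, zero_smul, add_zero, dWedge_apply_two] at h1
      linarith
    obtain ⟨n, hn⟩ : ∃ n, differential Plane x p n ≠ 0 := by
      by_contra! hc
      exact hd.defining.regular p hp (ContinuousLinearMap.ext hc)
    have h2 := h.nondegenerate_on p hpZ U x α β hp hd 1 0 (map_zero _) fun t w hxw => by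
      have h3 := hw n w
      rw [hxw, zero_mul] at h3
      rw [(mul_eq_zero.1 h3).resolve_left hn, (α p).map_coord_zero (m := ![0]) 0 rfl,
        (β p).map_coord_zero (m := ![0, w]) 0 rfl]
      simp
    exact one_ne_zero h2.1
  · rw [hd.clearedForm_eq hp hpZ, planeCoeff_smul] at h0
    have hx : x p ^ m ≠ 0 := pow_ne_zero _ fun h0 => hpZ ((hd.defining.zero_iff p hp).1 h0)
    have h1 := h.nondegenerate_off p hpZ (planeBasis 0) fun w => by
      rw [twoForm_apply, (mul_eq_zero.1 h0).resolve_left hx, mul_zero]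
    have := congrArg (fun v : Plane => v 0) h1
    simp at this

theorem IsBmSymplectic.planeCoeff_ne_zero {η : DForm Plane M 2} (h : IsBmSymplectic m Z r η) {p : M}
    (hp : p ∉ Z) : planeCoeff (η p) ≠ 0 := by
  intro h0
  have h1 := h.nondegenerate_off p hp (planeBasis 0) fun w => by rw [twoForm_apply, h0, mul_zero]
  have := congrArg (fun v : Plane => v 0) h1
  simp at this

/-- Three `b^m`-forms can be decomposed with respect to the same defining function. -/
theorem exists_common_decomposition {k₀ k₁ k₂ : ℕ} {η₀ : DForm Plane M (k₀ + 1)}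
    {η₁ : DForm Plane M (k₁ + 1)} {η₂ : DForm Plane M (k₂ + 1)} (h₀ : IsBmForm m Z r η₀)
    (h₁ : IsBmForm m Z r η₁) (h₂ : IsBmForm m Z r η₂) {p : M} (hp : p ∈ Z) :
    ∃ U x α₀ β₀ α₁ β₁ α₂ β₂, p ∈ U ∧ IsBmDecomposition m Z r η₀ U x α₀ β₀ ∧
      IsBmDecomposition m Z r η₁ U x α₁ β₁ ∧ IsBmDecomposition m Z r η₂ U x α₂ β₂ := by
  obtain ⟨U₀, x, α₀, β₀, hp₀, d₀⟩ := h₀.local_form p hp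
  obtain ⟨U₁, x₁, α₁, β₁, hp₁, d₁⟩ := h₁.local_form p hp
  obtain ⟨U₂, x₂, α₂, β₂, hp₂, d₂⟩ := h₂.local_form p hp
  obtain ⟨V₁, hV₁, hpV₁, α₁', d₁', -⟩ := d₁.exists_of_defining d₀.defining d₀.abs_eq hp₁ hp₀
  obtain ⟨V₂, hV₂, hpV₂, α₂', d₂', -⟩ := d₂.exists_of_defining d₀.defining d₀.abs_eq hp₂ hp₀
  have ho : IsOpen (V₁ ∩ V₂) := d₁'.defining.isOpen.inter d₂'.defining.isOpen
  exact ⟨V₁ ∩ V₂, x, α₀, β₀, α₁', β₁, α₂', β₂, ⟨hpV₁, hpV₂⟩, d₀.mono ho fun q hq => hV₁ hq.1,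
    d₁'.mono ho inter_subset_left, d₂'.mono ho inter_subset_right⟩

/-- Near `Z`, multiplication by `x ^ m` clears the denominators. -/
theorem isCleared_of_decomposition (hm : 1 ≤ m) {ω₀ ω₁ : DForm Plane M 2} {α : DForm Plane M 1}
    (h₀ : IsBmSymplectic m Z r ω₀) (h₁ : IsBmSymplectic m Z r ω₁) {U : Set M} {x : M → ℝ}
    {α₀ α₁ : DForm Plane M 1} {β₀ β₁ : DForm Plane M 2} {f : DForm Plane M 0}
    {β : DForm Plane M 1} (d₀ : IsBmDecomposition m Z r ω₀ U x α₀ β₀)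
    (d₁ : IsBmDecomposition m Z r ω₁ U x α₁ β₁) (d : IsBmDecomposition m Z r α U x f β) :
    IsCleared Z ω₀ ω₁ α U (clearedForm m x α₀ β₀) (clearedForm m x α₁ β₁) (clearedForm m x f β)
      (fun q => x q ^ m) where
  isOpen := d.defining.isOpen
  smooth₀ := smoothFormOn_clearedForm d₀.defining d₀.smooth_left d₀.smooth_right
  smooth₁ := smoothFormOn_clearedForm d₁.defining d₁.smooth_left d₁.smooth_right
  smooth := smoothFormOn_clearedForm d.defining d.smooth_left d.smooth_right
  ne₀ _ hq := h₀.planeCoeff_clearedForm_ne_zero hm d₀ hq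
  ne₁ _ hq := h₁.planeCoeff_clearedForm_ne_zero hm d₁ hq
  eq₀ _ hq hqZ := d₀.clearedForm_eq hq hqZ
  eq₁ _ hq hqZ := d₁.clearedForm_eq hq hqZ
  eq _ hq hqZ := d.clearedForm_eq hq hqZ

/-- Off `Z` there are no denominators to clear. -/
theorem isCleared_compl (hZ : IsClosed Z) {ω₀ ω₁ : DForm Plane M 2} {α : DForm Plane M 1}
    (h₀ : IsBmSymplectic m Z r ω₀) (h₁ : IsBmSymplectic m Z r ω₁) (h : IsBmForm m Z r α) :
    IsCleared Z ω₀ ω₁ α Zᶜ ω₀ ω₁ α (fun _ => 1) where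
  isOpen := hZ.isOpen_compl
  smooth₀ := h₀.isBmForm.smooth
  smooth₁ := h₁.isBmForm.smooth
  smooth := h.smooth
  ne₀ _ hq := h₀.planeCoeff_ne_zero hq
  ne₁ _ hq := h₁.planeCoeff_ne_zero hq
  eq₀ _ _ _ := (one_smul _ _).symm
  eq₁ _ _ _ := (one_smul _ _).symm
  eq _ _ _ := (one_smul _ _).symm

/-- The vector field `X` is tangent to `Z`: it annihilates all the local defining functions. -/
def IsTangentAlong (Z : Set M) (X : M → Plane) : Prop :=
  ∀ p ∈ Z, ∀ (U : Set M) (x : M → ℝ), p ∈ U → IsLocalDefining Plane Z U x →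
    differential Plane x p (X p) = 0

/-- If `y` vanishes on `Z`, then `dy` vanishes on the vectors tangent to `Z`. -/
theorem IsLocalDefining.differential_eq_zero {U : Set M} {x y : M → ℝ}
    (hx : IsLocalDefining Plane Z U x) {p : M} (hp : p ∈ U) (hpZ : p ∈ Z)
    (hy : ContMDiffAt 𝓘(ℝ, Plane) 𝓘(ℝ, ℝ) ∞ y p) (h0 : ∀ᶠ q in 𝓝 p, q ∈ Z → y q = 0) {v : Plane}
    (hv : differential Plane x p v = 0) : differential Plane y p v = 0 := by
  have hu := mem_extChartAt_target (I := 𝓘(ℝ, Plane)) p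
  have hinv := extChartAt_to_inv (I := 𝓘(ℝ, Plane)) p
  have hpU : (extChartAt 𝓘(ℝ, Plane) p).symm (extChartAt 𝓘(ℝ, Plane) p p) ∈ U := by rwa [hinv]
  rw [← differential_self (hx.mdifferentiableAt hp)] at hv
  rw [← differential_self (hy.mdifferentiableAt (by simp))]
  refine fderiv_apply_eq_zero_of_zero_imp (hx.contDiffAt hu hpU)
    (ContMDiffAt.comp (g := y) _ (by rwa [hinv]) (contMDiffAt_chart_symm hu)).contDiffAt
    (by rw [hinv]; exact (hx.zero_iff p hp).2 hpZ) ?_ ?_ hv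
  · rw [differential_self (hx.mdifferentiableAt hp)]
    exact hx.regular p hp
  · filter_upwards [eventually_symm_mem hu (A := U ∩ {q | q ∈ Z → y q = 0})
      (by rw [hinv]; exact inter_mem (hx.isOpen.mem_nhds hp) h0)] with w hw hxw
    exact hw.2.2 ((hx.zero_iff _ hw.2.1).1 hxw)

/-- For a smooth field tangent to `Z`, the function `dx(X)` vanishes on `Z`, hence is `O(x)`. -/
theorem IsTangentAlong.isTangentTo {X : M → Plane} (hZ : IsHypersurface Plane Z)
    (hX : SmoothField X) (h : IsTangentAlong Z X) : IsTangentTo Z X := by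
  intro p hp
  obtain ⟨U, x, hpU, hx⟩ := hZ.exists_defining p hp
  have hu := mem_extChartAt_target (I := 𝓘(ℝ, Plane)) p
  have hinv := extChartAt_to_inv (I := 𝓘(ℝ, Plane)) p
  have hpU' : (extChartAt 𝓘(ℝ, Plane) p).symm (extChartAt 𝓘(ℝ, Plane) p p) ∈ U := by rwa [hinv]
  have hξ := hx.contDiffAt hu hpU'
  set ξ : Plane → ℝ := fun v => x ((extChartAt 𝓘(ℝ, Plane) p).symm v) with hξdef
  have hψ : ContDiffAt ℝ ∞ (fun v => fderiv ℝ ξ v (fieldInChart X p v))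
      (extChartAt 𝓘(ℝ, Plane) p p) :=
    (hξ.fderiv_right (by simp)).clm_apply
      ((hX p).contDiffAt ((isOpen_extChartAt_target p).mem_nhds hu))
  have hev := eventually_symm_mem hu (hx.isOpen.mem_nhds hpU')
  obtain ⟨C, hC⟩ := exists_abs_le_of_zero_imp hξ hψ
    (by rw [hξdef]; simp only [hinv]; exact (hx.zero_iff p hpU).2 hp)
    (by rw [differential_self (hx.mdifferentiableAt hpU)]; exact hx.regular p hpU) (by
      filter_upwards [hev] with v hv hv0
      rw [differential_apply_field X hv.1 (hx.mdifferentiableAt hv.2)]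
      exact h _ ((hx.zero_iff _ hv.2).1 hv0) U x hv.2 hx)
  have hs := mem_extChartAt_source (I := 𝓘(ℝ, Plane)) p
  refine ⟨_, (hx.isOpen.eventually_mem hpU).and
    ((continuousAt_extChartAt (I := 𝓘(ℝ, Plane)) p).eventually (hC.and hev) |>.and
      (eventually_chart_symm_chart hs)), x, C, fun q hq => ?_⟩
  obtain ⟨hqU, ⟨h1, h2⟩, h3⟩ := hq
  refine ⟨hx.mdifferentiableAt hqU, hx.zero_iff q hqU, ?_⟩
  rw [differential_apply_field X h2.1 (by rw [h3]; exact hx.mdifferentiableAt hqU)] at h1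
  simpa only [hξdef, h3] using h1

/-- The exterior derivative of a one-form on the plane, in coordinates. -/
theorem planeCoeff_extDeriv {a : Plane → Plane [⋀^Fin 1]→L[ℝ] ℝ} {u : Plane}
    (ha : DifferentiableAt ℝ a u) :
    planeCoeff (extDeriv a u) = fderiv ℝ (fun v => a v ![planeBasis 1]) u (planeBasis 0) -
      fderiv ℝ (fun v => a v ![planeBasis 0]) u (planeBasis 1) := by
  have h0 : Fin.removeNth 0 ![planeBasis 0, planeBasis 1] = ![planeBasis 1] := by
    ext i; fin_cases i; rfl
  have h1 : Fin.removeNth 1 ![planeBasis 0, planeBasis 1] = ![planeBasis 0] := by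
    ext i; fin_cases i; rfl
  rw [planeCoeff, extDeriv_apply ha, Fin.sum_univ_two, h0, h1]
  simp [sub_eq_add_neg]

/-- If `ι_X η = -α` and `dα = -θ η` off `Z`, then `θ` is the divergence of `X`. -/
theorem hasDivergence_of_contraction (hZ : IsClosed Z) {η : DForm Plane M 2} {α : DForm Plane M 1}
    {X : M → Plane} {θ : M → ℝ} (hη : SmoothFormOn η Zᶜ) (hX : SmoothField X)
    (hα : ∀ q ∉ Z, FormDifferentiableAt α q) (hXα : ∀ q ∉ Z, ∀ v, η q ![X q, v] = -α q ![v])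
    (hd : ∀ q ∉ Z, extDer α q = -θ q • η q) : HasDivergence Z η X θ := by
  intro c u hu huZ
  have ha : DifferentiableAt ℝ (inChart α c) u := by
    have := hα _ huZ c ((extChartAt 𝓘(ℝ, Plane) c).map_target hu)
    rwa [(extChartAt 𝓘(ℝ, Plane) c).right_inv hu] at this
  have hw := (contDiffAt_coeffInChart hZ hη hu huZ).differentiableAt (by simp)
  have hXc : DifferentiableAt ℝ (fieldInChart X c) u :=
    ((hX c).contDiffAt ((isOpen_extChartAt_target c).mem_nhds hu)).differentiableAt (by simp)
  have hXi : ∀ i : Fin 2, HasFDerivAt (fun v => fieldInChart X c v i)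
      ((EuclideanSpace.proj (𝕜 := ℝ) i).comp (fderiv ℝ (fieldInChart X c) u)) u := fun i =>
    (EuclideanSpace.proj (𝕜 := ℝ) i).hasFDerivAt.comp u hXc.hasFDerivAt
  have hcon : ∀ᶠ v in 𝓝 u, ∀ e : Plane,
      (fieldInChart X c v 0 * e 1 - fieldInChart X c v 1 * e 0) * coeffInChart η c v =
        -inChart α c v ![e] := by
    filter_upwards [eventually_symm_mem hu (hZ.isOpen_compl.mem_nhds huZ)] with v hv e
    have := hXα _ hv.2 (tangentMapAt Plane (extChartAt 𝓘(ℝ, Plane) c).symm v e)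
    rw [← inChart_apply_one, ← tangentMapAt_symm_fieldInChart X hv.1, ← inChart_apply_two,
      twoForm_apply] at this
    exact this
  have e1 : (fun v => inChart α c v ![planeBasis 1]) =ᶠ[𝓝 u] fun v =>
      -(fieldInChart X c v 0 * coeffInChart η c v) := by
    filter_upwards [hcon] with v hv
    have := hv (planeBasis 1)
    simp at this
    linarith
  have e0 : (fun v => inChart α c v ![planeBasis 0]) =ᶠ[𝓝 u] fun v =>
      fieldInChart X c v 1 * coeffInChart η c v := by
    filter_upwards [hcon] with v hv
    have := hv (planeBasis 0)
    simp at this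
    linarith
  have hext := planeCoeff_extDeriv ha
  rw [← inChart_extDer hu (hα _ huZ), inChart_eq_smul (hd _ huZ), planeCoeff_smul, e1.fderiv_eq,
    e0.fderiv_eq, (((hXi 0).fun_mul hw.hasFDerivAt).fun_neg).fderiv,
    ((hXi 1).fun_mul hw.hasFDerivAt).fderiv] at hext
  rw [plane_map (fderiv ℝ (coeffInChart η c) u) (fieldInChart X c u)]
  simp [planeTrace] at hext ⊢
  change -(_ * coeffInChart η c u) = _ at hext
  linarith

/-- Where `x = 0`, the form `dx ∧ f + x^m β` is a multiple of `dx`, so the field `X` that it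
determines is tangent to `Z`. -/
theorem differential_eq_zero_of_contraction (hm : 1 ≤ m) {U : Set M} {x : M → ℝ}
    (hx : IsLocalDefining Plane Z U x) {f : DForm Plane M 0} {β : DForm Plane M 1}
    {R : Plane [⋀^Fin 2]→L[ℝ] ℝ} (hR : planeCoeff R ≠ 0) {p : M} (hp : p ∈ U) (hpZ : p ∈ Z)
    {X : Plane} (hX : ∀ v, R ![X, v] = -clearedForm m x f β p ![v]) :
    differential Plane x p X = 0 := by
  have h1 : ∀ v, R ![X, v] = -(f p ![] * differential Plane x p v) := by
    intro v
    have := hX v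
    unfold clearedForm at this
    rw [pow_eq_zero_of_mem hx hm hp hpZ, zero_smul, add_zero, dWedge_apply_one] at this
    exact this
  have h2 := h1 X
  rw [twoForm_apply, mul_comm (X 0), sub_self, zero_mul] at h2
  by_cases hf : f p ![] = 0
  · have h3 : X = planeSolve (planeCoeff R) 0 := eq_planeSolve hR fun v => by
      rw [h1 v, hf, zero_mul]; rfl
    rw [h3]
    simp [planeSolve]
  · have := neg_eq_zero.1 h2.symm
    exact (mul_eq_zero.1 this).resolve_left hf

end BmForms

/-! ### Integrals depending smoothly on parameters -/

section ParametricIntegral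

open MeasureTheory

universe v

variable {E : Type v} [NormedAddCommGroup E] [NormedSpace ℝ E]
  {V : Type v} [NormedAddCommGroup V] [NormedSpace ℝ V]
  {B : Type*} [NormedAddCommGroup B] [NormedSpace ℝ B]
  {K : Type*} [TopologicalSpace K]

/-- The family `F k : E → V` of functions on `Ω` depends smoothly on the parameter `k` and on the
variable: locally it is a smooth function of `e k` and the variable, where `e` is a
continuous map into a normed space. -/
def IsSmoothFamily (B : Type*) [NormedAddCommGroup B] [NormedSpace ℝ B] (Ω : Set E)
    (F : K → E → V) : Prop :=
  ∀ k₀, ∀ u ∈ Ω, ∃ (e : K → B) (f : B × E → V), ContinuousAt e k₀ ∧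
    ContDiffAt ℝ ∞ f (e k₀, u) ∧ ∀ᶠ z in 𝓝 (k₀, u), F z.1 z.2 = f (e z.1, z.2)

namespace IsSmoothFamily

variable {Ω : Set E} {F : K → E → V}

theorem continuousAt (h : IsSmoothFamily B Ω F) {k : K} {u : E} (hu : u ∈ Ω) :
    ContinuousAt (fun z : K × E => F z.1 z.2) (k, u) := by
  obtain ⟨e, f, he, hf, hev⟩ := h k u hu
  refine ContinuousAt.congr ?_ (hev.mono fun z hz => hz.symm)
  exact ContinuousAt.comp (x := (k, u)) (f := fun z : K × E => (e z.1, z.2)) hf.continuousAt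
    ((he.comp continuousAt_fst).prodMk continuousAt_snd)

theorem continuous_left (h : IsSmoothFamily B Ω F) {u : E} (hu : u ∈ Ω) :
    Continuous fun k => F k u :=
  continuous_iff_continuousAt.2 fun k => (h.continuousAt hu (k := k)).comp
    (f := fun k => (k, u)) (by fun_prop)

theorem eventually_hasFDerivAt (h : IsSmoothFamily B Ω F) (k₀ : K) {u : E} (hu : u ∈ Ω) :
    ∃ (e : K → B) (f : B × E → E →L[ℝ] V), ContinuousAt e k₀ ∧ ContDiffAt ℝ ∞ f (e k₀, u) ∧
      ∀ᶠ z in 𝓝 (k₀, u), HasFDerivAt (F z.1) (f (e z.1, z.2)) z.2 := by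
  obtain ⟨e, f, he, hf, hev⟩ := h k₀ u hu
  have hcont : ContinuousAt (fun z : K × E => (e z.1, z.2)) (k₀, u) :=
    (he.comp continuousAt_fst).prodMk continuousAt_snd
  refine ⟨e, fun w => (fderiv ℝ f w).comp (ContinuousLinearMap.inr ℝ B E), he,
    (hf.fderiv_right (by simp)).clm_comp contDiffAt_const, ?_⟩
  have hd : ∀ᶠ w in 𝓝 (e k₀, u), DifferentiableAt ℝ f w :=
    ((hf.of_le (m := 1) (by simp)).eventually (by simp)).mono
      fun w hw => hw.differentiableAt (by simp)
  filter_upwards [hev.eventually_nhds, hcont.eventually hd] with z hz hdz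
  have h1 : F z.1 =ᶠ[𝓝 z.2] fun v => f (e z.1, v) :=
    ((Continuous.prodMk_right z.1).tendsto z.2).eventually hz
  refine HasFDerivAt.congr_of_eventuallyEq ?_ h1
  exact hdz.hasFDerivAt.comp z.2 (hasFDerivAt_prodMk_right (e z.1) z.2)

theorem differentiableAt (h : IsSmoothFamily B Ω F) (k : K) {u : E} (hu : u ∈ Ω) :
    DifferentiableAt ℝ (F k) u := by
  obtain ⟨e, f, -, -, hev⟩ := h.eventually_hasFDerivAt k hu
  exact hev.self_of_nhds.differentiableAt

theorem fderiv (h : IsSmoothFamily B Ω F) : IsSmoothFamily B Ω fun k => fderiv ℝ (F k) := by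
  intro k₀ u hu
  obtain ⟨e, f, he, hf, hev⟩ := h.eventually_hasFDerivAt k₀ hu
  exact ⟨e, f, he, hf, hev.mono fun z hz => hz.fderiv⟩

variable [CompactSpace K] [MeasurableSpace K] [OpensMeasurableSpace K] (μ : Measure K)
  [IsFiniteMeasure μ]

theorem integrable (h : IsSmoothFamily B Ω F) {u : E} (hu : u ∈ Ω) :
    Integrable (fun k => F k u) μ :=
  (h.continuous_left hu).integrable_of_hasCompactSupport (HasCompactSupport.of_compactSpace _)

/-- Differentiation under the integral sign. -/
theorem hasFDerivAt_integral (h : IsSmoothFamily B Ω F) (hΩ : IsOpen Ω) {u : E} (hu : u ∈ Ω) :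
    HasFDerivAt (fun u => ∫ k, F k u ∂μ) (∫ k, _root_.fderiv ℝ (F k) u ∂μ) u := by
  obtain ⟨C, hC⟩ := (isCompact_range (h.fderiv.continuous_left hu).norm).bddAbove
  have hbd : ∀ᶠ v in 𝓝 u, ∀ k ∈ (univ : Set K), v ∈ Ω ∧ ‖_root_.fderiv ℝ (F k) v‖ < C + 1 := by
    refine isCompact_univ.eventually_forall_of_forall_eventually fun k _ => ?_
    have h1 : ∀ᶠ z in 𝓝 (u, k), z.1 ∈ Ω := continuousAt_fst.eventually (hΩ.mem_nhds hu)
    have h2 := (h.fderiv.continuousAt hu (k := k)).norm.eventually_lt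
      (continuousAt_const (y := C + 1)) (by
        have := hC (mem_range_self k)
        simp only at this ⊢
        linarith)
    exact h1.and (((continuous_swap (X := E) (Y := K)).tendsto (u, k)).eventually h2)
  obtain ⟨s, hs, hsb⟩ := hbd.exists_mem
  have hint := h.integrable μ hu
  refine (hasFDerivAt_integral_of_dominated_of_fderiv_le (bound := fun _ => C + 1)
    (F' := fun v k => _root_.fderiv ℝ (F k) v) hs ?_ hint
    (h.fderiv.integrable μ hu).aestronglyMeasurable ?_ (integrable_const _) ?_)
  · filter_upwards [hs] with v hv
    rcases isEmpty_or_nonempty K with hK | hK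
    · exact (continuous_of_discreteTopology.stronglyMeasurable).aestronglyMeasurable
    · exact (h.integrable μ (hsb v hv hK.some trivial).1).aestronglyMeasurable
  · exact Eventually.of_forall fun k v hv => (hsb v hv k trivial).2.le
  · exact Eventually.of_forall fun k v hv =>
      (h.differentiableAt k (hsb v hv k trivial).1).hasFDerivAt

/-- The integral of a smooth family is smooth. By differentiation under the integral sign, induction
on the order of differentiability applies to the family of derivatives. -/
theorem contDiffOn_integral (h : IsSmoothFamily B Ω F) (hΩ : IsOpen Ω) :
    ContDiffOn ℝ ∞ (fun u => ∫ k, F k u ∂μ) Ω := by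
  rw [contDiffOn_infty]
  intro n
  induction n generalizing V with
  | zero =>
    exact contDiffOn_zero.2 fun u hu =>
      (h.hasFDerivAt_integral μ hΩ hu).continuousAt.continuousWithinAt
  | succ n ih =>
    push_cast
    rw [contDiffOn_succ_iff_fderiv_of_isOpen hΩ]
    refine ⟨fun u hu => (h.hasFDerivAt_integral μ hΩ hu).differentiableAt.differentiableWithinAt,
      by simp, ?_⟩
    exact (ih h.fderiv).congr fun u hu => (h.hasFDerivAt_integral μ hΩ hu).fderiv

end IsSmoothFamily

end ParametricIntegral

/-! ### Averaging a vector field over a compact group -/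

section Averaging

open MeasureTheory

variable {M : Type*} [TopologicalSpace M] [ChartedSpace Plane M] [IsManifold 𝓘(ℝ, Plane) ∞ M]
  {F : Type*} [NormedAddCommGroup F] [NormedSpace ℝ F]
  {G : Type*} [Group G] [TopologicalSpace G] [ChartedSpace F G] [LieGroup 𝓘(ℝ, F) ∞ G]
  [MulAction G M] [ContMDiffSMul 𝓘(ℝ, F) 𝓘(ℝ, Plane) ∞ G M]

/-- The image of the vector field `X` under the action of `g`. -/
def translateField (g : G) (X : M → Plane) (p : M) : Plane :=
  tangentMapAt Plane (fun q : M => g • q) (g⁻¹ • p) (X (g⁻¹ • p))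

theorem tangentMapAt_smul_apply (g : G) (X : M → Plane) (p : M) :
    tangentMapAt Plane (fun q : M => g • q) p (X p) = translateField g X (g • p) := by
  rw [translateField, inv_smul_smul]

variable (F)
-- `F` occurs in the lemmas only through the manifold structure of `G`
include F

theorem contMDiff_smul_left (g : G) :
    ContMDiff 𝓘(ℝ, Plane) 𝓘(ℝ, Plane) ∞ (fun q : M => g • q) :=
  ContMDiff.smul (I := 𝓘(ℝ, F)) contMDiff_const contMDiff_id

theorem mdifferentiable_smul_left (g : G) :
    MDifferentiable 𝓘(ℝ, Plane) 𝓘(ℝ, Plane) (fun q : M => g • q) :=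
  (contMDiff_smul_left F g).mdifferentiable (by simp)

theorem tangentMapAt_smul_comp (g h : G) (p : M) :
    (tangentMapAt Plane (fun q : M => g • q) (h • p)).comp
      (tangentMapAt Plane (fun q : M => h • q) p) =
      tangentMapAt Plane (fun q : M => (g * h) • q) p := by
  rw [← tangentMapAt_comp (f := fun q : M => h • q) (mdifferentiable_smul_left F g _)
    (mdifferentiable_smul_left F h p)]
  simp only [mul_smul]

theorem tangentMapAt_smul_translateField (g h : G) (X : M → Plane) (p : M) :
    tangentMapAt Plane (fun q : M => h • q) p (translateField g X p) =
      translateField (h * g) X (h • p) := by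
  have h1 := tangentMapAt_smul_comp F h g (g⁻¹ • p)
  rw [smul_inv_smul] at h1
  have h2 : (h * g)⁻¹ • h • p = g⁻¹ • p := by rw [smul_smul]; congr 1; group
  rw [translateField, translateField, h2, ← h1]
  rfl

/-- The translates `g X` depend smoothly on `g` and the point: near `(g₀, u₀)`, in charts, `g X` is
the derivative of the action at `g⁻¹ u` applied to `X (g⁻¹ u)`. -/
theorem isSmoothFamily_translateField {X : M → Plane} (hX : SmoothField X) (c : M) :
    IsSmoothFamily F (extChartAt 𝓘(ℝ, Plane) c).target
      (fun g : G => fieldInChart (translateField g X) c) := by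
  intro g₀ u₀ hu₀
  set q := g₀⁻¹ • (extChartAt 𝓘(ℝ, Plane) c).symm u₀ with hq
  set e := extChartAt 𝓘(ℝ, F) g₀ with he
  set c' := extChartAt 𝓘(ℝ, Plane) q with hc'
  set cc := extChartAt 𝓘(ℝ, Plane) c with hcc
  have hg₀ : e g₀ ∈ e.target := mem_extChartAt_target g₀
  have hg₀' : e.symm (e g₀) = g₀ := extChartAt_to_inv g₀
  have hqs : q ∈ c'.source := mem_extChartAt_source q
  have hqt : c' q ∈ c'.target := mem_extChartAt_target q
  have hqi : c'.symm (c' q) = q := extChartAt_to_inv q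
  have hGm : IsManifold 𝓘(ℝ, F) ∞ G := inferInstance
  set Ψ : F × Plane → Plane := fun z => cc (e.symm z.1 • c'.symm z.2) with hΨ
  set Θ : F × Plane → Plane := fun z => c' ((e.symm z.1)⁻¹ • cc.symm z.2) with hΘ
  have hΘ₀ : Θ (e g₀, u₀) = c' q := by simp only [hΘ, hg₀', hq]
  have hΨd : ContDiffAt ℝ ∞ Ψ (e g₀, c' q) := by
    have h1 : ContMDiffAt 𝓘(ℝ, F × Plane) 𝓘(ℝ, F) ∞ (fun z : F × Plane => e.symm z.1)
        (e g₀, c' q) :=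
      ContMDiffAt.comp (e g₀, c' q) (g := e.symm) (contMDiffAt_chart_symm hg₀)
        contDiffAt_fst.contMDiffAt
    have h2 : ContMDiffAt 𝓘(ℝ, F × Plane) 𝓘(ℝ, Plane) ∞ (fun z : F × Plane => c'.symm z.2)
        (e g₀, c' q) :=
      ContMDiffAt.comp (e g₀, c' q) (g := c'.symm) (contMDiffAt_chart_symm hqt)
        contDiffAt_snd.contMDiffAt
    have h3 := ContMDiffAt.smul h1 h2
    refine (ContMDiffAt.comp (e g₀, c' q) (g := cc) (contMDiffAt_chart ?_) h3).contDiffAt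
    change e.symm (e g₀) • c'.symm (c' q) ∈ cc.source
    rw [hg₀', hqi, hq, smul_inv_smul]
    exact cc.map_target hu₀
  have hΘd : ContDiffAt ℝ ∞ Θ (e g₀, u₀) := by
    have h1 : ContMDiffAt 𝓘(ℝ, F × Plane) 𝓘(ℝ, F) ∞ (fun z : F × Plane => e.symm z.1)
        (e g₀, u₀) :=
      ContMDiffAt.comp (e g₀, u₀) (g := e.symm) (contMDiffAt_chart_symm hg₀)
        contDiffAt_fst.contMDiffAt
    have h2 : ContMDiffAt 𝓘(ℝ, F × Plane) 𝓘(ℝ, Plane) ∞ (fun z : F × Plane => cc.symm z.2)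
        (e g₀, u₀) :=
      ContMDiffAt.comp (e g₀, u₀) (g := cc.symm) (contMDiffAt_chart_symm hu₀)
        contDiffAt_snd.contMDiffAt
    have h3 := ContMDiffAt.smul h1.inv h2
    refine (ContMDiffAt.comp (e g₀, u₀) (g := c') (contMDiffAt_chart ?_) h3).contDiffAt
    change (e.symm (e g₀))⁻¹ • cc.symm u₀ ∈ c'.source
    rw [hg₀']
    exact hqs
  refine ⟨e, fun z => ((fderiv ℝ Ψ (z.1, Θ z)).comp (ContinuousLinearMap.inr ℝ F Plane))
    (fieldInChart X q (Θ z)), continuousAt_extChartAt g₀, ?_, ?_⟩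
  · have h1 : ContDiffAt ℝ ∞ (fun z : F × Plane => fderiv ℝ Ψ (z.1, Θ z)) (e g₀, u₀) :=
      ContDiffAt.comp (e g₀, u₀) (g := fderiv ℝ Ψ)
        (by simp only [hΘ₀]; exact hΨd.fderiv_right (by simp)) (contDiffAt_fst.prodMk hΘd)
    have h2 : ContDiffAt ℝ ∞ (fun z : F × Plane => fieldInChart X q (Θ z)) (e g₀, u₀) :=
      ContDiffAt.comp (e g₀, u₀) (g := fieldInChart X q)
        (by rw [hΘ₀]; exact (hX q).contDiffAt ((isOpen_extChartAt_target q).mem_nhds hqt)) hΘd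
    exact (h1.clm_comp contDiffAt_const).clm_apply h2
  · have hec : ContinuousAt (fun z : G × Plane => (e z.1, z.2)) (g₀, u₀) :=
      ((continuousAt_extChartAt (I := 𝓘(ℝ, F)) g₀).comp continuousAt_fst).prodMk continuousAt_snd
    have hΘc : ContinuousAt (fun z : G × Plane => (e z.1, Θ (e z.1, z.2))) (g₀, u₀) :=
      (continuousAt_fst.comp hec).prodMk
        (ContinuousAt.comp (x := (g₀, u₀)) (f := fun z : G × Plane => (e z.1, z.2))
          hΘd.continuousAt hec)
    have hd : ∀ᶠ w in 𝓝 (e g₀, c' q), DifferentiableAt ℝ Ψ w :=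
      ((hΨd.of_le (m := 1) (by simp)).eventually (by simp)).mono
        fun w hw => hw.differentiableAt (by simp)
    have hd' := hΘc.eventually (by simp only [hΘ₀]; exact hd)
    have hs1 : ∀ᶠ z : G × Plane in 𝓝 (g₀, u₀), z.1 ∈ e.source :=
      continuousAt_fst.eventually ((isOpen_extChartAt_source g₀).mem_nhds (mem_extChartAt_source g₀))
    have hs2 : ∀ᶠ z : G × Plane in 𝓝 (g₀, u₀), z.2 ∈ cc.target :=
      continuousAt_snd.eventually ((isOpen_extChartAt_target c).mem_nhds hu₀)
    have hs3 : ∀ᶠ z : G × Plane in 𝓝 (g₀, u₀), z.1⁻¹ • cc.symm z.2 ∈ c'.source := by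
      have hsm : ContinuousAt (fun z : G × Plane => (e.symm (e z.1))⁻¹ • cc.symm z.2) (g₀, u₀) := by
        have h1 : ContMDiffAt 𝓘(ℝ, F × Plane) 𝓘(ℝ, F) ∞ (fun z : F × Plane => e.symm z.1)
            (e g₀, u₀) :=
          ContMDiffAt.comp (e g₀, u₀) (g := e.symm) (contMDiffAt_chart_symm hg₀)
            contDiffAt_fst.contMDiffAt
        have h2 : ContMDiffAt 𝓘(ℝ, F × Plane) 𝓘(ℝ, Plane) ∞ (fun z : F × Plane => cc.symm z.2)
            (e g₀, u₀) :=
          ContMDiffAt.comp (e g₀, u₀) (g := cc.symm) (contMDiffAt_chart_symm hu₀)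
            contDiffAt_snd.contMDiffAt
        exact ContinuousAt.comp (x := (g₀, u₀)) (f := fun z : G × Plane => (e z.1, z.2))
          (ContMDiffAt.smul h1.inv h2).continuousAt hec
      have h4 := hsm.eventually ((isOpen_extChartAt_source (I := 𝓘(ℝ, Plane)) q).mem_nhds
        (by simp only [hg₀', ← hq]; exact hqs))
      filter_upwards [h4, hs1] with z hz hz1
      rwa [e.left_inv hz1] at hz
    filter_upwards [hs1, hs2, hs3, hd'] with z h1 h2 h3 h4
    set g := z.1 with hg
    have hgi : e.symm (e g) = g := e.left_inv h1
    set v := Θ (e g, z.2) with hv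
    have hv' : v = c' (g⁻¹ • cc.symm z.2) := by simp only [hv, hΘ, hgi]
    have hvt : v ∈ c'.target := by rw [hv']; exact c'.map_source h3
    have hvi : c'.symm v = g⁻¹ • cc.symm z.2 := by rw [hv', c'.left_inv h3]
    have hmap : mapInCharts Plane (fun q : M => g • q) q c = fun w => Ψ (e g, w) := by
      funext w; simp only [mapInCharts, hΨ, hgi, hcc, hc']
    have hgv : g • c'.symm v = cc.symm z.2 := by rw [hvi, smul_inv_smul]
    have key := fderiv_mapInCharts_fieldInChart (f := fun q : M => g • q) (X := X)
      (Y := translateField g X) (c := q) (c' := c) (u := v) hvt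
      (mdifferentiable_smul_left F g _) (by
        change g • c'.symm v ∈ cc.source
        rw [hgv]; exact cc.map_target h2) (tangentMapAt_smul_apply g X _)
    have hval : mapInCharts Plane (fun q : M => g • q) q c v = z.2 := by
      change cc (g • c'.symm v) = z.2
      rw [hgv, cc.right_inv h2]
    have hder : HasFDerivAt (fun w => Ψ (e g, w)) ((fderiv ℝ Ψ (e g, v)).comp
        (ContinuousLinearMap.inr ℝ F Plane)) v :=
      h4.hasFDerivAt.comp v (hasFDerivAt_prodMk_right (e g) v)
    rw [hval, hmap, hder.fderiv] at key
    exact key.symm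

theorem smoothField_translateField {X : M → Plane} (hX : SmoothField X) (g : G) :
    SmoothField (translateField g X) := by
  intro c u hu
  obtain ⟨e, f, -, hf, hev⟩ := isSmoothFamily_translateField (F := F) hX c g u hu
  have h1 : fieldInChart (translateField g X) c =ᶠ[𝓝 u] fun v => f (e g, v) :=
    ((Continuous.prodMk_right g).tendsto u).eventually hev
  exact ((ContDiffAt.comp u (f := fun v => (e g, v)) hf
    (contDiffAt_const.prodMk contDiffAt_id)).congr_of_eventuallyEq h1).contDiffWithinAt

variable [CompactSpace G] [MeasurableSpace G] [BorelSpace G] (μ : Measure G)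
  [IsProbabilityMeasure μ]

/-- The average of the images of `X` under the elements of the group. -/
def averageField (X : M → Plane) (p : M) : Plane := ∫ g, translateField g X p ∂μ

theorem integrable_translateField {X : M → Plane} (hX : SmoothField X) (p : M) :
    Integrable (fun g : G => translateField g X p) μ := by
  have h := (isSmoothFamily_translateField (F := F) (G := G) hX p).integrable μ
    (mem_extChartAt_target (I := 𝓘(ℝ, Plane)) p)
  simpa only [fieldInChart_self] using h

theorem fieldInChart_averageField {X : M → Plane} (hX : SmoothField X) (c : M) :
    fieldInChart (averageField μ X) c = fun u => ∫ g, fieldInChart (translateField g X) c u ∂μ := by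
  funext u
  exact (ContinuousLinearMap.integral_comp_comm _ (integrable_translateField F μ hX _)).symm

theorem smoothField_averageField {X : M → Plane} (hX : SmoothField X) :
    SmoothField (averageField μ X) := by
  intro c
  rw [fieldInChart_averageField F μ hX]
  exact (isSmoothFamily_translateField (F := F) hX c).contDiffOn_integral μ
    (isOpen_extChartAt_target c)

/-- The average is invariant, because Haar measure is. -/
theorem tangentMapAt_averageField [IsTopologicalGroup G] [μ.IsMulLeftInvariant] {X : M → Plane}
    (hX : SmoothField X) (h : G) (p : M) :
    tangentMapAt Plane (fun q : M => h • q) p (averageField μ X p) = averageField μ X (h • p) := by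
  unfold averageField
  rw [← ContinuousLinearMap.integral_comp_comm _ (integrable_translateField F μ hX p)]
  simp only [tangentMapAt_smul_translateField F]
  exact integral_mul_left_eq_self (fun g => translateField g X (h • p)) h

/-- The divergence is linear in the field, so it commutes with averaging. -/
theorem hasDivergence_averageField {Z : Set M} {η : DForm Plane M 2} {X : M → Plane}
    (hX : SmoothField X) {θ : M → ℝ}
    (hdiv : ∀ g : G, HasDivergence Z η (translateField g X) θ) :
    HasDivergence Z η (averageField μ X) θ := by
  intro c u hu huZ
  have hS := isSmoothFamily_translateField (F := F) (G := G) hX c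
  have hder := hS.hasFDerivAt_integral μ (isOpen_extChartAt_target c) hu
  have hi := hS.integrable μ hu
  have hi' := hS.fderiv.integrable μ hu
  rw [fieldInChart_averageField F μ hX, hder.fderiv]
  set T : (Plane →L[ℝ] Plane) →L[ℝ] ℝ :=
    (EuclideanSpace.proj (𝕜 := ℝ) 0).comp (ContinuousLinearMap.apply ℝ Plane (planeBasis 0)) +
    (EuclideanSpace.proj (𝕜 := ℝ) 1).comp (ContinuousLinearMap.apply ℝ Plane (planeBasis 1))
  have hT : ∀ A, planeTrace A = T A := fun A => rfl
  rw [hT, ← ContinuousLinearMap.integral_comp_comm _ hi, ← ContinuousLinearMap.integral_comp_comm _ hi',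
    ← integral_const_mul, ← integral_add (ContinuousLinearMap.integrable_comp _ hi)
      ((ContinuousLinearMap.integrable_comp _ hi').const_mul _)]
  rw [integral_congr_ae (μ := μ)
    (g := fun _ => θ ((extChartAt 𝓘(ℝ, Plane) c).symm u) * coeffInChart η c u)
    (Eventually.of_forall fun g => by simp only [← hT]; exact hdiv g c u hu huZ)]
  simp

/-- Tangency is linear in the field, so it is inherited by the average. -/
theorem isTangentAlong_averageField {Z : Set M} {X : M → Plane} (hX : SmoothField X)
    (h : ∀ g : G, IsTangentAlong Z (translateField g X)) : IsTangentAlong Z (averageField μ X) := by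
  intro p hp U x hpU hx
  unfold averageField
  rw [← ContinuousLinearMap.integral_comp_comm _ (integrable_translateField F μ hX p)]
  simp only [h _ p hp U x hpU hx, integral_zero]

/-- An element of `G` that preserves `Z` maps tangent fields to tangent fields. -/
theorem isTangentAlong_translateField {Z : Set M} (hZ : IsHypersurface Plane Z) {X : M → Plane}
    (h : IsTangentAlong Z X) {g : G} (hg : ∀ p : M, g • p ∈ Z ↔ p ∈ Z) :
    IsTangentAlong Z (translateField g X) := by
  intro p hp U x hpU hx
  set q := g⁻¹ • p with hq
  have hgq : g • q = p := smul_inv_smul g p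
  have hqZ : q ∈ Z := by rw [← hg, hgq]; exact hp
  obtain ⟨V, y, hqV, hy⟩ := hZ.exists_defining q hqZ
  have hcont := contMDiff_smul_left F (M := M) g
  have h1 : ContMDiffAt 𝓘(ℝ, Plane) 𝓘(ℝ, ℝ) ∞ (fun q : M => x (g • q)) q :=
    ContMDiffAt.comp q (by rw [hgq]; exact hx.contMDiffAt hpU) (hcont q)
  have h2 := hy.differential_eq_zero hqV hqZ h1 (by
    filter_upwards [hcont.continuous.continuousAt.eventually
      (hx.isOpen.mem_nhds (by change g • q ∈ U; rw [hgq]; exact hpU))] with q' hq' hqZ'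
    exact (hx.zero_iff _ hq').2 ((hg q').2 hqZ')) (h q hqZ V y hqV hy)
  have h3 : differential Plane (fun q : M => x (g • q)) q =
      (differential Plane x (g • q)).comp (tangentMapAt Plane (fun q : M => g • q) q) :=
    mfderiv_comp q (by rw [hgq]; exact hx.mdifferentiableAt hpU) (mdifferentiable_smul_left F g q)
  rw [h3, hgq] at h2
  exact h2

/-- Translates of `X` have the same divergence: `g X` is to the translate of `α` what `X` is to `α`.
It does not matter that the translate of `α` need not be a `b^m`-form, as the equation is one on the
complement of `Z`. -/
theorem hasDivergence_translateField {Z : Set M} (hZ : IsClosed Z) {η : DForm Plane M 2}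
    {α : DForm Plane M 1} {X : M → Plane} {θ : M → ℝ} (hη : SmoothFormOn η Zᶜ)
    (hX : SmoothField X) (hα : ∀ q ∉ Z, FormDifferentiableAt α q)
    (hXα : ∀ q ∉ Z, ∀ v, η q ![X q, v] = -α q ![v])
    (hd : ∀ q ∉ Z, extDer α q = -θ q • η q) (hinv : IsInvariant G Z η)
    (hθ : ∀ (g : G) p, θ (g • p) = θ p) (g : G) : HasDivergence Z η (translateField g X) θ := by
  have hf := contMDiff_smul_left F (M := M) g⁻¹
  have hdf := fun q => FormDifferentiableAt.pullback (f := fun q : M => g⁻¹ • q) (η := α) (p := q)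
    (Eventually.of_forall hf)
  refine hasDivergence_of_contraction (α := pullback (fun q : M => g⁻¹ • q) α) hZ hη
    (smoothField_translateField (F := F) hX g)
    (fun q hq => hdf q (hα _ (((hinv g⁻¹).1 q).not.2 hq))) (fun q hq v => ?_) fun q hq => ?_
  · have hq' : g⁻¹ • q ∉ Z := ((hinv g⁻¹).1 q).not.2 hq
    have h1 : tangentMapAt Plane (fun q : M => g⁻¹ • q) q (translateField g X q) = X (g⁻¹ • q) := by
      rw [tangentMapAt_smul_translateField F, inv_mul_cancel, translateField]
      simp only [one_smul, inv_one]
      rw [tangentMapAt_id]; rfl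
    have h2 := hXα _ hq' (tangentMapAt Plane (fun q : M => g⁻¹ • q) q v)
    rw [← (hinv g⁻¹).2 q hq]
    unfold pullback
    rw [ContinuousAlternatingMap.compContinuousLinearMap_apply,
      ContinuousAlternatingMap.compContinuousLinearMap_apply]
    rw [← h1] at h2
    convert h2 using 2
    · ext i; fin_cases i <;> rfl
    · congr 1; ext i; fin_cases i; rfl
  · have hq' : g⁻¹ • q ∉ Z := ((hinv g⁻¹).1 q).not.2 hq
    rw [extDer_pullback (Eventually.of_forall hf) (hα _ hq')]
    conv_rhs => rw [← (hinv g⁻¹).2 q hq, ← hθ g⁻¹ q]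
    unfold pullback
    rw [hd _ hq']
    rfl

end Averaging

/-! ### Positivity of the quotient of the two area forms -/

section Positivity

variable {M : Type*} [TopologicalSpace M] [ChartedSpace Plane M] [IsManifold 𝓘(ℝ, Plane) ∞ M]
  {m : ℕ} {Z : Set M} {r : M → ℝ}

theorem inChart_apply_zero (f : DForm Plane M 0) (c : M) (u : Plane) :
    inChart f c u ![] = f ((extChartAt 𝓘(ℝ, Plane) c).symm u) ![] := by
  unfold inChart pullback
  rw [ContinuousAlternatingMap.compContinuousLinearMap_apply]
  congr 1; ext i; exact i.elim0

theorem SmoothFormOn.contDiffAt_function {f : DForm Plane M 0} {U : Set M} (h : SmoothFormOn f U)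
    {c : M} {u : Plane} (hu : u ∈ (extChartAt 𝓘(ℝ, Plane) c).target)
    (hU : U ∈ 𝓝 ((extChartAt 𝓘(ℝ, Plane) c).symm u)) :
    ContDiffAt ℝ ∞ (fun v => f ((extChartAt 𝓘(ℝ, Plane) c).symm v) ![]) u := by
  simp only [← inChart_apply_zero]
  exact (ContinuousAlternatingMap.apply ℝ Plane ℝ ![]).contDiff.contDiffAt.comp u
    (h.contDiffAt hu hU)

theorem SmoothFormOn.continuousAt_function {f : DForm Plane M 0} {U : Set M}
    (h : SmoothFormOn f U) {p : M} (hU : U ∈ 𝓝 p) : ContinuousAt (fun q => f q ![]) p := by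
  have hu := mem_extChartAt_target (I := 𝓘(ℝ, Plane)) p
  have h1 := (h.contDiffAt_function hu (by rwa [extChartAt_to_inv])).continuousAt
  refine (h1.comp (continuousAt_extChartAt (I := 𝓘(ℝ, Plane)) p)).congr ?_
  filter_upwards [eventually_chart_symm_chart (mem_extChartAt_source (I := 𝓘(ℝ, Plane)) p)] with q hq
  simp only [Function.comp_apply, hq]

/-- The exterior derivative of `(ξ ^ m)⁻¹ f dξ + b`: the derivative of `(ξ ^ m)⁻¹` does not
contribute, being a multiple of `dξ`. -/
theorem planeCoeff_extDeriv_of_singular {a b : Plane → Plane [⋀^Fin 1]→L[ℝ] ℝ} {ξ f : Plane → ℝ}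
    {u : Plane} (hξ : ContDiffAt ℝ ∞ ξ u) (hf : DifferentiableAt ℝ f u) (hb : DifferentiableAt ℝ b u)
    (ha : DifferentiableAt ℝ a u) (hξ0 : ξ u ≠ 0)
    (hev : ∀ᶠ v in 𝓝 u, ∀ e : Plane, a v ![e] = (ξ v ^ m)⁻¹ * f v * fderiv ℝ ξ v e + b v ![e]) :
    ξ u ^ m * planeCoeff (extDeriv a u) =
      fderiv ℝ f u (planeBasis 0) * fderiv ℝ ξ u (planeBasis 1) -
        fderiv ℝ f u (planeBasis 1) * fderiv ℝ ξ u (planeBasis 0) +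
        ξ u ^ m * planeCoeff (extDeriv b u) := by
  have hpow : ξ u ^ m ≠ 0 := pow_ne_zero _ hξ0
  obtain ⟨s, hs⟩ : ∃ s, HasDerivAt (fun t : ℝ => (t ^ m)⁻¹) s (ξ u) :=
    ⟨_, ((hasDerivAt_pow m (ξ u)).inv hpow)⟩
  have hg : HasFDerivAt (fun v => (ξ v ^ m)⁻¹) (s • fderiv ℝ ξ u) u :=
    hs.comp_hasFDerivAt u (hξ.differentiableAt (by simp)).hasFDerivAt
  have hk := hg.fun_mul hf.hasFDerivAt
  have hL : DifferentiableAt ℝ (fderiv ℝ ξ) u :=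
    (hξ.fderiv_right (m := ∞) (by simp)).differentiableAt (by simp)
  have hLe : ∀ e, HasFDerivAt (fun v => fderiv ℝ ξ v e) ((fderiv ℝ (fderiv ℝ ξ) u).flip e) u := by
    intro e
    have := hL.hasFDerivAt.clm_apply (hasFDerivAt_const e u)
    simpa using this
  have hbe : ∀ e : Plane, DifferentiableAt ℝ (fun v => b v ![e]) u := fun e =>
    (ContinuousAlternatingMap.apply ℝ Plane ℝ ![e]).differentiableAt.comp u hb
  have hae : ∀ e : Plane, fderiv ℝ (fun v => a v ![e]) u = _ := fun e =>
    (EventuallyEq.fderiv_eq (hev.mono fun v hv => hv e)).trans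
      ((hk.fun_mul (hLe e)).fun_add (hbe e).hasFDerivAt).fderiv
  have hsymm := (hξ.isSymmSndFDerivAt (by
    rw [minSmoothness_of_isRCLikeNormedField]; exact ENat.LEInfty.out)).eq (planeBasis 0) (planeBasis 1)
  rw [planeCoeff_extDeriv ha, planeCoeff_extDeriv hb, hae, hae]
  simp only [_root_.add_apply, _root_.smul_apply, ContinuousLinearMap.flip_apply, smul_eq_mul]
  rw [hsymm]
  field_simp
  ring

variable {ω₀ ω₁ : DForm Plane M 2} {α : DForm Plane M 1} {U : Set M} {x : M → ℝ}
  {α₀ α₁ : DForm Plane M 1} {β₀ β₁ : DForm Plane M 2} {f : DForm Plane M 0} {β : DForm Plane M 1}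

/-- If `ω₁ - ω₀ = dα` with `α = f dx / x^m + β`, then the leading coefficients of `ω₀` and `ω₁`
differ on `Z` by the coefficient of `df ∧ dx`. -/
theorem planeCoeff_sub_planeCoeff_eq (hZ : IsHypersurface Plane Z) (hm : 1 ≤ m)
    (d₀ : IsBmDecomposition m Z r ω₀ U x α₀ β₀) (d₁ : IsBmDecomposition m Z r ω₁ U x α₁ β₁)
    (d : IsBmDecomposition m Z r α U x f β) (hα : ∀ q ∉ Z, FormDifferentiableAt α q)
    (hd : ∀ q ∉ Z, ω₁ q - ω₀ q = extDer α q) {p : M} (hp : p ∈ U) (hpZ : p ∈ Z) :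
    planeCoeff (clearedForm m x α₁ β₁ p) - planeCoeff (clearedForm m x α₀ β₀ p) =
      fderiv ℝ (fun v => f ((extChartAt 𝓘(ℝ, Plane) p).symm v) ![]) (extChartAt 𝓘(ℝ, Plane) p p)
          (planeBasis 0) *
        fderiv ℝ (fun v => x ((extChartAt 𝓘(ℝ, Plane) p).symm v)) (extChartAt 𝓘(ℝ, Plane) p p)
          (planeBasis 1) -
      fderiv ℝ (fun v => f ((extChartAt 𝓘(ℝ, Plane) p).symm v) ![]) (extChartAt 𝓘(ℝ, Plane) p p)
          (planeBasis 1) *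
        fderiv ℝ (fun v => x ((extChartAt 𝓘(ℝ, Plane) p).symm v)) (extChartAt 𝓘(ℝ, Plane) p p)
          (planeBasis 0) := by
  have hu := mem_extChartAt_target (I := 𝓘(ℝ, Plane)) p
  have hinv := extChartAt_to_inv (I := 𝓘(ℝ, Plane)) p
  set u₀ := extChartAt 𝓘(ℝ, Plane) p p with hu₀
  set σ := (extChartAt 𝓘(ℝ, Plane) p).symm with hσ
  set ξ : Plane → ℝ := fun v => x (σ v) with hξdef
  set φ : Plane → ℝ := fun v => f (σ v) ![] with hφdef
  have hUn : U ∈ 𝓝 (σ u₀) := by rw [hinv]; exact d.defining.isOpen.mem_nhds hp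
  have hpU : σ u₀ ∈ U := by rwa [hinv]
  have hξ := d.defining.contDiffAt hu hpU
  have hφ := d.smooth_left.contDiffAt_function hu hUn
  have hb := d.smooth_right.contDiffAt hu hUn
  have c0 := ((smoothFormOn_clearedForm (m := m) d₀.defining d₀.smooth_left
    d₀.smooth_right).contDiffAt_coeff hu hUn).continuousAt
  have c1 := ((smoothFormOn_clearedForm (m := m) d₁.defining d₁.smooth_left
    d₁.smooth_right).contDiffAt_coeff hu hUn).continuousAt
  have dφ : ∀ e, ContinuousAt (fun v => fderiv ℝ φ v e) u₀ := fun e =>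
    ((hφ.fderiv_right (m := 0) (by simp)).clm_apply contDiffAt_const).continuousAt
  have dξ : ∀ e, ContinuousAt (fun v => fderiv ℝ ξ v e) u₀ := fun e =>
    ((hξ.fderiv_right (m := 0) (by simp)).clm_apply contDiffAt_const).continuousAt
  have cb : ∀ e e', ContinuousAt (fun v => fderiv ℝ (fun w => inChart β p w ![e]) v e') u₀ :=
    fun e e' => (((d.smooth_right.contDiffAt_apply hu hUn e).fderiv_right (m := 0)
      (by simp)).clm_apply contDiffAt_const).continuousAt
  have key := eq_of_frequently (hZ.frequently_symm_notMem hu) (c1.sub c0)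
    ((((dφ (planeBasis 0)).mul (dξ (planeBasis 1))).sub
      ((dφ (planeBasis 1)).mul (dξ (planeBasis 0)))).add
      ((hξ.continuousAt.pow m).mul ((cb (planeBasis 1) (planeBasis 0)).sub
        (cb (planeBasis 0) (planeBasis 1))))) (by
    filter_upwards [eventually_symm_mem hu hUn] with v hv hvZ
    have hUv : U ∈ 𝓝 (σ v) := d.defining.isOpen.mem_nhds hv.2
    have hξv := d.defining.contDiffAt hv.1 hv.2
    have hφv := (d.smooth_left.contDiffAt_function hv.1 hUv).differentiableAt (by simp)
    have hbv := (d.smooth_right.contDiffAt hv.1 hUv).differentiableAt (by simp)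
    have hav : DifferentiableAt ℝ (inChart α p) v := by
      have := hα _ hvZ p ((extChartAt 𝓘(ℝ, Plane) p).map_target hv.1)
      rwa [(extChartAt 𝓘(ℝ, Plane) p).right_inv hv.1] at this
    have hξ0 : ξ v ≠ 0 := fun h0 => hvZ ((d.defining.zero_iff _ hv.2).1 h0)
    have hsing := planeCoeff_extDeriv_of_singular (m := m) hξv hφv hbv hav hξ0 (by
      filter_upwards [eventually_symm_mem hv.1 (inter_mem hUv
        (hZ.isClosed.isOpen_compl.mem_nhds hvZ))] with w hw e
      rw [inChart_apply_one, d.eq _ hw.2, inChart_apply_one, differential_comp_symm hw.1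
        (d.defining.mdifferentiableAt hw.2.1)]
      change _ * dWedge x f _ _ + β _ ![_] = _
      rw [dWedge_apply_one]
      simp only [ContinuousLinearMap.comp_apply]
      ring)
    rw [← inChart_extDer hv.1 (hα _ hvZ), planeCoeff_extDeriv hbv] at hsing
    simp only [Pi.sub_apply, Pi.mul_apply, Pi.add_apply, Pi.pow_apply, coeffInChart]
    rw [inChart_eq_smul (d₁.clearedForm_eq hv.2 hvZ), inChart_eq_smul (d₀.clearedForm_eq hv.2 hvZ)]
    change _ = _ + ξ v ^ m * _
    rw [← hsing]
    have hsub : planeCoeff (inChart (extDer α) p v) =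
        planeCoeff (inChart ω₁ p v) - planeCoeff (inChart ω₀ p v) := by
      unfold inChart pullback
      rw [← hd _ hvZ]; rfl
    rw [hsub, planeCoeff_smul, planeCoeff_smul]
    ring)
  simp only [Pi.sub_apply, Pi.mul_apply, Pi.add_apply, Pi.pow_apply, coeffInChart, hu₀,
    inChart_self] at key
  rw [key, ← hu₀, hinv, pow_eq_zero_of_mem d.defining hm hp hpZ, zero_mul, add_zero]

/-- At a point where the restriction of `|f|` to `Z` is maximal, the leading coefficients of
`ω₀` and `ω₁` agree: by Lagrange's multiplier rule `df` is a multiple of `dx` there. -/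
theorem planeCoeff_eq_of_isMax (hZ : IsHypersurface Plane Z) (hm : 1 ≤ m)
    (d₀ : IsBmDecomposition m Z r ω₀ U x α₀ β₀) (d₁ : IsBmDecomposition m Z r ω₁ U x α₁ β₁)
    (d : IsBmDecomposition m Z r α U x f β) (hα : ∀ q ∉ Z, FormDifferentiableAt α q)
    (hd : ∀ q ∉ Z, ω₁ q - ω₀ q = extDer α q) {p : M} (hp : p ∈ U) (hpZ : p ∈ Z)
    (hmax : ∀ᶠ q in 𝓝 p, q ∈ Z → |f q ![]| ≤ |f p ![]|) :
    planeCoeff (clearedForm m x α₁ β₁ p) = planeCoeff (clearedForm m x α₀ β₀ p) := by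
  have hmain := planeCoeff_sub_planeCoeff_eq hZ hm d₀ d₁ d hα hd hp hpZ
  have hu := mem_extChartAt_target (I := 𝓘(ℝ, Plane)) p
  have hinv := extChartAt_to_inv (I := 𝓘(ℝ, Plane)) p
  have hregular := d.defining.regular p hp
  rw [← differential_self (d.defining.mdifferentiableAt hp)] at hregular
  set u₀ := extChartAt 𝓘(ℝ, Plane) p p with hu₀
  set σ := (extChartAt 𝓘(ℝ, Plane) p).symm with hσ
  set ξ : Plane → ℝ := fun v => x (σ v) with hξdef
  set φ : Plane → ℝ := fun v => f (σ v) ![] with hφdef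
  have hUn : U ∈ 𝓝 (σ u₀) := by rw [hinv]; exact d.defining.isOpen.mem_nhds hp
  have hpU : σ u₀ ∈ U := by rwa [hinv]
  have hξ := d.defining.contDiffAt hu hpU
  have hφ := d.smooth_left.contDiffAt_function hu hUn
  have hxp : x p = 0 := (d.defining.zero_iff p hp).2 hpZ
  have hev : ∀ᶠ v in 𝓝[{v | ξ v = ξ u₀}] u₀, |φ v| ≤ |φ u₀| := by
    filter_upwards [self_mem_nhdsWithin, nhdsWithin_le_nhds (eventually_symm_mem hu
      (A := U ∩ {q | q ∈ Z → |f q ![]| ≤ |f p ![]|})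
      (by rw [hinv]; exact inter_mem (d.defining.isOpen.mem_nhds hp) hmax))] with v hv hv'
    have h1 : x (σ v) = 0 := by
      have : x (σ v) = x (σ u₀) := hv
      rw [this, hinv, hxp]
    have := hv'.2.2 ((d.defining.zero_iff _ hv'.2.1).1 h1)
    simpa only [hφdef, hinv] using this
  have hextr : IsLocalExtrOn φ {v | ξ v = ξ u₀} u₀ := by
    rcases le_total 0 (φ u₀) with h0 | h0
    · right
      filter_upwards [hev] with v hv
      rw [abs_of_nonneg h0] at hv
      exact (le_abs_self _).trans hv
    · left
      filter_upwards [hev] with v hv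
      rw [abs_of_nonpos h0] at hv
      linarith [neg_abs_le (φ v)]
  obtain ⟨a, b, hab, hlin⟩ := hextr.exists_multipliers_of_hasStrictFDerivAt_1d
    (hξ.hasStrictFDerivAt (by simp)) (hφ.hasStrictFDerivAt (by simp))
  have hb : b ≠ 0 := by
    rintro rfl
    rw [zero_smul, add_zero] at hlin
    rcases smul_eq_zero.1 hlin with h | h
    · exact hab (by rw [h]; rfl)
    · exact hregular h
  have hl : ∀ e, a * fderiv ℝ ξ u₀ e + b * fderiv ℝ φ u₀ e = 0 := fun e =>
    congrArg (fun L : Plane →L[ℝ] ℝ => L e) hlin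
  have h0 := hl (planeBasis 0)
  have h1 := hl (planeBasis 1)
  rw [← sub_eq_zero, hmain]
  apply mul_left_cancel₀ hb
  rw [mul_zero]
  linear_combination fderiv ℝ ξ u₀ (planeBasis 1) * h0 - fderiv ℝ ξ u₀ (planeBasis 0) * h1

/-- On `Z` the absolute value of the leading coefficient of a one-form does not depend
on the decomposition. -/
theorem abs_leading_eq (hZ : IsHypersurface Plane Z) (hm : 1 ≤ m)
    (d : IsBmDecomposition m Z r α U x f β) {U' : Set M} {x' : M → ℝ} {f' : DForm Plane M 0}
    {β' : DForm Plane M 1} (d' : IsBmDecomposition m Z r α U' x' f' β') {p : M} (hp : p ∈ U)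
    (hp' : p ∈ U') (hpZ : p ∈ Z) : |f p ![]| = |f' p ![]| := by
  obtain ⟨V, hV, hpV, f'', d'', ε, hε, hVε⟩ := d.exists_of_defining d'.defining d'.abs_eq hp hp'
  have hu := mem_extChartAt_target (I := 𝓘(ℝ, Plane)) p
  have hinv := extChartAt_to_inv (I := 𝓘(ℝ, Plane)) p
  have hVn : V ∈ 𝓝 ((extChartAt 𝓘(ℝ, Plane) p).symm (extChartAt 𝓘(ℝ, Plane) p p)) := by
    rw [hinv]; exact d''.defining.isOpen.mem_nhds hpV
  have hUn : U' ∈ 𝓝 ((extChartAt 𝓘(ℝ, Plane) p).symm (extChartAt 𝓘(ℝ, Plane) p p)) := by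
    rw [hinv]; exact d'.defining.isOpen.mem_nhds hp'
  have heq : clearedForm m x' f'' β p = clearedForm m x' f' β' p := by
    have := eq_of_frequently (hZ.frequently_symm_notMem hu)
      ((smoothFormOn_clearedForm (m := m) d''.defining d''.smooth_left
        d''.smooth_right).contDiffAt hu hVn).continuousAt
      ((smoothFormOn_clearedForm (m := m) d'.defining d'.smooth_left
        d'.smooth_right).contDiffAt hu hUn).continuousAt (by
      filter_upwards [eventually_symm_mem hu hVn] with v hv hvZ
      rw [inChart_eq_smul (d''.clearedForm_eq hv.2 hvZ),
        inChart_eq_smul (d'.clearedForm_eq (hV hv.2) hvZ)])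
    rwa [inChart_self, inChart_self] at this
  obtain ⟨n, hn⟩ : ∃ n, differential Plane x' p n ≠ 0 := by
    by_contra! hc
    exact d'.defining.regular p hp' (ContinuousLinearMap.ext hc)
  have h1 := congrArg (fun L : Plane [⋀^Fin 1]→L[ℝ] ℝ => L ![n]) heq
  unfold clearedForm at h1
  rw [pow_eq_zero_of_mem d'.defining hm hp' hpZ] at h1
  simp only [zero_smul, add_zero, dWedge_apply_one] at h1
  rw [← mul_right_cancel₀ hn h1, (hVε p hpV).2]
  change _ = |ε ^ (m + 1) * f p ![]|
  have hε1 : |ε| = 1 := by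
    have := congrArg abs hε
    rw [abs_mul, abs_one] at this
    nlinarith [abs_nonneg ε]
  rw [abs_mul, abs_pow, hε1, one_pow, one_mul]

/-- The set where the quotient `ω₁ / ω₀` is negative does not meet `Z`: at a point of it where the
leading coefficient of `α` along `Z` is largest in absolute value, `ω₀` and `ω₁` would have the same
leading coefficient. -/
theorem disjoint_of_ratio_neg [CompactSpace M] (hZ : IsHypersurface Plane Z) (hm : 1 ≤ m)
    (h₀ : IsBmSymplectic m Z r ω₀) (h₁ : IsBmSymplectic m Z r ω₁) (hα : IsBmForm m Z r α)
    (hd : ∀ q ∉ Z, ω₁ q - ω₀ q = extDer α q) {h : M → ℝ}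
    (hh : ∀ p U R₀ R₁ A g, IsCleared Z ω₀ ω₁ α U R₀ R₁ A g → p ∈ U → R₁ p = h p • R₀ p)
    (hN : IsClopen {p | h p < 0}) : ∀ p ∈ Z, 0 ≤ h p := by
  classical
  by_contra! hc
  obtain ⟨p₀, hp₀Z, hp₀⟩ := hc
  have hdata := fun p : Z => exists_common_decomposition h₀.isBmForm h₁.isBmForm hα p.2
  choose U x α₀ β₀ α₁ β₁ f β hpU d₀ d₁ d using hdata
  -- the absolute value of the leading coefficient of `α`, as a function on `Z`; the value `0`
  -- elsewhere plays no role
  set Φ : M → ℝ := fun p => if hp : p ∈ Z then |f ⟨p, hp⟩ p ![]| else 0 with hΦ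
  have hΦeq : ∀ (p : Z) (q : M), q ∈ Z → q ∈ U p → Φ q = |f p q ![]| := by
    intro p q hq hqU
    rw [hΦ]
    simp only [hq, dif_pos]
    exact abs_leading_eq hZ hm (d ⟨q, hq⟩) (d p) (hpU ⟨q, hq⟩) hqU hq
  have hΦc : ContinuousOn Φ Z := by
    intro p hp
    have h1 := ((d ⟨p, hp⟩).smooth_left.continuousAt_function
      ((d ⟨p, hp⟩).defining.isOpen.mem_nhds (hpU ⟨p, hp⟩))).abs
    refine h1.continuousWithinAt.congr_of_eventuallyEq ?_ (hΦeq ⟨p, hp⟩ p hp (hpU ⟨p, hp⟩))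
    filter_upwards [self_mem_nhdsWithin, nhdsWithin_le_nhds
      ((d ⟨p, hp⟩).defining.isOpen.mem_nhds (hpU ⟨p, hp⟩))] with q hq hqU
    exact hΦeq ⟨p, hp⟩ q hq hqU
  have hK : IsCompact (Z ∩ {p | h p < 0}) := (hZ.isClosed.inter hN.isClosed).isCompact
  obtain ⟨p, ⟨hpZ, hpN⟩, hmax⟩ := hK.exists_isMaxOn ⟨p₀, hp₀Z, hp₀⟩ (hΦc.mono inter_subset_left)
  have hextr := planeCoeff_eq_of_isMax hZ hm (d₀ ⟨p, hpZ⟩) (d₁ ⟨p, hpZ⟩) (d ⟨p, hpZ⟩)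
    (fun q hq => hα.smooth.formDifferentiableAt (hZ.isClosed.isOpen_compl.mem_nhds hq)) hd
    (hpU ⟨p, hpZ⟩) hpZ (by
      filter_upwards [hN.isOpen.mem_nhds hpN,
        (d ⟨p, hpZ⟩).defining.isOpen.mem_nhds (hpU ⟨p, hpZ⟩)] with q hqN hqU hqZ
      rw [← hΦeq ⟨p, hpZ⟩ q hqZ hqU, ← hΦeq ⟨p, hpZ⟩ p hpZ (hpU ⟨p, hpZ⟩)]
      exact hmax ⟨hqZ, hqN⟩)
  have hcl := isCleared_of_decomposition hm h₀ h₁ (d₀ ⟨p, hpZ⟩) (d₁ ⟨p, hpZ⟩) (d ⟨p, hpZ⟩)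
  rw [hh _ _ _ _ _ _ hcl (hpU ⟨p, hpZ⟩), planeCoeff_smul] at hextr
  have hne := hcl.ne₀ p (hpU ⟨p, hpZ⟩)
  have : h p = 1 := mul_right_cancel₀ hne (by rw [hextr, one_mul])
  have hpN' : h p < 0 := hpN
  linarith

/-- If `div X = 1 - h` with respect to an area form, then `h` is not negative on a nonempty clopen
set `N` disjoint from `Z`: otherwise the flow of `-X` would produce a diffeomorphism of `N` that
contracts areas by a factor of two. -/
theorem isEmpty_of_ratio_neg [T2Space M] [CompactSpace M] {η : DForm Plane M 2}
    (hη : SmoothFormOn η Zᶜ) (hη0 : ∀ p ∉ Z, η p ≠ 0) {X : M → Plane} (hX : SmoothField X)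
    {h : M → ℝ} (hs : SmoothScalar h) (hdiv : HasDivergence Z η X fun p => 1 - h p) {N : Set M}
    (hN : IsClopen N) (hNZ : ∀ p ∈ N, p ∉ Z) (hneg : ∀ p ∈ N, h p < 0) : N = ∅ := by
  classical
  by_contra hne
  -- the data for Moser's lemma vanish off `N`, and the complement of `N` takes the place of `Z`
  set Y : M → Plane := fun p => if p ∈ N then -X p else 0 with hY
  set θ : M → ℝ := fun p => if p ∈ N then h p - 1 else 0 with hθ
  have hYin : ∀ {c : M} {u : Plane}, u ∈ (extChartAt 𝓘(ℝ, Plane) c).target →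
      (extChartAt 𝓘(ℝ, Plane) c).symm u ∈ N →
      fieldInChart Y c =ᶠ[𝓝 u] fun v => -fieldInChart X c v := fun {c u} hu huN => by
    filter_upwards [eventually_symm_mem hu (hN.isOpen.mem_nhds huN)] with v hv
    simp only [fieldInChart, hY, if_pos hv.2, map_neg]
  have hYout : ∀ {c : M} {u : Plane}, u ∈ (extChartAt 𝓘(ℝ, Plane) c).target →
      (extChartAt 𝓘(ℝ, Plane) c).symm u ∉ N →
      fieldInChart Y c =ᶠ[𝓝 u] fun _ => 0 := fun {c u} hu huN => by
    filter_upwards [eventually_symm_mem hu (hN.isClosed.isOpen_compl.mem_nhds huN)] with v hv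
    simp only [fieldInChart, hY, if_neg hv.2, map_zero]
  have hYs : SmoothField Y := by
    intro c u hu
    have hX' := (hX c).contDiffAt ((isOpen_extChartAt_target c).mem_nhds hu)
    by_cases huN : (extChartAt 𝓘(ℝ, Plane) c).symm u ∈ N
    · exact (hX'.neg.congr_of_eventuallyEq (hYin hu huN)).contDiffWithinAt
    · exact (contDiffAt_const.congr_of_eventuallyEq (hYout hu huN)).contDiffWithinAt
  have hθs : SmoothScalar θ := by
    intro c u hu
    have hs' := (hs c).contDiffAt ((isOpen_extChartAt_target c).mem_nhds hu)
    by_cases huN : (extChartAt 𝓘(ℝ, Plane) c).symm u ∈ N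
    · have h1 : (fun v => θ ((extChartAt 𝓘(ℝ, Plane) c).symm v)) =ᶠ[𝓝 u] fun v =>
          h ((extChartAt 𝓘(ℝ, Plane) c).symm v) - 1 := by
        filter_upwards [eventually_symm_mem hu (hN.isOpen.mem_nhds huN)] with v hv
        simp only [hθ, if_pos hv.2]
      exact ((hs'.sub contDiffAt_const).congr_of_eventuallyEq h1).contDiffWithinAt
    · refine ((contDiffAt_const (c := (0 : ℝ))).congr_of_eventuallyEq ?_).contDiffWithinAt
      filter_upwards [eventually_symm_mem hu (hN.isClosed.isOpen_compl.mem_nhds huN)] with v hv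
      simp only [hθ, if_neg hv.2]
  have hdiv' : HasDivergence Nᶜ η Y θ := by
    intro c u hu huN
    rw [notMem_compl_iff] at huN
    have h1 := hdiv c u hu (hNZ _ huN)
    rw [(hYin hu huN).fderiv_eq, (hYin hu huN).self_of_nhds, fderiv_fun_neg]
    simp only [hθ, if_pos huN, planeTrace, map_neg, _root_.neg_apply, PiLp.neg_apply] at h1 ⊢
    linarith
  have htan : IsTangentTo Nᶜ Y := fun p hp =>
    ⟨Nᶜ, hN.isClosed.isOpen_compl.mem_nhds hp, fun _ => 0, 0, fun q hq =>
      ⟨mdifferentiableAt_const, by simpa using hq, by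
        have : Y q = 0 := if_neg hq
        rw [this, map_zero]; simp⟩⟩
  have hθ1 : ∀ p, θ p < 1 := fun p => by
    by_cases hp : p ∈ N
    · simp only [hθ, if_pos hp]; linarith [hneg p hp]
    · simp [hθ, if_neg hp]
  have hηN : SmoothFormOn η N := hη.mono hNZ
  obtain ⟨γ, hγ⟩ := exists_isMoserMap hN.isOpen.isClosed_compl (by rwa [compl_compl]) hYs hθs hdiv'
    htan hθ1
  refine false_of_area_contraction hN (nonempty_iff_ne_empty.2 hne) hηN
    (fun p hp => hη0 p (hNZ p hp)) γ (fun p => not_iff_not.1 (hγ.mem_iff p))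
    (l := fun q => 1 - 1 * θ q) (fun p hp => ?_) fun p hp => ?_
  · simp only [hθ, if_pos hp]; linarith [hneg p hp]
  · have := hγ.pullback_eq p (notMem_compl_iff.2 hp)
    rwa [zero_mul, sub_zero, one_smul] at this

end Positivity

/-! ### The field and the quotient for Moser's method -/

section EquivariantMoser

variable {M : Type*} [TopologicalSpace M] [ChartedSpace Plane M] [IsManifold 𝓘(ℝ, Plane) ∞ M]
  {m : ℕ} {Z : Set M} {r : M → ℝ} {ω₀ ω₁ : DForm Plane M 2}

/-- The data for Moser's method: a smooth vector field tangent to `Z` with `ι_X ω₀ = -α` off `Z`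
for a primitive `α` of `ω₁ - ω₀`, and a smooth positive function `h` with `ω₁ = h ω₀`. -/
theorem exists_moser_data [T2Space M] [CompactSpace M] (hm : 1 ≤ m) (hZ : IsHypersurface Plane Z)
    (h₀ : IsBmSymplectic m Z r ω₀) (h₁ : IsBmSymplectic m Z r ω₁) {α : DForm Plane M 1}
    (hα : IsBmForm m Z r α) (hd : ∀ q ∉ Z, ω₁ q - ω₀ q = extDer α q) :
    ∃ (X : M → Plane) (h : M → ℝ), SmoothField X ∧ SmoothScalar h ∧ IsTangentAlong Z X ∧
      (∀ p, 0 < h p) ∧ (∀ p ∉ Z, ω₁ p = h p • ω₀ p) ∧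
      (∀ p ∉ Z, ∀ v, ω₀ p ![X p, v] = -α p ![v]) ∧ ∀ p ∉ Z, extDer α p = -(1 - h p) • ω₀ p := by
  have hc := isCleared_compl hZ.isClosed h₀ h₁ hα
  obtain ⟨X, h, hX, hs, hXh⟩ := exists_field_and_ratio hZ (ω₀ := ω₀) (ω₁ := ω₁) (α := α) fun p => by
    by_cases hp : p ∈ Z
    · obtain ⟨U, x, α₀, β₀, α₁, β₁, f, β, hpU, d₀, d₁, d⟩ :=
        exists_common_decomposition h₀.isBmForm h₁.isBmForm hα hp
      exact ⟨_, _, _, _, _, hpU, isCleared_of_decomposition hm h₀ h₁ d₀ d₁ d⟩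
    · exact ⟨_, _, _, _, _, hp, hc⟩
  have hαd : ∀ q ∉ Z, FormDifferentiableAt α q := fun q hq =>
    hα.smooth.formDifferentiableAt (hZ.isClosed.isOpen_compl.mem_nhds hq)
  have hratio : ∀ p ∉ Z, ω₁ p = h p • ω₀ p := fun p hp => (hXh p _ _ _ _ _ hc hp).2.1
  have hcon : ∀ p ∉ Z, ∀ v, ω₀ p ![X p, v] = -α p ![v] := fun p hp => (hXh p _ _ _ _ _ hc hp).2.2
  have hext : ∀ p ∉ Z, extDer α p = -(1 - h p) • ω₀ p := fun p hp => by
    rw [← hd p hp, hratio p hp]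
    ext v
    simp
    ring
  have hne : ∀ p, h p ≠ 0 := fun p => by
    by_cases hp : p ∈ Z
    · obtain ⟨U, x, α₀, β₀, α₁, β₁, f, β, hpU, d₀, d₁, d⟩ :=
        exists_common_decomposition h₀.isBmForm h₁.isBmForm hα hp
      exact (hXh p _ _ _ _ _ (isCleared_of_decomposition hm h₀ h₁ d₀ d₁ d) hpU).1
    · exact (hXh p _ _ _ _ _ hc hp).1
  have htan : IsTangentAlong Z X := by
    intro p hp U x hpU hx
    obtain ⟨V, y, α₀, β₀, α₁, β₁, f, β, hpV, d₀, d₁, d⟩ :=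
      exists_common_decomposition h₀.isBmForm h₁.isBmForm hα hp
    have hcl := isCleared_of_decomposition hm h₀ h₁ d₀ d₁ d
    refine d.defining.differential_eq_zero hpV hp (hx.contMDiffAt hpU) ?_
      (differential_eq_zero_of_contraction hm d.defining (hcl.ne₀ p hpV) hpV hp
        (hXh p _ _ _ _ _ hcl hpV).2.2)
    filter_upwards [hx.isOpen.mem_nhds hpU] with q hq hqZ using (hx.zero_iff q hq).2 hqZ
  have hclopen : IsClopen {p | h p < 0} := by
    refine ⟨?_, isOpen_lt hs.continuous continuous_const⟩
    have : {p | h p < 0} = {p | h p ≤ 0} := by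
      ext p; exact ⟨fun hp => le_of_lt (α := ℝ) hp, fun hp => lt_of_le_of_ne (α := ℝ) hp (hne p)⟩
    rw [this]
    exact isClosed_le hs.continuous continuous_const
  have hNZ := disjoint_of_ratio_neg hZ hm h₀ h₁ hα hd (h := h)
    (fun p U R₀ R₁ A g hcl hp => (hXh p U R₀ R₁ A g hcl hp).2.1) hclopen
  have hempty := isEmpty_of_ratio_neg h₀.isBmForm.smooth
    (fun p hp h0 => h₀.planeCoeff_ne_zero hp (by rw [h0]; rfl)) hX hs
    (hasDivergence_of_contraction hZ.isClosed h₀.isBmForm.smooth hX hαd hcon hext) hclopen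
    (fun p hp hpZ => (hNZ p hpZ).not_gt hp) fun p hp => hp
  refine ⟨X, h, hX, hs, htan, fun p => ?_, hratio, hcon, hext⟩
  refine lt_of_le_of_ne (not_lt.1 fun hp => ?_) (hne p).symm
  have : p ∈ {p | h p < 0} := hp
  rw [hempty] at this
  exact this

/-- The quotient of two invariant area forms is invariant, also on `Z`, by continuity. -/
theorem ratio_smul_eq {F : Type*} [NormedAddCommGroup F] [NormedSpace ℝ F]
    {G : Type*} [Group G] [TopologicalSpace G] [ChartedSpace F G] [LieGroup 𝓘(ℝ, F) ∞ G]
    [MulAction G M] [ContMDiffSMul 𝓘(ℝ, F) 𝓘(ℝ, Plane) ∞ G M] (hZ : IsHypersurface Plane Z)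
    {h : M → ℝ} (hs : Continuous h) (hne : ∀ p ∉ Z, planeCoeff (ω₀ p) ≠ 0)
    (hratio : ∀ p ∉ Z, ω₁ p = h p • ω₀ p)
    (hinv₀ : IsInvariant G Z ω₀) (hinv₁ : IsInvariant G Z ω₁) (g : G) (p : M) :
    h (g • p) = h p := by
  refine eq_of_frequently (hZ.frequently_notMem p) (f := fun p => h (g • p))
    (hs.comp (contMDiff_smul_left F g).continuous).continuousAt hs.continuousAt
    (Eventually.of_forall fun q hq => ?_)
  have hgq : g • q ∉ Z := ((hinv₀ g).1 q).not.2 hq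
  have h1 := (hinv₁ g).2 q hq
  have h2 := (hinv₀ g).2 q hq
  unfold pullback at h1 h2
  simp only at h1 h2
  rw [hratio _ hgq, hratio _ hq, ← h2] at h1
  have h3 : h (g • q) • ω₀ q = h q • ω₀ q := by
    rw [← h2]; exact h1
  exact mul_right_cancel₀ (hne q hq) (congrArg planeCoeff h3)

end EquivariantMoser
end BmGeometry

end

theorem theorem4p1
    {S : Type*} [TopologicalSpace S] [ChartedSpace (EuclideanSpace ℝ (Fin 2)) S]
    [IsManifold 𝓘(ℝ, EuclideanSpace ℝ (Fin 2)) ∞ S] [T2Space S] [CompactSpace S]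
    {F : Type*} [NormedAddCommGroup F] [NormedSpace ℝ F] [FiniteDimensional ℝ F]
    {G : Type*} [Group G] [TopologicalSpace G] [ChartedSpace F G]
    [LieGroup 𝓘(ℝ, F) ∞ G] [T2Space G] [CompactSpace G] [MulAction G S]
    [ContMDiffSMul 𝓘(ℝ, F) 𝓘(ℝ, EuclideanSpace ℝ (Fin 2)) ∞ G S]
    (m : ℕ) (hm : 1 ≤ m)
    (Z : Set S) (hZ : BmGeometry.IsHypersurface (EuclideanSpace ℝ (Fin 2)) Z)
    (r : S → ℝ) (hr : BmGeometry.IsDistanceTo (EuclideanSpace ℝ (Fin 2)) Z r)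
    (ω₀ ω₁ : BmGeometry.DForm (EuclideanSpace ℝ (Fin 2)) S 2)
    (h₀ : BmGeometry.IsBmSymplectic m Z r ω₀) (h₁ : BmGeometry.IsBmSymplectic m Z r ω₁)
    (hinv₀ : BmGeometry.IsInvariant G Z ω₀) (hinv₁ : BmGeometry.IsInvariant G Z ω₁)
    (hclass : BmGeometry.SameBmClass m Z r ω₀ ω₁) :
    ∃ γ : Diffeomorph 𝓘(ℝ, EuclideanSpace ℝ (Fin 2)) 𝓘(ℝ, EuclideanSpace ℝ (Fin 2)) S S ∞,
      (∀ (g : G) (p : S), γ (g • p) = g • γ p) ∧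
      γ '' Z = Z ∧
      BmGeometry.PullsBackTo Z γ ω₁ ω₀ := by
  open BmGeometry in
  obtain ⟨α, hα, hd⟩ := hclass
  obtain ⟨X, h, hX, hs, htan, hpos, hratio, hcon, hext⟩ := exists_moser_data hm hZ h₀ h₁ hα hd
  have hαd : ∀ q ∉ Z, FormDifferentiableAt α q := fun q hq =>
    hα.smooth.formDifferentiableAt (hZ.isClosed.isOpen_compl.mem_nhds hq)
  have hhinv : ∀ (g : G) p, h (g • p) = h p := ratio_smul_eq (F := F) hZ hs.continuous
    (fun p hp => h₀.planeCoeff_ne_zero hp) hratio hinv₀ hinv₁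
  have hθ : SmoothScalar fun p => 1 - h p := fun c => contDiffOn_const.sub (hs c)
  have htop : IsTopologicalGroup G := topologicalGroup_of_lieGroup 𝓘(ℝ, F) ∞
  let _ : MeasurableSpace G := borel G
  have : BorelSpace G := ⟨rfl⟩
  set μ : MeasureTheory.Measure G := MeasureTheory.Measure.haarMeasure ⊤
  have : MeasureTheory.IsProbabilityMeasure μ :=
    ⟨MeasureTheory.Measure.haarMeasure_self (K₀ := (⊤ : TopologicalSpace.PositiveCompacts G))⟩
  have hXav := smoothField_averageField F μ hX
  obtain ⟨γ, hγ⟩ := exists_isMoserMap hZ.isClosed h₀.isBmForm.smooth hXav hθ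
    (hasDivergence_averageField F μ hX (hasDivergence_translateField F hZ.isClosed
      h₀.isBmForm.smooth hX hαd hcon hext hinv₀ fun g p => by rw [hhinv g p]))
    ((isTangentAlong_averageField F μ hX fun g =>
      isTangentAlong_translateField F hZ htan (hinv₀ g).1).isTangentTo hZ hXav)
    fun p => by linarith [hpos p]
  refine ⟨γ, fun g p => hγ.comm _ (mdifferentiable_smul_left F g)
    (tangentMapAt_averageField F μ hX g) (fun p => by rw [hhinv g p]) p, ?_, hγ.mem_iff, ?_⟩
  · ext p
    constructor
    · rintro ⟨q, hq, rfl⟩; exact (hγ.mem_iff q).2 hq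
    · intro hp
      exact ⟨γ.symm p, (hγ.mem_iff _).1 (by rwa [γ.apply_symm_apply]), γ.apply_symm_apply p⟩
  · intro p hp
    have h1 := hγ.pullback_eq p hp
    rw [zero_mul, sub_zero, one_smul] at h1
    rw [← h1]
    unfold pullback
    simp only [one_mul, sub_sub_cancel]
    rw [← hratio _ ((hγ.mem_iff p).not.2 hp)]
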